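/- Let $G\rightrightarrows M$ be a (finite-dimensional, real, smooth) Lie groupoid with source $s$, target $t$ and unit map $x\mapsto 1_x$, where $M$ is Hausdorff and $G$ need not be. Let $A\to M$ be its Lie algebroid: $A_x=\ker (ds)_{1_x}$, the anchor is $\rho_A=dt|_A$, and the bracket of sections is induced by the commutator of right invariant vector fields on $G$. A Nijenhuis operator on $M$ is a smooth $(1,1)$ tensor $\mathcal N:TM\to TM$ such that $[\mathcal NX,\mathcal NY]+\mathcal N^2[X,Y]-\mathcal N[\mathcal NX,Y]-\mathcal N[X,\mathcal NY]=0$ for all vector fields $X,Y$; it defines the Lie algebroid $(TM)_{\mathcal N}$ with underlying vector bundle $TM$, anchor $\mathcal N$ and bracket $[X,Y]_{\mathcal N}=[\mathcal NX,Y]+[X,\mathcal NY]-\mathcal N[X,Y]$. One says that $G$ integrates $\mathcal N$ if there is a Lie algebroid isomorphism $A\cong (TM)_{\mathcal N}$ (over the identity of $M$). For a vector bundle map $U:TM\to A$ over $M$ put, at $g\in G$, $$\overrightarrow U_g=dR_g\circ U_{t(g)}\circ dt,\qquad \overleftarrow U_g=dL_g\circ di\circ U_{s(g)}\circ ds,\qquad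 \delta U=\overrightarrow U+\overleftarrow U,$$ where $R_g$, $L_g$ are the right and left translations by $g$ and $i$ is the inversion. The Lie groupoid $G$ integrates some Nijenhuis operator on $M$ if and only if there exists a (smooth) vector bundle map $U:TM\to A$ such that 1. $\ker\overrightarrow U=\ker dt$ and $\operatorname{im}\overrightarrow U=\ker ds$ (at every point of $G$); 2. the Frölicher–Nijenhuis bracket $[\overrightarrow U,\overrightarrow U]^{\mathrm{fn}}$ vanishes. Moreover, for every $U$ satisfying 1. and 2., there is a $(1,1)$ tensor $\mathcal N$ on $M$ (necessarily unique) to which $\delta U$ is both $s$-related and $t$-related, i.e. $\mathcal N=s_*\delta U=t_*\delta U$; this $\mathcal N$ is a Nijenhuis operator; $U$ is an isomorphism between the Lie algebroids $(TM)_{\mathcal N}$ and $A$; and, under the identification of $TM$ with $A$ by $U$, the derivative $\dot{\delta U}:TA\to TA$ of $\delta U$ is the tangent lift $\mathcal N^{\mathrm{tan}}:TTM\to TTM$ of $\mathcal N$, that is, $dU\circ\mathcal N^{\mathrm{tan}}=\dot{\delta U}\circ dU$. Here, with $\kappa$ the canonical flip of a double tangent bundle, $\mathcal N^{\mathrm{tan}}=\kappa\circ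 d\mathcal N\circ\kappa$, and $\dot{\delta U}$ is the restriction of $\kappa\circ d(\delta U)\circ\kappa:TTG\to TTG$ to $TA\subset TTG$ (the image of the groupoid map $\delta U:TG\to TG$ under the Lie functor). -/

import Mathlib

open scoped Manifold ContDiff

noncomputable section

namespace NijenhuisGroupoid

/-! ### (1,1) tensors, the Frölicher–Nijenhuis bracket and the tangent lift -/

section Tensors

variable {E : Type*} [NormedAddCommGroup E] [NormedSpace ℝ E]
  {M : Type*} [TopologicalSpace M] [ChartedSpace E M]

/-- The vector field `X` on `M`, as a map `M → TM`, is smooth at `x`. -/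
def SmoothFieldAt (X : ∀ x : M, TangentSpace 𝓘(ℝ, E) x) (x : M) [IsManifold 𝓘(ℝ, E) ∞ M] : Prop :=
  ContMDiffAt 𝓘(ℝ, E) 𝓘(ℝ, E).tangent ∞
    (fun y => (⟨y, X y⟩ : TangentBundle 𝓘(ℝ, E) M)) x

/-- `X` is a smooth vector field on `M`. -/
def SmoothField (X : ∀ x : M, TangentSpace 𝓘(ℝ, E) x) [IsManifold 𝓘(ℝ, E) ∞ M] : Prop :=
  ContMDiff 𝓘(ℝ, E) 𝓘(ℝ, E).tangent ∞
    (fun y => (⟨y, X y⟩ : TangentBundle 𝓘(ℝ, E) M))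

/-- A field of endomorphisms of the tangent spaces, as a map `TM → TM`. -/
def totalMap (K : ∀ x : M, TangentSpace 𝓘(ℝ, E) x →L[ℝ] TangentSpace 𝓘(ℝ, E) x)
    (p : TangentBundle 𝓘(ℝ, E) M) : TangentBundle 𝓘(ℝ, E) M :=
  ⟨p.1, K p.1 p.2⟩

/-- `K` is a (smooth) `(1,1)` tensor on `M`, i.e. a smooth vector bundle map `TM → TM` over `M`. -/
def SmoothTensor (K : ∀ x : M, TangentSpace 𝓘(ℝ, E) x →L[ℝ] TangentSpace 𝓘(ℝ, E) x)
    [IsManifold 𝓘(ℝ, E) ∞ M] : Prop :=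
  ContMDiff 𝓘(ℝ, E).tangent 𝓘(ℝ, E).tangent ∞ (totalMap K)

/-- The value at `x` of the Frölicher–Nijenhuis bracket of two `(1,1)` tensors `K`, `L` (a vector
valued 2-form), evaluated on the vector fields `X`, `Y`. -/
def fnBracket (K L : ∀ x : M, TangentSpace 𝓘(ℝ, E) x →L[ℝ] TangentSpace 𝓘(ℝ, E) x)
    (X Y : ∀ x : M, TangentSpace 𝓘(ℝ, E) x) (x : M) : TangentSpace 𝓘(ℝ, E) x :=
  VectorField.mlieBracket 𝓘(ℝ, E) (fun y => K y (X y)) (fun y => L y (Y y)) x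
    + VectorField.mlieBracket 𝓘(ℝ, E) (fun y => L y (X y)) (fun y => K y (Y y)) x
    + K x (L x (VectorField.mlieBracket 𝓘(ℝ, E) X Y x))
    + L x (K x (VectorField.mlieBracket 𝓘(ℝ, E) X Y x))
    - K x (VectorField.mlieBracket 𝓘(ℝ, E) (fun y => L y (X y)) Y x
        + VectorField.mlieBracket 𝓘(ℝ, E) X (fun y => L y (Y y)) x)
    - L x (VectorField.mlieBracket 𝓘(ℝ, E) (fun y => K y (X y)) Y x
        + VectorField.mlieBracket 𝓘(ℝ, E) X (fun y => K y (Y y)) x)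

/-- `[K, L] = 0` for the Frölicher–Nijenhuis bracket. Local vector fields are used (only their germs
at `x` matter), so that the definition is also correct on non-Hausdorff manifolds. -/
def FNBracketVanishes (K L : ∀ x : M, TangentSpace 𝓘(ℝ, E) x →L[ℝ] TangentSpace 𝓘(ℝ, E) x)
    [IsManifold 𝓘(ℝ, E) ∞ M] : Prop :=
  ∀ (x : M) (X Y : ∀ y : M, TangentSpace 𝓘(ℝ, E) y),
    SmoothFieldAt X x → SmoothFieldAt Y x → fnBracket K L X Y x = 0

/-- The Nijenhuis torsion
`T_N(X, Y) = [N X, N Y] + N² [X, Y] - N [N X, Y] - N [X, N Y]`, evaluated at `x`. -/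
def torsion (N : ∀ x : M, TangentSpace 𝓘(ℝ, E) x →L[ℝ] TangentSpace 𝓘(ℝ, E) x)
    (X Y : ∀ x : M, TangentSpace 𝓘(ℝ, E) x) (x : M) : TangentSpace 𝓘(ℝ, E) x :=
  VectorField.mlieBracket 𝓘(ℝ, E) (fun y => N y (X y)) (fun y => N y (Y y)) x
    + N x (N x (VectorField.mlieBracket 𝓘(ℝ, E) X Y x))
    - N x (VectorField.mlieBracket 𝓘(ℝ, E) (fun y => N y (X y)) Y x)
    - N x (VectorField.mlieBracket 𝓘(ℝ, E) X (fun y => N y (Y y)) x)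

/-- `N` is a Nijenhuis operator: a smooth `(1,1)` tensor with vanishing Nijenhuis torsion. -/
structure IsNijenhuis (N : ∀ x : M, TangentSpace 𝓘(ℝ, E) x →L[ℝ] TangentSpace 𝓘(ℝ, E) x)
    [IsManifold 𝓘(ℝ, E) ∞ M] : Prop where
  smooth : SmoothTensor N
  torsion_eq_zero : ∀ (x : M) (X Y : ∀ y : M, TangentSpace 𝓘(ℝ, E) y),
    SmoothFieldAt X x → SmoothFieldAt Y x → torsion N X Y x = 0

/-- The Lie bracket `[X, Y]_N = [N X, Y] + [X, N Y] - N [X, Y]` of the Lie algebroid `(TM)_N`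
(whose anchor is `N`). -/
def bracketN (N : ∀ x : M, TangentSpace 𝓘(ℝ, E) x →L[ℝ] TangentSpace 𝓘(ℝ, E) x)
    (X Y : ∀ x : M, TangentSpace 𝓘(ℝ, E) x) (x : M) : TangentSpace 𝓘(ℝ, E) x :=
  VectorField.mlieBracket 𝓘(ℝ, E) (fun y => N y (X y)) Y x
    + VectorField.mlieBracket 𝓘(ℝ, E) X (fun y => N y (Y y)) x
    - N x (VectorField.mlieBracket 𝓘(ℝ, E) X Y x)

/-- The canonical flip `κ : TTM → TTM`, `(x, v; w, z) ↦ (x, w; v, z)` in the coordinates of `TTM`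
induced by a chart of `M`. The preferred chart of `TM` at `(x, v)` is the one induced by the
preferred chart of `M` at `x` (for every `v`), and `T_x M = E`, `T_(x, v) TM = E × E` are the
identifications given by these charts, so the coordinate formula can be used verbatim. -/
def canonicalFlip [IsManifold 𝓘(ℝ, E) ∞ M]
    (z : TangentBundle 𝓘(ℝ, E).tangent (TangentBundle 𝓘(ℝ, E) M)) :
    TangentBundle 𝓘(ℝ, E).tangent (TangentBundle 𝓘(ℝ, E) M) :=
  let w : E × E := z.2
  let v : E := z.1.2
  ⟨⟨z.1.1, (w.1 : E)⟩, ((v, w.2) : E × E)⟩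

/-- The tangent (complete) lift `K^tan = κ ∘ dK ∘ κ : TTM → TTM` of a `(1,1)` tensor `K : TM → TM`.
It is the linear `(1,1)` tensor on `TM` that projects to `K` and satisfies
`K^tan (Y↑) = (K Y)↑` and `L_{Y↑} K^tan = (L_Y K)↑` for all vector fields `Y`, where `↑` is the
vertical lift and `L_Y K = [Y, K]` is the Frölicher–Nijenhuis bracket. -/
def tangentLift [IsManifold 𝓘(ℝ, E) ∞ M]
    (K : ∀ x : M, TangentSpace 𝓘(ℝ, E) x →L[ℝ] TangentSpace 𝓘(ℝ, E) x)
    (z : TangentBundle 𝓘(ℝ, E).tangent (TangentBundle 𝓘(ℝ, E) M)) :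
    TangentBundle 𝓘(ℝ, E).tangent (TangentBundle 𝓘(ℝ, E) M) :=
  canonicalFlip (tangentMap 𝓘(ℝ, E).tangent 𝓘(ℝ, E).tangent (totalMap K) (canonicalFlip z))

end Tensors

/-! ### Lie groupoids -/

/-- A Lie groupoid `G ⇉ M`. Only the values `mul g h` with `src g = tgt h` are meaningful (`g h` is
"first `h`, then `g`"), and `mul` is smooth on the submanifold of composable pairs. The space of
arrows need not be Hausdorff. -/
structure LieGroupoid (E F M G : Type*) [NormedAddCommGroup E] [NormedSpace ℝ E]
    [NormedAddCommGroup F] [NormedSpace ℝ F]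
    [TopologicalSpace M] [ChartedSpace E M] [TopologicalSpace G] [ChartedSpace F G] where
  src : G → M
  tgt : G → M
  unit : M → G
  inv : G → G
  mul : G → G → G
  src_unit : ∀ x, src (unit x) = x
  tgt_unit : ∀ x, tgt (unit x) = x
  src_mul : ∀ g h, src g = tgt h → src (mul g h) = src h
  tgt_mul : ∀ g h, src g = tgt h → tgt (mul g h) = tgt g
  mul_assoc : ∀ g h k, src g = tgt h → src h = tgt k → mul (mul g h) k = mul g (mul h k)
  unit_mul : ∀ g, mul (unit (tgt g)) g = g
  mul_unit : ∀ g, mul g (unit (src g)) = g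
  src_inv : ∀ g, src (inv g) = tgt g
  tgt_inv : ∀ g, tgt (inv g) = src g
  inv_mul : ∀ g, mul (inv g) g = unit (src g)
  mul_inv : ∀ g, mul g (inv g) = unit (tgt g)
  isSubmersion_src : Manifold.IsSubmersion 𝓘(ℝ, F) 𝓘(ℝ, E) ∞ src
  isSubmersion_tgt : Manifold.IsSubmersion 𝓘(ℝ, F) 𝓘(ℝ, E) ∞ tgt
  smooth_unit : ContMDiff 𝓘(ℝ, E) 𝓘(ℝ, F) ∞ unit
  smooth_inv : ContMDiff 𝓘(ℝ, F) 𝓘(ℝ, F) ∞ inv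
  smooth_mul : ContMDiffOn (𝓘(ℝ, F).prod 𝓘(ℝ, F)) 𝓘(ℝ, F) ∞
    (fun p : G × G => mul p.1 p.2) {p : G × G | src p.1 = tgt p.2}

namespace LieGroupoid

variable {E F : Type*} [NormedAddCommGroup E] [NormedSpace ℝ E]
  [NormedAddCommGroup F] [NormedSpace ℝ F]
  {M G : Type*} [TopologicalSpace M] [ChartedSpace E M] [TopologicalSpace G] [ChartedSpace F G]
  (Γ : LieGroupoid E F M G)

/-- `T^s G = ker ds` at `g`. -/
def kerSrc (g : G) : Submodule ℝ (TangentSpace 𝓘(ℝ, F) g) :=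
  LinearMap.ker (mfderiv 𝓘(ℝ, F) 𝓘(ℝ, E) Γ.src g).toLinearMap

/-- `T^t G = ker dt` at `g`. -/
def kerTgt (g : G) : Submodule ℝ (TangentSpace 𝓘(ℝ, F) g) :=
  LinearMap.ker (mfderiv 𝓘(ℝ, F) 𝓘(ℝ, E) Γ.tgt g).toLinearMap

/-- The fibre at `x` of the Lie algebroid `A` of `G`: the kernel of `ds` at the unit of `x`.
As a vector bundle, `A` is an embedded submanifold of `TG`, so that a map to `A` is smooth iff it is
smooth as a map to `TG`. -/
abbrev Alg (x : M) : Submodule ℝ (TangentSpace 𝓘(ℝ, F) (Γ.unit x)) :=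
  Γ.kerSrc (Γ.unit x)

/-- The anchor `ρ : A → TM`, the restriction of `dt` (and `t (1_x) = x`). -/
def anchor (x : M) : Γ.Alg x →L[ℝ] TangentSpace 𝓘(ℝ, E) x :=
  ContinuousLinearMap.comp
    (show TangentSpace 𝓘(ℝ, F) (Γ.unit x) →L[ℝ] TangentSpace 𝓘(ℝ, E) x from
      mfderiv 𝓘(ℝ, F) 𝓘(ℝ, E) Γ.tgt (Γ.unit x))
    (Γ.Alg x).subtypeL

/-- The differential at the unit `1_{t(g)}` of the right translation `R_g : h ↦ h g`, defined on the
`s`-fibre over `t(g)`, with values in `T_g G` (as `1_{t(g)} g = g`). The set is a submanifold with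
tangent space `A_{t(g)}` at the unit, so this is well determined by `R_g` on `A_{t(g)}`, and it is
only applied there. -/
def dR (g : G) : Γ.Alg (Γ.tgt g) →L[ℝ] TangentSpace 𝓘(ℝ, F) g :=
  ContinuousLinearMap.comp
    (show TangentSpace 𝓘(ℝ, F) (Γ.unit (Γ.tgt g)) →L[ℝ] TangentSpace 𝓘(ℝ, F) g from
      mfderivWithin 𝓘(ℝ, F) 𝓘(ℝ, F) (fun h => Γ.mul h g) {h | Γ.src h = Γ.tgt g}
        (Γ.unit (Γ.tgt g)))
    (Γ.Alg (Γ.tgt g)).subtypeL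

/-- The differential at the unit `1_{s(g)}` of the left translation `L_g : h ↦ g h`, defined on the
`t`-fibre over `s(g)`, with values in `T_g G` (as `g 1_{s(g)} = g`). It is well determined by `L_g`
on the tangent space `ker dt` of that fibre, and it is only applied there. -/
def dL (g : G) : TangentSpace 𝓘(ℝ, F) (Γ.unit (Γ.src g)) →L[ℝ] TangentSpace 𝓘(ℝ, F) g :=
  mfderivWithin 𝓘(ℝ, F) 𝓘(ℝ, F) (fun h => Γ.mul g h) {h | Γ.tgt h = Γ.src g}
    (Γ.unit (Γ.src g))

/-- The differential of the inversion at the unit `1_x`, restricted to `A_x`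
(and `1_x⁻¹ = 1_x`). -/
def dInv (x : M) : Γ.Alg x →L[ℝ] TangentSpace 𝓘(ℝ, F) (Γ.unit x) :=
  ContinuousLinearMap.comp
    (show TangentSpace 𝓘(ℝ, F) (Γ.unit x) →L[ℝ] TangentSpace 𝓘(ℝ, F) (Γ.unit x) from
      mfderiv 𝓘(ℝ, F) 𝓘(ℝ, F) Γ.inv (Γ.unit x))
    (Γ.Alg x).subtypeL

/-- The right invariant vector field on `G` of a section `a` of `A`. -/
def rightInvariant (a : ∀ x : M, Γ.Alg x) (g : G) : TangentSpace 𝓘(ℝ, F) g :=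
  Γ.dR g (a (Γ.tgt g))

/-- The Lie bracket of two sections of `A`: the restriction to the units of the commutator of the
corresponding right invariant vector fields. -/
def bracket (a b : ∀ x : M, Γ.Alg x) (x : M) : TangentSpace 𝓘(ℝ, F) (Γ.unit x) :=
  VectorField.mlieBracket 𝓘(ℝ, F) (Γ.rightInvariant a) (Γ.rightInvariant b) (Γ.unit x)

/-- `a` is a smooth section of `A`. -/
def SmoothSection [IsManifold 𝓘(ℝ, F) ∞ G] (a : ∀ x : M, Γ.Alg x) : Prop :=
  ContMDiff 𝓘(ℝ, E) 𝓘(ℝ, F).tangent ∞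
    (fun x => (⟨Γ.unit x, (a x : TangentSpace 𝓘(ℝ, F) (Γ.unit x))⟩ : TangentBundle 𝓘(ℝ, F) G))

/-- A fibrewise linear map `TM → A` over `M`, as a map `TM → TG`. -/
def bundleMap (U : ∀ x : M, TangentSpace 𝓘(ℝ, E) x →L[ℝ] Γ.Alg x)
    (p : TangentBundle 𝓘(ℝ, E) M) : TangentBundle 𝓘(ℝ, F) G :=
  ⟨Γ.unit p.1, (U p.1 p.2 : TangentSpace 𝓘(ℝ, F) (Γ.unit p.1))⟩

/-- `U` is a (smooth) vector bundle map `TM → A` over `M`. -/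
def IsBundleMap [IsManifold 𝓘(ℝ, E) ∞ M] [IsManifold 𝓘(ℝ, F) ∞ G]
    (U : ∀ x : M, TangentSpace 𝓘(ℝ, E) x →L[ℝ] Γ.Alg x) : Prop :=
  ContMDiff 𝓘(ℝ, E).tangent 𝓘(ℝ, F).tangent ∞ (Γ.bundleMap U)

/-- The right invariant lift of `U`: at `g` it is `dR_g ∘ U_{t(g)} ∘ dt`. -/
def rightLift (U : ∀ x : M, TangentSpace 𝓘(ℝ, E) x →L[ℝ] Γ.Alg x) (g : G) :
    TangentSpace 𝓘(ℝ, F) g →L[ℝ] TangentSpace 𝓘(ℝ, F) g :=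
  (Γ.dR g).comp ((U (Γ.tgt g)).comp (mfderiv 𝓘(ℝ, F) 𝓘(ℝ, E) Γ.tgt g))

/-- The left invariant lift of `U`: at `g` it is `dL_g ∘ di ∘ U_{s(g)} ∘ ds`. -/
def leftLift (U : ∀ x : M, TangentSpace 𝓘(ℝ, E) x →L[ℝ] Γ.Alg x) (g : G) :
    TangentSpace 𝓘(ℝ, F) g →L[ℝ] TangentSpace 𝓘(ℝ, F) g :=
  (Γ.dL g).comp ((Γ.dInv (Γ.src g)).comp
    ((U (Γ.src g)).comp (mfderiv 𝓘(ℝ, F) 𝓘(ℝ, E) Γ.src g)))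

/-- `δU`, the sum of the right and the left invariant lift of `U`. -/
def delta (U : ∀ x : M, TangentSpace 𝓘(ℝ, E) x →L[ℝ] Γ.Alg x) (g : G) :
    TangentSpace 𝓘(ℝ, F) g →L[ℝ] TangentSpace 𝓘(ℝ, F) g :=
  Γ.rightLift U g + Γ.leftLift U g

/-- The field of endomorphisms `T` on `G` is `s`-related to `N` on `M`: `ds ∘ T = N ∘ ds`. As `s` is
a surjective submersion, there is at most one such `N`, denoted `s_* T`. -/
def SrcRelated (T : ∀ g : G, TangentSpace 𝓘(ℝ, F) g →L[ℝ] TangentSpace 𝓘(ℝ, F) g)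
    (N : ∀ x : M, TangentSpace 𝓘(ℝ, E) x →L[ℝ] TangentSpace 𝓘(ℝ, E) x) : Prop :=
  ∀ g : G, (mfderiv 𝓘(ℝ, F) 𝓘(ℝ, E) Γ.src g).comp (T g)
    = (N (Γ.src g)).comp (mfderiv 𝓘(ℝ, F) 𝓘(ℝ, E) Γ.src g)

/-- The field of endomorphisms `T` on `G` is `t`-related to `N` on `M`: `dt ∘ T = N ∘ dt`. As `t` is
a surjective submersion, there is at most one such `N`, denoted `t_* T`. -/
def TgtRelated (T : ∀ g : G, TangentSpace 𝓘(ℝ, F) g →L[ℝ] TangentSpace 𝓘(ℝ, F) g)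
    (N : ∀ x : M, TangentSpace 𝓘(ℝ, E) x →L[ℝ] TangentSpace 𝓘(ℝ, E) x) : Prop :=
  ∀ g : G, (mfderiv 𝓘(ℝ, F) 𝓘(ℝ, E) Γ.tgt g).comp (T g)
    = (N (Γ.tgt g)).comp (mfderiv 𝓘(ℝ, F) 𝓘(ℝ, E) Γ.tgt g)

/-- `U` is an isomorphism between the Lie algebroid `(TM)_N` (anchor `N`, bracket `[-,-]_N`) and the
Lie algebroid `A` of `G`: an isomorphism of vector bundles over `M` (smooth, fibrewise bijective,
and with an inverse that maps smooth sections to smooth sections) that preserves anchors and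
brackets. -/
structure IsLieAlgebroidIso [IsManifold 𝓘(ℝ, E) ∞ M] [IsManifold 𝓘(ℝ, F) ∞ G]
    (N : ∀ x : M, TangentSpace 𝓘(ℝ, E) x →L[ℝ] TangentSpace 𝓘(ℝ, E) x)
    (U : ∀ x : M, TangentSpace 𝓘(ℝ, E) x →L[ℝ] Γ.Alg x) : Prop where
  isBundleMap : Γ.IsBundleMap U
  bijective : ∀ x : M, Function.Bijective (U x)
  smooth_inverse : ∀ X : ∀ x : M, TangentSpace 𝓘(ℝ, E) x,
    Γ.SmoothSection (fun x => U x (X x)) → SmoothField X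
  map_anchor : ∀ (x : M) (v : TangentSpace 𝓘(ℝ, E) x), Γ.anchor x (U x v) = N x v
  map_bracket : ∀ X Y : ∀ x : M, TangentSpace 𝓘(ℝ, E) x, SmoothField X → SmoothField Y →
    ∀ x : M, (U x (bracketN N X Y x) : TangentSpace 𝓘(ℝ, F) (Γ.unit x))
      = Γ.bracket (fun y => U y (X y)) (fun y => U y (Y y)) x

/-- `G` integrates `N`: the Lie algebroid of `G` is isomorphic to `(TM)_N`. -/
def Integrates [IsManifold 𝓘(ℝ, E) ∞ M] [IsManifold 𝓘(ℝ, F) ∞ G]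
    (N : ∀ x : M, TangentSpace 𝓘(ℝ, E) x →L[ℝ] TangentSpace 𝓘(ℝ, E) x) : Prop :=
  ∃ Φ : ∀ x : M, TangentSpace 𝓘(ℝ, E) x →L[ℝ] Γ.Alg x, Γ.IsLieAlgebroidIso N Φ

/-- `U` is a vector bundle map `TM → A` whose right invariant lift has kernel `T^t G`, image `T^s G`
and vanishing Frölicher–Nijenhuis bracket with itself. -/
structure IsIntegratingMap [IsManifold 𝓘(ℝ, E) ∞ M] [IsManifold 𝓘(ℝ, F) ∞ G]
    (U : ∀ x : M, TangentSpace 𝓘(ℝ, E) x →L[ℝ] Γ.Alg x) : Prop where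
  isBundleMap : Γ.IsBundleMap U
  ker_eq : ∀ g : G, LinearMap.ker (Γ.rightLift U g).toLinearMap = Γ.kerTgt g
  range_eq : ∀ g : G, LinearMap.range (Γ.rightLift U g).toLinearMap = Γ.kerSrc g
  fnBracket_eq_zero : FNBracketVanishes (Γ.rightLift U) (Γ.rightLift U)

/-- The derivative `Ṫ : TA → TA` of a multiplicative `(1,1)` tensor `T` on `G`, that is, of a
groupoid map `T : TG → TG` for the tangent groupoid `TG ⇉ TM`. The Lie functor sends `T` to the
restriction of `dT : TTG → TTG` to the Lie algebroid of `TG` (a subset of `TTG`), which is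
identified with `TA` (another subset of `TTG`) by the canonical flip `κ` of `TTG`. The formula
`κ ∘ dT ∘ κ` makes sense on all of `TTG`; `Ṫ` is its restriction to `TA`. -/
def derivative [IsManifold 𝓘(ℝ, F) ∞ G] (_Γ : LieGroupoid E F M G)
    (T : ∀ g : G, TangentSpace 𝓘(ℝ, F) g →L[ℝ] TangentSpace 𝓘(ℝ, F) g)
    (z : TangentBundle 𝓘(ℝ, F).tangent (TangentBundle 𝓘(ℝ, F) G)) :
    TangentBundle 𝓘(ℝ, F).tangent (TangentBundle 𝓘(ℝ, F) G) :=
  canonicalFlip (tangentMap 𝓘(ℝ, F).tangent 𝓘(ℝ, F).tangent (totalMap T) (canonicalFlip z))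

end LieGroupoid

end NijenhuisGroupoid

end

/-!
# Lie groupoids integrating Nijenhuis operators

Write `R`, `L` for the right and left invariant lifts of a vector bundle map `U : TM → A`,
`T = δU = R + L`, and `N = ρ ∘ U` (`anchorTensor U`) for its composition with the anchor.

*The equivalence.* At `g`, the lift `R` is the composition of the surjective map `dt`, of `U` at
`t(g)`, and of `dR_g`, which is an isomorphism from `A` at `t(g)` onto `ker ds`
(`LieGroupoid.dR_injective`, `LieGroupoid.exists_dR_eq`). So the condition on the kernel and the
image of `R` says that `U` is fibrewise bijective. The bracket `[R, R]` is twice the Nijenhuis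
torsion of `R` (`fnBracket_self`). On vector fields that are `t`-related to fields `X₀`, `Y₀` on `M`,
the torsion of `R` is the right invariant vector field of `[U X₀, U Y₀] - U [X₀, Y₀]_N`
(`LieGroupoid.torsion_rightLift`), because `R` maps such fields to right invariant ones and
`dt ∘ R = N ∘ dt`. As the torsion is a tensor (`torsion_congr`) and vector fields on `M` lift along
submersions with prescribed value at a point (`exists_lift`), it vanishes if and only if `U`
preserves brackets. Finally `dt` maps the torsion of `R` to that of `N`
(`mfderiv_torsion_of_related`), so that `N` is then a Nijenhuis operator. The inverse of a smooth
fibrewise bijective `U` is smooth by inversion of matrices (`LieGroupoid.smoothFieldAt_of_comp`).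

*The tensor `δU`.* The inversion of `G` exchanges `R` and `L` (`LieGroupoid.leftLift_eq`). With
`ds ∘ R = 0` and `dt ∘ R = N ∘ dt` this gives that `δU` is both `s`-related and `t`-related to `N`.

*The tangent lift.* In the preferred charts, the identity `dU ∘ N^tan = (δU)˙ ∘ dU` at a point over
`x` amounts to `T ∘ d1 = d1 ∘ N`, `T ∘ U = U ∘ N` at the unit `1_x`, and to an identity between the
derivatives of the coordinate expressions of `N`, `U` and `T`. The latter is
`(L_Y T) (d1 X₀) = U ((L_{Y₀} N) X₀)` at `1_x` for fields `X₀`, `Y₀` with constant coordinates, where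
`Y` is the right invariant vector field of `U Y₀` (`LieGroupoid.IsIntegratingMap.lieDerivative_delta`).
For the summand `L` of `T`, the left hand side vanishes: right invariant and left invariant fields
commute (`mlieBracket_eq_zero_of_square`, on the surface `(p, q) ↦ c(p) d(q)⁻¹`). For the summand
`R`, it is computed on a `t`-lift of `X₀` by means of the vanishing of the torsion of `R`.

In Mathlib the tangent space at a point is the model vector space, identified by the preferred chart
at the point. Equations between tangent vectors at provably (but not definitionally) equal points,
such as `s(1_x)` and `x`, are therefore stated as equations in the model vector space.
-/

open scoped Manifold ContDiff

noncomputable section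

namespace NijenhuisGroupoid

open Filter Topology VectorField

/-! ### Vector fields and their brackets in coordinates -/

section Coordinates

variable {E : Type*} [NormedAddCommGroup E] [NormedSpace ℝ E]
  {M : Type*} [TopologicalSpace M] [ChartedSpace E M] [IsManifold 𝓘(ℝ, E) ∞ M]
  {F : Type*} [NormedAddCommGroup F] [NormedSpace ℝ F]
  {G : Type*} [TopologicalSpace G] [ChartedSpace F G] [IsManifold 𝓘(ℝ, F) ∞ G]

/-- The fibre coordinate of a tangent vector in the trivialization of `TM` at `x₀`, which is the
one induced by the preferred chart of `M` at `x₀`. -/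
def fiberCoord (x₀ : M) (p : TangentBundle 𝓘(ℝ, E) M) : E :=
  (trivializationAt E (TangentSpace 𝓘(ℝ, E) : M → Type _) x₀ p).2

theorem fiberCoord_self (x : M) (v : TangentSpace 𝓘(ℝ, E) x) :
    fiberCoord x (⟨x, v⟩ : TangentBundle 𝓘(ℝ, E) M) = v := by
  rw [fiberCoord, TangentBundle.trivializationAt_apply]
  exact tangentCoordChange_self (I := 𝓘(ℝ, E)) (mem_extChartAt_source x)

theorem fiberCoord_eq_mfderiv {x₀ y : M} (hy : y ∈ (chartAt E x₀).source)
    (v : TangentSpace 𝓘(ℝ, E) y) :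
    fiberCoord x₀ (⟨y, v⟩ : TangentBundle 𝓘(ℝ, E) M)
      = mfderiv 𝓘(ℝ, E) 𝓘(ℝ, E) (extChartAt 𝓘(ℝ, E) x₀) y v := by
  rw [(hasMFDerivAt_extChartAt hy).mfderiv, mfderiv_chartAt_eq_tangentCoordChange hy]
  rfl

/-- The fibre coordinate of `df(v)` is the derivative of the coordinate expression of `f`, applied to
the fibre coordinate of `v`. -/
theorem fiberCoord_tangentMap {f : M → G} {x₀ y : M} {z₀ : G}
    (hf : MDifferentiableAt 𝓘(ℝ, E) 𝓘(ℝ, F) f y)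
    (hy : y ∈ (chartAt E x₀).source) (hfy : f y ∈ (chartAt F z₀).source)
    (v : TangentSpace 𝓘(ℝ, E) y) :
    fiberCoord z₀ (tangentMap 𝓘(ℝ, E) 𝓘(ℝ, F) f ⟨y, v⟩)
      = fderiv ℝ (extChartAt 𝓘(ℝ, F) z₀ ∘ f ∘ (extChartAt 𝓘(ℝ, E) x₀).symm)
          (extChartAt 𝓘(ℝ, E) x₀ y) (fiberCoord x₀ ⟨y, v⟩) := by
  have hy' : y ∈ (extChartAt 𝓘(ℝ, E) x₀).source := by rwa [extChartAt_source]
  have hyt : extChartAt 𝓘(ℝ, E) x₀ y ∈ (extChartAt 𝓘(ℝ, E) x₀).target :=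
    (extChartAt 𝓘(ℝ, E) x₀).map_source hy'
  have hl : (extChartAt 𝓘(ℝ, E) x₀).symm (extChartAt 𝓘(ℝ, E) x₀ y) = y :=
    (extChartAt 𝓘(ℝ, E) x₀).left_inv hy'
  have hsymm : MDifferentiableAt 𝓘(ℝ, E) 𝓘(ℝ, E) (extChartAt 𝓘(ℝ, E) x₀).symm
      (extChartAt 𝓘(ℝ, E) x₀ y) := by
    have := mdifferentiableWithinAt_extChartAt_symm hyt
    simpa [mdifferentiableWithinAt_univ] using this
  have h1 : MDifferentiableAt 𝓘(ℝ, E) 𝓘(ℝ, F)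
      (f ∘ (extChartAt 𝓘(ℝ, E) x₀).symm) (extChartAt 𝓘(ℝ, E) x₀ y) := by
    refine MDifferentiableAt.comp _ (by rwa [hl]) hsymm
  have h2 : MDifferentiableAt 𝓘(ℝ, E) 𝓘(ℝ, F)
      (extChartAt 𝓘(ℝ, F) z₀ ∘ f ∘ (extChartAt 𝓘(ℝ, E) x₀).symm) (extChartAt 𝓘(ℝ, E) x₀ y) := by
    refine MDifferentiableAt.comp _ (I' := 𝓘(ℝ, F)) ?_ h1
    exact mdifferentiableAt_extChartAt (by rw [Function.comp_apply, hl]; exact hfy)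
  have e1 : fiberCoord z₀ (tangentMap 𝓘(ℝ, E) 𝓘(ℝ, F) f ⟨y, v⟩)
      = mfderiv 𝓘(ℝ, E) 𝓘(ℝ, F) (extChartAt 𝓘(ℝ, F) z₀ ∘ f) y v :=
    (fiberCoord_eq_mfderiv hfy _).trans
      (mfderiv_comp_apply (I' := 𝓘(ℝ, F)) (I'' := 𝓘(ℝ, F)) y
        (mdifferentiableAt_extChartAt hfy) hf v).symm
  have e2 : (extChartAt 𝓘(ℝ, F) z₀ ∘ f) =ᶠ[𝓝 y]
      ((extChartAt 𝓘(ℝ, F) z₀ ∘ f ∘ (extChartAt 𝓘(ℝ, E) x₀).symm) ∘ extChartAt 𝓘(ℝ, E) x₀) := by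
    filter_upwards [extChartAt_source_mem_nhds' hy'] with u hu
    simp only [Function.comp_apply, (extChartAt 𝓘(ℝ, E) x₀).left_inv hu]
  have e3 := congrArg (fun T : E →L[ℝ] F => T v) (e2.mfderiv_eq (I := 𝓘(ℝ, E)) (I' := 𝓘(ℝ, F)))
  have e4 := mfderiv_comp_apply (I' := 𝓘(ℝ, E)) (I'' := 𝓘(ℝ, F)) y h2
    (mdifferentiableAt_extChartAt hy) v
  refine e1.trans (e3.trans (e4.trans ?_))
  rw [mfderiv_eq_fderiv]
  exact congrArg _ (fiberCoord_eq_mfderiv hy v).symm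

/-- The coordinate expression of a vector field near `x₀`, a map between open subsets of `E`. -/
def fieldCoord (x₀ : M) (V : ∀ x : M, TangentSpace 𝓘(ℝ, E) x) (e : E) : E :=
  fiberCoord x₀ ⟨(extChartAt 𝓘(ℝ, E) x₀).symm e, V ((extChartAt 𝓘(ℝ, E) x₀).symm e)⟩

theorem fieldCoord_extChartAt {x₀ y : M} (V : ∀ x : M, TangentSpace 𝓘(ℝ, E) x)
    (hy : y ∈ (chartAt E x₀).source) :
    fieldCoord x₀ V (extChartAt 𝓘(ℝ, E) x₀ y) = fiberCoord x₀ ⟨y, V y⟩ := by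
  have hy' : y ∈ (extChartAt 𝓘(ℝ, E) x₀).source := by rwa [extChartAt_source]
  rw [fieldCoord, (extChartAt 𝓘(ℝ, E) x₀).left_inv hy']

theorem fieldCoord_self (x₀ : M) (V : ∀ x : M, TangentSpace 𝓘(ℝ, E) x) :
    fieldCoord x₀ V (extChartAt 𝓘(ℝ, E) x₀ x₀) = V x₀ := by
  rw [fieldCoord_extChartAt V (mem_chart_source E x₀), fiberCoord_self]

theorem contMDiffAt_extChartAt_symm (x : M) :
    ContMDiffAt 𝓘(ℝ, E) 𝓘(ℝ, E) ∞ (extChartAt 𝓘(ℝ, E) x).symm (extChartAt 𝓘(ℝ, E) x x) := by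
  have := contMDiffWithinAt_extChartAt_symm_range (I := 𝓘(ℝ, E)) (n := ∞) x
    (mem_extChartAt_target x)
  rwa [modelWithCornersSelf_coe, Set.range_id, contMDiffWithinAt_univ] at this

theorem SmoothFieldAt.contDiffAt_fieldCoord {V : ∀ x : M, TangentSpace 𝓘(ℝ, E) x} {x₀ : M}
    (hV : SmoothFieldAt V x₀) :
    ContDiffAt ℝ ∞ (fieldCoord x₀ V) (extChartAt 𝓘(ℝ, E) x₀ x₀) := by
  have h := (Bundle.contMDiffAt_totalSpace.1 hV).2
  rw [← contMDiffAt_iff_contDiffAt]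
  have h' : ContMDiffAt 𝓘(ℝ, E) 𝓘(ℝ, E) ∞ (fun y => fiberCoord x₀ ⟨y, V y⟩)
      ((extChartAt 𝓘(ℝ, E) x₀).symm (extChartAt 𝓘(ℝ, E) x₀ x₀)) := by
    rw [extChartAt_to_inv]; exact h
  exact h'.comp _ (contMDiffAt_extChartAt_symm x₀)

/-- The Lie bracket of vector fields on a manifold at `x₀` is the Lie bracket of their coordinate
expressions in the preferred chart at `x₀`. -/
theorem mlieBracket_eq_lieBracket_fieldCoord (V W : ∀ x : M, TangentSpace 𝓘(ℝ, E) x) (x₀ : M) :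
    mlieBracket 𝓘(ℝ, E) V W x₀
      = lieBracket ℝ (fieldCoord x₀ V) (fieldCoord x₀ W) (extChartAt 𝓘(ℝ, E) x₀ x₀) := by
  have key : ∀ V : ∀ x : M, TangentSpace 𝓘(ℝ, E) x,
      (mpullbackWithin 𝓘(ℝ, E) 𝓘(ℝ, E) (extChartAt 𝓘(ℝ, E) x₀).symm V (Set.range 𝓘(ℝ, E)))
      =ᶠ[𝓝 (extChartAt 𝓘(ℝ, E) x₀ x₀)] fieldCoord x₀ V := by
    intro V
    filter_upwards [extChartAt_target_mem_nhds (I := 𝓘(ℝ, E)) x₀] with e he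
    have hs : (extChartAt 𝓘(ℝ, E) x₀).symm e ∈ (chartAt E x₀).source := by
      rw [← extChartAt_source 𝓘(ℝ, E)]; exact (extChartAt 𝓘(ℝ, E) x₀).map_target he
    refine Eq.trans ?_ (fiberCoord_eq_mfderiv hs _).symm
    rw [mpullbackWithin_apply,
      ContinuousLinearMap.inverse_eq (mfderivWithin_extChartAt_symm_comp_mfderiv_extChartAt he)
        (mfderiv_extChartAt_comp_mfderivWithin_extChartAt_symm he)]
    rfl
  have h2 : ∀ v : E,
      (mfderiv 𝓘(ℝ, E) 𝓘(ℝ, E) (extChartAt 𝓘(ℝ, E) x₀) x₀).inverse v = v := by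
    intro v
    have hid : (mfderiv 𝓘(ℝ, E) 𝓘(ℝ, E) (extChartAt 𝓘(ℝ, E) x₀) x₀)
        = ContinuousLinearMap.id ℝ E := by
      ext u
      exact (fiberCoord_eq_mfderiv (mem_chart_source E x₀) u).symm.trans (fiberCoord_self x₀ u)
    rw [hid]
    exact congrArg (fun T : E →L[ℝ] E => T v) (ContinuousLinearMap.inverse_id (R := ℝ) (M := E))
  have h3 : ((extChartAt 𝓘(ℝ, E) x₀).symm ⁻¹' Set.univ ∩ Set.range 𝓘(ℝ, E)) = Set.univ := by
    simp
  let V' : E → E :=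
    mpullbackWithin 𝓘(ℝ, E) 𝓘(ℝ, E) (extChartAt 𝓘(ℝ, E) x₀).symm V (Set.range 𝓘(ℝ, E))
  let W' : E → E :=
    mpullbackWithin 𝓘(ℝ, E) 𝓘(ℝ, E) (extChartAt 𝓘(ℝ, E) x₀).symm W (Set.range 𝓘(ℝ, E))
  have h4 : ∀ b : E, lieBracketWithin ℝ V' W'
        ((extChartAt 𝓘(ℝ, E) x₀).symm ⁻¹' Set.univ ∩ Set.range 𝓘(ℝ, E))
        (extChartAt 𝓘(ℝ, E) x₀ x₀) = b → mlieBracket 𝓘(ℝ, E) V W x₀ = b := by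
    rintro b rfl
    rw [← mlieBracketWithin_univ, mlieBracketWithin_apply]
    exact h2 _
  refine h4 _ ?_
  rw [h3, lieBracketWithin_univ]
  exact Filter.EventuallyEq.lieBracket_vectorField_eq (key V) (key W)

end Coordinates

section

variable {𝕜 : Type*} [NontriviallyNormedField 𝕜]
  {E : Type*} [NormedAddCommGroup E] [NormedSpace 𝕜 E] {H : Type*} [TopologicalSpace H]
  {I : ModelWithCorners 𝕜 E H}
  {M : Type*} [TopologicalSpace M] [ChartedSpace H M] [IsManifold I ∞ M]
  {E' : Type*} [NormedAddCommGroup E'] [NormedSpace 𝕜 E'] {H' : Type*} [TopologicalSpace H']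
  {I' : ModelWithCorners 𝕜 E' H'}
  {M' : Type*} [TopologicalSpace M'] [ChartedSpace H' M'] [IsManifold I' ∞ M']

theorem eventually_mdifferentiableAt {f : M → M'} {x : M} (hf : ContMDiffAt I I' ∞ f x) :
    ∀ᶠ y in 𝓝 x, MDifferentiableAt I I' f y := by
  have : IsManifold I 1 M := .of_le (n := ∞) (by exact_mod_cast le_top)
  have : IsManifold I' 1 M' := .of_le (n := ∞) (by exact_mod_cast le_top)
  have h : ContMDiffAt I I' 1 f x := hf.of_le (by exact_mod_cast le_top)
  exact ((contMDiffAt_iff_contMDiffAt_nhds (by simp)).1 h).mono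
    fun y hy => hy.mdifferentiableAt (by simp)

theorem contMDiffAt_tangentMap {f : M → M'} {p : TangentBundle I M}
    (hf : ContMDiffAt I I' ∞ f p.1) :
    ContMDiffAt I.tangent I'.tangent ∞ (tangentMap I I' f) p := by
  rw [contMDiffAt_infty]
  intro n
  have : IsManifold I ((n : ℕ∞ω) + 1) M := .of_le (n := ∞) (by exact_mod_cast le_top)
  have : IsManifold I' ((n : ℕ∞ω) + 1) M' := .of_le (n := ∞) (by exact_mod_cast le_top)
  have hn : ContMDiffAt I I' ((n : ℕ∞ω) + 1) f p.1 := hf.of_le (by exact_mod_cast le_top)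
  obtain ⟨u, hu, hpu, hfu⟩ := (contMDiffWithinAt_univ.2 hn).contMDiffOn' le_rfl
    (fun h => absurd h (by exact_mod_cast ENat.natCast_ne_top (n + 1)))
  rw [Set.insert_eq_of_mem (Set.mem_univ _), Set.univ_inter] at hfu
  have h := hfu.contMDiffOn_tangentMapWithin (m := n) le_rfl hu.uniqueMDiffOn
  have hu' : (Bundle.TotalSpace.proj : TangentBundle I M → M) ⁻¹' u ∈ 𝓝 p :=
    (FiberBundle.continuous_proj E (TangentSpace I)).continuousAt.preimage_mem_nhds
      (hu.mem_nhds hpu)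
  refine (h.contMDiffAt hu').congr_of_eventuallyEq ?_
  filter_upwards [hu'] with q hq
  rw [tangentMapWithin, tangentMap, mfderivWithin_of_isOpen hu hq]

end

/-! ### Brackets of related vector fields, and commuting vector fields -/

section Brackets

variable {E : Type*} [NormedAddCommGroup E] [NormedSpace ℝ E]
  {M : Type*} [TopologicalSpace M] [ChartedSpace E M] [IsManifold 𝓘(ℝ, E) ∞ M]
  {F : Type*} [NormedAddCommGroup F] [NormedSpace ℝ F]
  {G : Type*} [TopologicalSpace G] [ChartedSpace F G] [IsManifold 𝓘(ℝ, F) ∞ G]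

theorem mfderiv_eq_fderiv_chart {f : M → G} {x : M} (hf : MDifferentiableAt 𝓘(ℝ, E) 𝓘(ℝ, F) f x)
    (v : TangentSpace 𝓘(ℝ, E) x) :
    mfderiv 𝓘(ℝ, E) 𝓘(ℝ, F) f x v
      = fderiv ℝ (extChartAt 𝓘(ℝ, F) (f x) ∘ f ∘ (extChartAt 𝓘(ℝ, E) x).symm)
          (extChartAt 𝓘(ℝ, E) x x) v := by
  have h := fiberCoord_tangentMap hf (mem_chart_source E x) (mem_chart_source F (f x)) v
  rw [fiberCoord_self] at h
  exact (fiberCoord_self (E := F) (f x) _).symm.trans h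

omit [IsManifold 𝓘(ℝ, E) ∞ M] [IsManifold 𝓘(ℝ, F) ∞ G] in
theorem contDiffAt_chart {f : M → G} {x : M} (hf : ContMDiffAt 𝓘(ℝ, E) 𝓘(ℝ, F) ∞ f x) :
    ContDiffAt ℝ ∞ (extChartAt 𝓘(ℝ, F) (f x) ∘ f ∘ (extChartAt 𝓘(ℝ, E) x).symm)
      (extChartAt 𝓘(ℝ, E) x x) := by
  have h := (contMDiffAt_iff.1 hf).2
  rwa [modelWithCornersSelf_coe, Set.range_id, contDiffWithinAt_univ] at h

omit [IsManifold 𝓘(ℝ, E) ∞ M] in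
theorem tendsto_extChartAt_symm (x : M) :
    Tendsto (extChartAt 𝓘(ℝ, E) x).symm (𝓝 (extChartAt 𝓘(ℝ, E) x x)) (𝓝 x) := by
  have := continuousAt_extChartAt_symm (I := 𝓘(ℝ, E)) x
  rwa [ContinuousAt, extChartAt_to_inv] at this

theorem two_le_smooth : minSmoothness ℝ 2 ≤ ∞ := by
  rw [minSmoothness_of_isRCLikeNormedField]
  exact WithTop.coe_le_coe.2 (le_top : (2 : ℕ∞) ≤ ⊤)

/-- Brackets of `f`-related vector fields are `f`-related, for a smooth map `f`. -/
theorem mfderiv_mlieBracket_of_related {f : M → G} {x : M}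
    (hf : ContMDiffAt 𝓘(ℝ, E) 𝓘(ℝ, F) ∞ f x)
    {V W : ∀ x : M, TangentSpace 𝓘(ℝ, E) x} {V' W' : ∀ g : G, TangentSpace 𝓘(ℝ, F) g}
    (hV : SmoothFieldAt V x) (hW : SmoothFieldAt W x)
    (hV' : SmoothFieldAt V' (f x)) (hW' : SmoothFieldAt W' (f x))
    (h₁ : ∀ᶠ y in 𝓝 x, mfderiv 𝓘(ℝ, E) 𝓘(ℝ, F) f y (V y) = V' (f y))
    (h₂ : ∀ᶠ y in 𝓝 x, mfderiv 𝓘(ℝ, E) 𝓘(ℝ, F) f y (W y) = W' (f y)) :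
    mfderiv 𝓘(ℝ, E) 𝓘(ℝ, F) f x (mlieBracket 𝓘(ℝ, E) V W x)
      = mlieBracket 𝓘(ℝ, F) V' W' (f x) := by
  set φ := extChartAt 𝓘(ℝ, E) x with hφ
  set ψ := extChartAt 𝓘(ℝ, F) (f x) with hψ
  set f' : E → F := ψ ∘ f ∘ φ.symm with hf'
  have hf'x : f' (φ x) = ψ (f x) := by simp [hf', hφ]
  have hd : ContDiffAt ℝ ∞ f' (φ x) := contDiffAt_chart hf
  have hdf : DifferentiableAt ℝ f' (φ x) := hd.differentiableAt (by simp)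
  have hfd : ∀ᶠ y in 𝓝 x, MDifferentiableAt 𝓘(ℝ, E) 𝓘(ℝ, F) f y :=
    eventually_mdifferentiableAt hf
  have hfs : ∀ᶠ y in 𝓝 x, f y ∈ (chartAt F (f x)).source :=
    hf.continuousAt.preimage_mem_nhds (chart_source_mem_nhds F (f x))
  have key : ∀ (V : ∀ x : M, TangentSpace 𝓘(ℝ, E) x) (V' : ∀ g : G, TangentSpace 𝓘(ℝ, F) g),
      (∀ᶠ y in 𝓝 x, mfderiv 𝓘(ℝ, E) 𝓘(ℝ, F) f y (V y) = V' (f y)) →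
      (fun e => fderiv ℝ f' e (fieldCoord x V e)) =ᶠ[𝓝 (φ x)]
        (fun e => fieldCoord (f x) V' (f' e)) := by
    intro V V' h
    have hev : ∀ᶠ y in 𝓝 x, fderiv ℝ f' (φ y) (fieldCoord x V (φ y))
        = fieldCoord (f x) V' (f' (φ y)) := by
      filter_upwards [h, hfd, hfs, chart_source_mem_nhds E x] with y hy hfy hys hyx
      have hl : φ.symm (φ y) = y := φ.left_inv (by rwa [hφ, extChartAt_source])
      rw [hφ, fieldCoord_extChartAt V hyx, ← hφ, hf', hψ, hφ,
        ← fiberCoord_tangentMap hfy hyx hys]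
      rw [← hφ, Function.comp_apply, Function.comp_apply, hl, fieldCoord_extChartAt V' hys,
        ← hy]
      rfl
    filter_upwards [(tendsto_extChartAt_symm x).eventually hev,
      extChartAt_target_mem_nhds (I := 𝓘(ℝ, E)) x] with e he het
    rwa [← hφ, φ.right_inv het] at he
  have hV1 := hV.contDiffAt_fieldCoord.differentiableAt (by simp)
  have hW1 := hW.contDiffAt_fieldCoord.differentiableAt (by simp)
  have hV1' := hV'.contDiffAt_fieldCoord.differentiableAt (by simp)
  have hW1' := hW'.contDiffAt_fieldCoord.differentiableAt (by simp)
  have e1 := fderiv_apply_lieBracket (𝕜 := ℝ) (n := ∞) hd two_le_smooth hW1 hV1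
  rw [(key V V' h₁).fderiv_eq, (key W W' h₂).fderiv_eq] at e1
  have comp : ∀ (Z : F → F), DifferentiableAt ℝ Z (ψ (f x)) → ∀ v,
      fderiv ℝ (fun e => Z (f' e)) (φ x) v = fderiv ℝ Z (ψ (f x)) (fderiv ℝ f' (φ x) v) := by
    intro Z hZ v
    have := fderiv_comp (𝕜 := ℝ) (φ x) (g := Z) (f := f') (by rwa [hf'x]) hdf
    rw [hf'x] at this
    exact congrArg (fun T : E →L[ℝ] F => T v) this
  rw [comp _ hV1', comp _ hW1', (key V V' h₁).eq_of_nhds, (key W W' h₂).eq_of_nhds, hf'x] at e1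
  refine (mfderiv_eq_fderiv_chart (hfd.self_of_nhds) _).trans ?_
  refine (congrArg (fderiv ℝ f' (φ x)) (mlieBracket_eq_lieBracket_fieldCoord V W x)).trans ?_
  refine e1.trans ?_
  exact (mlieBracket_eq_lieBracket_fieldCoord V' W' (f x)).symm

theorem fiberCoord_modelSpace (e u v : E) :
    fiberCoord e (⟨u, v⟩ : TangentBundle 𝓘(ℝ, E) E) = v := by
  refine (fiberCoord_eq_mfderiv (by rw [chartAt_self_eq]; trivial) v).trans ?_
  have : extChartAt 𝓘(ℝ, E) e = PartialEquiv.refl E := extChartAt_model_space_eq_id ℝ e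
  rw [this, PartialEquiv.refl_coe, mfderiv_eq_fderiv, fderiv_id]
  rfl

/-- Two vector fields commute at a point if they are tangent to the coordinate lines
`p ↦ f (p, q)` and `q ↦ f (p, q)` of some smooth map `f`, at least along the respective
transversal axes `p = 0` and `q = 0`. -/
theorem mlieBracket_eq_zero_of_square {f : ℝ × ℝ → M} {x : M} (hx : f 0 = x)
    (hf : ContMDiffAt 𝓘(ℝ, ℝ × ℝ) 𝓘(ℝ, E) ∞ f 0)
    {V W : ∀ x : M, TangentSpace 𝓘(ℝ, E) x} (hV : SmoothFieldAt V x) (hW : SmoothFieldAt W x)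
    (h₁ : ∀ᶠ q in 𝓝 (0 : ℝ),
      mfderiv 𝓘(ℝ, ℝ × ℝ) 𝓘(ℝ, E) f (0, q) ((1, 0) : ℝ × ℝ) = V (f (0, q)))
    (h₂ : ∀ᶠ p in 𝓝 (0 : ℝ),
      mfderiv 𝓘(ℝ, ℝ × ℝ) 𝓘(ℝ, E) f (p, 0) ((0, 1) : ℝ × ℝ) = W (f (p, 0))) :
    mlieBracket 𝓘(ℝ, E) V W x = 0 := by
  subst hx
  set ψ := extChartAt 𝓘(ℝ, E) (f 0) with hψ
  set f' : ℝ × ℝ → E := ψ ∘ f with hf'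
  have hd : ContDiffAt ℝ ∞ f' 0 := by
    have := contDiffAt_chart hf
    rwa [extChartAt_model_space_eq_id] at this
  have hfd : ∀ᶠ y in 𝓝 (0 : ℝ × ℝ), MDifferentiableAt 𝓘(ℝ, ℝ × ℝ) 𝓘(ℝ, E) f y :=
    eventually_mdifferentiableAt hf
  have hfs : ∀ᶠ y in 𝓝 (0 : ℝ × ℝ), f y ∈ (chartAt E (f 0)).source :=
    hf.continuousAt.preimage_mem_nhds (chart_source_mem_nhds E (f 0))
  have key : ∀ (V : ∀ x : M, TangentSpace 𝓘(ℝ, E) x) (a : ℝ → ℝ × ℝ) (b : ℝ × ℝ),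
      Tendsto a (𝓝 0) (𝓝 0) →
      (∀ᶠ q in 𝓝 (0 : ℝ), mfderiv 𝓘(ℝ, ℝ × ℝ) 𝓘(ℝ, E) f (a q) b = V (f (a q))) →
      ∀ᶠ q in 𝓝 (0 : ℝ), fderiv ℝ f' (a q) b = fieldCoord (f 0) V (f' (a q)) := by
    intro V a b ha h
    filter_upwards [h, ha.eventually hfd, ha.eventually hfs] with q h1 h2 h3
    have := fiberCoord_tangentMap (x₀ := (0 : ℝ × ℝ)) h2
      (by rw [chartAt_self_eq]; trivial) h3 b
    rw [fiberCoord_modelSpace, extChartAt_model_space_eq_id] at this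
    rw [hf', Function.comp_apply, fieldCoord_extChartAt V h3, ← h1]
    exact this.symm
  have hl : ContDiffAt ℝ 1 (fderiv ℝ f') 0 := hd.fderiv_right
    (by rw [one_add_one_eq_two]; exact WithTop.coe_le_coe.2 (le_top : (2 : ℕ∞) ≤ ⊤))
  have hsymm : IsSymmSndFDerivAt ℝ f' 0 := hd.isSymmSndFDerivAt two_le_smooth
  have hdf : DifferentiableAt ℝ f' 0 := hd.differentiableAt (by simp)
  have main : ∀ (V : ∀ x : M, TangentSpace 𝓘(ℝ, E) x) (c b : ℝ × ℝ), SmoothFieldAt V (f 0) →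
      (∀ᶠ q in 𝓝 (0 : ℝ), mfderiv 𝓘(ℝ, ℝ × ℝ) 𝓘(ℝ, E) f (q • c) b = V (f (q • c))) →
      fderiv ℝ (fderiv ℝ f') 0 c b
        = fderiv ℝ (fieldCoord (f 0) V) (ψ (f 0)) (fderiv ℝ f' 0 c) := by
    intro V c b hV h
    have hc : HasDerivAt (fun q : ℝ => q • c) c 0 := by
      simpa using (hasDerivAt_id (0 : ℝ)).smul_const c
    have ht : Tendsto (fun q : ℝ => q • c) (𝓝 0) (𝓝 0) := by
      simpa [ContinuousAt] using hc.continuousAt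
    have h' := key V (fun q => q • c) b ht h
    have d1 : HasDerivAt (fun q : ℝ => fderiv ℝ f' (q • c) b)
        (fderiv ℝ (fderiv ℝ f') 0 c b) 0 := by
      have h0 : HasFDerivAt (fderiv ℝ f') (fderiv ℝ (fderiv ℝ f') 0) 0 :=
        (hl.differentiableAt (by simp)).hasFDerivAt
      have h1 : HasDerivAt (fun q : ℝ => fderiv ℝ f' (q • c)) (fderiv ℝ (fderiv ℝ f') 0 c) 0 :=
        h0.comp_hasDerivAt_of_eq (0 : ℝ) hc (zero_smul ℝ c).symm
      have h2 := h1.clm_apply (hasDerivAt_const (0 : ℝ) b)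
      rwa [map_zero, add_zero] at h2
    have d2 : HasDerivAt (fun q : ℝ => fieldCoord (f 0) V (f' (q • c)))
        (fderiv ℝ (fieldCoord (f 0) V) (ψ (f 0)) (fderiv ℝ f' 0 c)) 0 := by
      have h0 : HasDerivAt (fun q : ℝ => f' (q • c)) (fderiv ℝ f' 0 c) 0 :=
        hdf.hasFDerivAt.comp_hasDerivAt_of_eq (0 : ℝ) hc (zero_smul ℝ c).symm
      have h1 : HasFDerivAt (fieldCoord (f 0) V) (fderiv ℝ (fieldCoord (f 0) V) (ψ (f 0)))
          (ψ (f 0)) :=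
        (hV.contDiffAt_fieldCoord.differentiableAt (by simp)).hasFDerivAt
      exact h1.comp_hasDerivAt_of_eq (0 : ℝ) h0 (by rw [zero_smul]; rfl)
    exact d1.unique (d2.congr_of_eventuallyEq h')
  -- `[V, W]` is the difference of the two mixed second derivatives of `f'`
  have a1 := main V (0, 1) (1, 0) hV (h₁.mono fun q hq => by
    have e : q • ((0 : ℝ), (1 : ℝ)) = (0, q) := by simp
    rw [e]; exact hq)
  have a2 := main W (1, 0) (0, 1) hW (h₂.mono fun q hq => by
    have e : q • ((1 : ℝ), (0 : ℝ)) = (q, 0) := by simp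
    rw [e]; exact hq)
  have b1 : fderiv ℝ f' 0 (1, 0) = fieldCoord (f 0) V (ψ (f 0)) :=
    (key V (fun q => (0, q)) (1, 0) (by
      have : Continuous fun q : ℝ => ((0 : ℝ), q) := by fun_prop
      exact this.tendsto' _ _ rfl) h₁).self_of_nhds
  have b2 : fderiv ℝ f' 0 (0, 1) = fieldCoord (f 0) W (ψ (f 0)) :=
    (key W (fun q => (q, 0)) (0, 1) (by
      have : Continuous fun q : ℝ => (q, (0 : ℝ)) := by fun_prop
      exact this.tendsto' _ _ rfl) h₂).self_of_nhds
  refine (mlieBracket_eq_lieBracket_fieldCoord V W (f 0)).trans ?_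
  rw [lieBracket, ← b1, ← b2, ← a1, ← a2, hsymm.eq, sub_self]
  rfl

end Brackets

/-! ### The chain rule for tangent maps -/

section TangentMaps

variable {𝕜 : Type*} [NontriviallyNormedField 𝕜]
  {E : Type*} [NormedAddCommGroup E] [NormedSpace 𝕜 E] {H : Type*} [TopologicalSpace H]
  {I : ModelWithCorners 𝕜 E H} {M : Type*} [TopologicalSpace M] [ChartedSpace H M]
  {E' : Type*} [NormedAddCommGroup E'] [NormedSpace 𝕜 E'] {H' : Type*} [TopologicalSpace H']
  {I' : ModelWithCorners 𝕜 E' H'} {M' : Type*} [TopologicalSpace M'] [ChartedSpace H' M']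
  {E'' : Type*} [NormedAddCommGroup E''] [NormedSpace 𝕜 E''] {H'' : Type*} [TopologicalSpace H'']
  {I'' : ModelWithCorners 𝕜 E'' H''} {M'' : Type*} [TopologicalSpace M''] [ChartedSpace H'' M'']

/-- Tangent vectors at equal points are compared by their values in the model vector space. -/
theorem tangentBundle_mk_congr {x y : M} (e : x = y) (v : E) :
    (⟨x, v⟩ : TangentBundle I M) = ⟨y, v⟩ := by
  subst e; rfl

theorem mfderiv_apply_congr (f : M → M') {x y : M} (e : x = y) (v : E) :
    (mfderiv I I' f x v : E') = mfderiv I I' f y v := by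
  subst e; rfl

theorem tangentMap_eq_of_eventuallyEq {f h : M → M'} (p : TangentBundle I M)
    (e : f =ᶠ[𝓝 p.1] h) : tangentMap I I' f p = tangentMap I I' h p :=
  (tangentBundle_mk_congr e.eq_of_nhds _).trans
    (congrArg (fun T : E →L[𝕜] E' => (⟨h p.1, T p.2⟩ : TangentBundle I' M'))
      (e.mfderiv_eq (I := I) (I' := I')))

theorem tangentMap_tangentMap {f : M' → M''} {r : M → M'} {h : M → M''} (p : TangentBundle I M)
    (hf : MDifferentiableAt I' I'' f (r p.1)) (hr : MDifferentiableAt I I' r p.1)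
    (e : ∀ᶠ x in 𝓝 p.1, f (r x) = h x) :
    tangentMap I' I'' f (tangentMap I I' r p) = tangentMap I I'' h p :=
  (tangentMap_comp_at p hf hr).symm.trans (tangentMap_eq_of_eventuallyEq p e)

/-- The chain rule, for the values in the model vector space. -/
theorem mfderiv_mfderiv {f : M' → M''} {r : M → M'} {h : M → M''} {x : M} {y : M'}
    (hy : r x = y)
    (hf : MDifferentiableAt I' I'' f y) (hr : MDifferentiableAt I I' r x)
    (e : ∀ᶠ x in 𝓝 x, f (r x) = h x) (v : E) :
    (mfderiv I' I'' f y (mfderiv I I' r x v : E') : E'') = mfderiv I I'' h x v := by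
  subst hy
  exact congrArg (fun p : TangentBundle I'' M'' => (p.2 : E''))
    (tangentMap_tangentMap (⟨x, v⟩ : TangentBundle I M) hf hr e)

end TangentMaps

/-! ### Submersions -/

section Submersions

variable {E : Type*} [NormedAddCommGroup E] [NormedSpace ℝ E]
  {M : Type*} [TopologicalSpace M] [ChartedSpace E M]
  {F : Type*} [NormedAddCommGroup F] [NormedSpace ℝ F]
  {G : Type*} [TopologicalSpace G] [ChartedSpace F G]

/-- Near `g₀`, a submersion `f : G → M` admits a smooth family of retractions onto its fibres:
`ρ (y, -)` maps a neighbourhood of `g₀` to the fibre over `y` and `ρ (f g, g) = g`. -/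
theorem exists_retraction {f : G → M} {g₀ : G}
    (hf : Manifold.IsSubmersionAt 𝓘(ℝ, F) 𝓘(ℝ, E) ∞ f g₀) :
    ∃ ρ : M × G → G, ContMDiffAt (𝓘(ℝ, E).prod 𝓘(ℝ, F)) 𝓘(ℝ, F) ∞ ρ (f g₀, g₀) ∧
      (∀ᶠ p in 𝓝 (f g₀, g₀), f (ρ p) = p.1) ∧ ∀ᶠ g in 𝓝 g₀, ρ (f g, g) = g := by
  set φ := hf.domChart with hφ
  set ψ := hf.codChart with hψ
  set L := hf.equiv
  have hg₀ : g₀ ∈ φ.source := hf.mem_domChart_source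
  have hfg₀ : f g₀ ∈ ψ.source := hf.mem_codChart_source
  have hw : ∀ e ∈ φ.target, ψ (f (φ.symm e)) = (L e).1 := by
    intro e he
    have := hf.writtenInCharts
      (show e ∈ (hf.domChart.extend 𝓘(ℝ, F)).target by simpa [hφ] using he)
    simpa using this
  have hw' : ∀ g ∈ φ.source, ψ (f g) = (L (φ g)).1 := by
    intro g hg
    have := hw (φ g) (φ.map_source hg)
    rwa [φ.left_inv hg] at this
  have hfsource : ∀ g ∈ φ.source, f g ∈ ψ.source := fun g hg =>
    hf.source_subset_preimage_source hg
  -- In adapted charts `f` is a linear projection; `ρ (y, g)` is obtained from the chart image of `g`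
  -- by replacing its first component with the chart image of `y`.
  let d : M × G → F := fun p => L.symm (ψ p.1, (L (φ p.2)).2)
  have hd₀ : ∀ g ∈ φ.source, d (f g, g) = φ g := by
    intro g hg
    simp only [d, hw' g hg, Prod.mk.eta, L.symm_apply_apply]
  have hφs : ContMDiffAt 𝓘(ℝ, F) 𝓘(ℝ, F) ∞ φ g₀ :=
    (contMDiffOn_of_mem_maximalAtlas hf.domChart_mem_maximalAtlas).contMDiffAt
      (φ.open_source.mem_nhds hg₀)
  have hψs : ContMDiffAt 𝓘(ℝ, E) 𝓘(ℝ, E) ∞ ψ (f g₀) :=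
    (contMDiffOn_of_mem_maximalAtlas hf.codChart_mem_maximalAtlas).contMDiffAt
      (ψ.open_source.mem_nhds hfg₀)
  have hφss : ContMDiffAt 𝓘(ℝ, F) 𝓘(ℝ, F) ∞ φ.symm (d (f g₀, g₀)) := by
    rw [hd₀ g₀ hg₀]
    exact (contMDiffOn_symm_of_mem_maximalAtlas hf.domChart_mem_maximalAtlas).contMDiffAt
      (φ.open_target.mem_nhds (φ.map_source hg₀))
  have h1 : ContMDiffAt (𝓘(ℝ, E).prod 𝓘(ℝ, F)) 𝓘(ℝ, E) ∞ (fun p : M × G => ψ p.1) (f g₀, g₀) :=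
    ContMDiffAt.comp (f g₀, g₀) (I' := 𝓘(ℝ, E)) (g := ψ) (f := Prod.fst) hψs contMDiffAt_fst
  have h2 : ContMDiffAt (𝓘(ℝ, E).prod 𝓘(ℝ, F)) 𝓘(ℝ, F) ∞ (fun p : M × G => φ p.2) (f g₀, g₀) :=
    ContMDiffAt.comp (f g₀, g₀) (I' := 𝓘(ℝ, F)) (g := φ) (f := Prod.snd) hφs contMDiffAt_snd
  have hds : ContMDiffAt (𝓘(ℝ, E).prod 𝓘(ℝ, F)) 𝓘(ℝ, F) ∞ d (f g₀, g₀) := by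
    have h3 := ((ContinuousLinearMap.snd ℝ E hf.complement).contDiff.comp
      L.contDiff).contMDiff.contMDiffAt.comp (f g₀, g₀) h2 (n := ∞)
    exact L.symm.contDiff.contMDiff.contMDiffAt.comp (f g₀, g₀) (h1.prodMk_space h3)
  refine ⟨fun p => φ.symm (d p), hφss.comp (f g₀, g₀) hds, ?_, ?_⟩
  · have e1 : ∀ᶠ p in 𝓝 (f g₀, g₀), d p ∈ φ.target := by
      refine hds.continuousAt.preimage_mem_nhds ?_
      rw [hd₀ g₀ hg₀]
      exact φ.open_target.mem_nhds (φ.map_source hg₀)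
    have e2 : ∀ᶠ p : M × G in 𝓝 (f g₀, g₀), p.1 ∈ ψ.source :=
      continuousAt_fst.preimage_mem_nhds (ψ.open_source.mem_nhds hfg₀)
    filter_upwards [e1, e2] with p hp1 hp2
    refine ψ.injOn (hfsource _ (φ.map_target hp1)) hp2 ?_
    rw [hw _ hp1]
    simp [d]
  · filter_upwards [φ.open_source.mem_nhds hg₀] with g hg
    rw [hd₀ g hg, φ.left_inv hg]

variable [IsManifold 𝓘(ℝ, E) ∞ M] [IsManifold 𝓘(ℝ, F) ∞ G]

theorem exists_smoothFieldAt {g₀ : G} (v : TangentSpace 𝓘(ℝ, F) g₀) :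
    ∃ V : ∀ g : G, TangentSpace 𝓘(ℝ, F) g, SmoothFieldAt V g₀ ∧ V g₀ = v := by
  refine ⟨fun g => FiberBundle.extend F v g, ?_, FiberBundle.extend_apply_self F v⟩
  exact FiberBundle.contMDiffAt_extend ..

/-- Vector fields can be lifted along a submersion, with prescribed value of the lift at a point. -/
theorem exists_lift {f : G → M} {g₀ : G}
    (hf : Manifold.IsSubmersionAt 𝓘(ℝ, F) 𝓘(ℝ, E) ∞ f g₀)
    {X : ∀ x : M, TangentSpace 𝓘(ℝ, E) x} (hX : SmoothFieldAt X (f g₀))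
    (v : TangentSpace 𝓘(ℝ, F) g₀) (hv : mfderiv 𝓘(ℝ, F) 𝓘(ℝ, E) f g₀ v = X (f g₀)) :
    ∃ Z : ∀ g : G, TangentSpace 𝓘(ℝ, F) g, SmoothFieldAt Z g₀ ∧ Z g₀ = v ∧
      ∀ᶠ g in 𝓝 g₀, mfderiv 𝓘(ℝ, F) 𝓘(ℝ, E) f g (Z g) = X (f g) := by
  obtain ⟨ρ, hρ, hρ1, hρ2⟩ := exists_retraction hf
  obtain ⟨V, hV, hVv⟩ := exists_smoothFieldAt v
  have hfs : ContMDiffAt 𝓘(ℝ, F) 𝓘(ℝ, E) ∞ f g₀ := hf.contMDiffAt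
  let Z : ∀ g : G, TangentSpace 𝓘(ℝ, F) g := fun g =>
    (mfderiv (𝓘(ℝ, E).prod 𝓘(ℝ, F)) 𝓘(ℝ, F) ρ (f g, g) ((X (f g), V g) : E × F) : F)
  have hι : ContinuousAt (fun g => (f g, g)) g₀ := hfs.continuousAt.prodMk continuousAt_id
  have hfd := eventually_mdifferentiableAt hfs
  have hρd := eventually_mdifferentiableAt hρ
  refine ⟨Z, ?_, ?_, ?_⟩
  · have e : (fun g => (⟨g, Z g⟩ : TangentBundle 𝓘(ℝ, F) G)) =ᶠ[𝓝 g₀]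
        fun g => tangentMap (𝓘(ℝ, E).prod 𝓘(ℝ, F)) 𝓘(ℝ, F) ρ
          ((equivTangentBundleProd 𝓘(ℝ, E) M 𝓘(ℝ, F) G).symm (⟨f g, X (f g)⟩, ⟨g, V g⟩)) := by
      filter_upwards [hρ2] with g hg
      exact tangentBundle_mk_congr hg.symm _
    refine ContMDiffAt.congr_of_eventuallyEq ?_ e
    have h1 : ContMDiffAt 𝓘(ℝ, F) 𝓘(ℝ, E).tangent ∞
        (fun g => (⟨f g, X (f g)⟩ : TangentBundle 𝓘(ℝ, E) M)) g₀ :=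
      ContMDiffAt.comp g₀ (g := fun y => (⟨y, X y⟩ : TangentBundle 𝓘(ℝ, E) M)) hX hfs
    have h2 := (contMDiff_equivTangentBundleProd_symm (n := ∞) (I := 𝓘(ℝ, E)) (M := M)
      (I' := 𝓘(ℝ, F)) (M' := G)).contMDiffAt.comp g₀ (h1.prodMk hV)
    exact ContMDiffAt.comp g₀ (contMDiffAt_tangentMap hρ) h2
  · have h1 := (hfd.self_of_nhds.hasMFDerivAt.prodMk (hasMFDerivAt_id g₀))
    have h2 := mfderiv_mfderiv (f := ρ) (r := fun g => (f g, g)) (h := id) rfl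
      hρd.self_of_nhds h1.mdifferentiableAt hρ2 v
    rw [mfderiv_id] at h2
    refine Eq.trans ?_ h2
    have h3 : ((X (f g₀), V g₀) : E × F)
        = mfderiv 𝓘(ℝ, F) (𝓘(ℝ, E).prod 𝓘(ℝ, F)) (fun g => (f g, g)) g₀ v := by
      refine Eq.trans ?_ (congrArg (fun T : F →L[ℝ] E × F => T v) h1.mfderiv.symm)
      rw [← hv, hVv]
      rfl
    exact congrArg (mfderiv (𝓘(ℝ, E).prod 𝓘(ℝ, F)) 𝓘(ℝ, F) ρ (f g₀, g₀)) h3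
  · have e1 : ∀ᶠ g in 𝓝 g₀, ∀ᶠ p in 𝓝 (f g, g), f (ρ p) = p.1 :=
      hι.eventually (eventually_eventually_nhds.2 hρ1)
    filter_upwards [e1, hι.eventually hρd, hρ2, hfd] with g hg1 hg2 hg3 hg4
    refine (mfderiv_mfderiv (f := f) (r := ρ) hg3 hg4 hg2 hg1 ((X (f g), V g) : E × F)).trans ?_
    rw [mfderiv_fst]
    rfl

end Submersions

/-! ### Smooth vector fields and derivatives of maps between tangent bundles -/

section TangentBundles

variable {E : Type*} [NormedAddCommGroup E] [NormedSpace ℝ E]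
  {M : Type*} [TopologicalSpace M] [ChartedSpace E M] [IsManifold 𝓘(ℝ, E) ∞ M]
  {F : Type*} [NormedAddCommGroup F] [NormedSpace ℝ F]
  {G : Type*} [TopologicalSpace G] [ChartedSpace F G] [IsManifold 𝓘(ℝ, F) ∞ G]

/-- Every tangent vector of a Hausdorff manifold is the value of a global smooth vector field (an
extension with constant coordinates, multiplied by a bump function). -/
theorem exists_smoothField [FiniteDimensional ℝ E] [T2Space M] {x : M}
    (v : TangentSpace 𝓘(ℝ, E) x) :
    ∃ V : ∀ y : M, TangentSpace 𝓘(ℝ, E) y, SmoothField V ∧ V x = v := by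
  obtain ⟨s, hs, hsv⟩ := FiberBundle.exists_contMDiffOn_extend (k := ∞) 𝓘(ℝ, E) E v
  obtain ⟨f, -, hf⟩ := (SmoothBumpFunction.nhds_basis_tsupport (I := 𝓘(ℝ, E)) x).mem_iff.1
    (interior_mem_nhds.2 hs)
  refine ⟨fun y => f y • FiberBundle.extend E v y, ?_, ?_⟩
  · exact ContMDiffOn.smul_section_of_tsupport f.contMDiff.contMDiffOn isOpen_interior hf
      (hsv.mono interior_subset)
  · simp only [f.eq_one, one_smul]
    exact FiberBundle.extend_apply_self E v

/-- The vector field with constant coordinates `v` in the preferred chart at `x`. Only its germ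
at `x` is meaningful. -/
def constField (x : M) (v : E) (y : M) : TangentSpace 𝓘(ℝ, E) y :=
  FiberBundle.extend E (E := fun y : M => TangentSpace 𝓘(ℝ, E) y) (x := x) v y

theorem constField_self (x : M) (v : E) : constField x v x = v :=
  FiberBundle.extend_apply_self E (E := fun y : M => TangentSpace 𝓘(ℝ, E) y) (x := x) v

theorem constField_zero {x y : M} (hy : y ∈ (chartAt E x).source) : constField x (0 : E) y = 0 := by
  have h : fiberCoord x (⟨x, (0 : E)⟩ : TangentBundle 𝓘(ℝ, E) M) = 0 := fiberCoord_self x 0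
  have h' := map_zero ((trivializationAt E (TangentSpace 𝓘(ℝ, E) : M → Type _) x).symmₗ ℝ y)
  rw [Bundle.Trivialization.coe_symmₗ _ hy, ← h] at h'
  exact h'

theorem smoothFieldAt_constField (x : M) (v : E) : SmoothFieldAt (constField x v) x :=
  FiberBundle.contMDiffAt_extend ..

theorem fiberCoord_constField (x : M) (v : E) :
    ∀ᶠ y in 𝓝 x, fiberCoord x ⟨y, constField x v y⟩ = v := by
  filter_upwards [chart_source_mem_nhds E x] with y hy
  have h := (trivializationAt E (TangentSpace 𝓘(ℝ, E) : M → Type _) x).apply_mk_symm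
    (b := y) hy (fiberCoord x ⟨x, v⟩)
  refine Eq.trans (b := fiberCoord x ⟨x, v⟩) ?_ (fiberCoord_self x v)
  have h' := congrArg Prod.snd h
  exact h'

theorem fieldCoord_constField (x : M) (v : E) :
    fieldCoord x (constField x v) =ᶠ[𝓝 (extChartAt 𝓘(ℝ, E) x x)] fun _ => v :=
  (tendsto_extChartAt_symm x).eventually (fiberCoord_constField x v)

/-- The derivative of a smooth map to a tangent bundle, in the preferred charts. -/
theorem mfderiv_to_tangentBundle {s : M → TangentBundle 𝓘(ℝ, F) G} {x : M}
    (hs : ContMDiffAt 𝓘(ℝ, E) 𝓘(ℝ, F).tangent ∞ s x) (w : E) :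
    (mfderiv 𝓘(ℝ, E) 𝓘(ℝ, F).tangent s x w : F × F)
      = (mfderiv 𝓘(ℝ, E) 𝓘(ℝ, F) (fun y => (s y).1) x w,
        fderiv ℝ (fun e => fiberCoord (s x).1 (s ((extChartAt 𝓘(ℝ, E) x).symm e)))
          (extChartAt 𝓘(ℝ, E) x x) w) := by
  have h := Bundle.contMDiffAt_totalSpace.1 hs
  have hd := hs.mdifferentiableAt (by simp)
  have h1 : ContDiffAt ℝ ∞ (extChartAt 𝓘(ℝ, F) (s x).1 ∘ (fun y => (s y).1) ∘
      (extChartAt 𝓘(ℝ, E) x).symm) (extChartAt 𝓘(ℝ, E) x x) := contDiffAt_chart h.1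
  have h2 : ContDiffAt ℝ ∞ (fun e => fiberCoord (s x).1 (s ((extChartAt 𝓘(ℝ, E) x).symm e)))
      (extChartAt 𝓘(ℝ, E) x x) := by
    have := contDiffAt_chart h.2
    rwa [extChartAt_model_space_eq_id] at this
  have e0 : mfderiv 𝓘(ℝ, E) 𝓘(ℝ, F).tangent s x
      = fderivWithin ℝ (writtenInExtChartAt 𝓘(ℝ, E) 𝓘(ℝ, F).tangent x s) (Set.range 𝓘(ℝ, E))
        (extChartAt 𝓘(ℝ, E) x x) := hd.mfderiv
  have e1 : writtenInExtChartAt 𝓘(ℝ, E) 𝓘(ℝ, F).tangent x s = fun e =>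
      ((extChartAt 𝓘(ℝ, F) (s x).1 ∘ (fun y => (s y).1) ∘ (extChartAt 𝓘(ℝ, E) x).symm) e,
        fiberCoord (s x).1 (s ((extChartAt 𝓘(ℝ, E) x).symm e))) := by
    funext e
    rw [writtenInExtChartAt, FiberBundle.extChartAt]
    rfl
  have hr : Set.range 𝓘(ℝ, E) = Set.univ := by simp
  rw [e1, hr, fderivWithin_univ, (h1.differentiableAt (by simp)).fderiv_prodMk
    (h2.differentiableAt (by simp))] at e0
  refine (congrArg (fun T : E →L[ℝ] F × F => T w) e0).trans ?_
  refine Prod.ext ?_ rfl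
  exact (mfderiv_eq_fderiv_chart (h.1.mdifferentiableAt (by simp)) w).symm

theorem contMDiffAt_mk (x : M) (v : E) :
    ContMDiffAt 𝓘(ℝ, E) 𝓘(ℝ, E).tangent ∞ (fun u : E => (⟨x, u⟩ : TangentBundle 𝓘(ℝ, E) M)) v := by
  refine Bundle.contMDiffAt_totalSpace.2 ⟨contMDiffAt_const, ?_⟩
  have : (fun u : E => (trivializationAt E (TangentSpace 𝓘(ℝ, E) : M → Type _) x
      (⟨x, u⟩ : TangentBundle 𝓘(ℝ, E) M)).2) = id := by
    funext u
    exact fiberCoord_self x u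
  rw [this]
  exact contMDiffAt_id

/-- The derivative of the inclusion of a fibre of `TM`: fibre directions are vertical. -/
theorem mfderiv_mk (x : M) (v z : E) :
    (mfderiv 𝓘(ℝ, E) 𝓘(ℝ, E).tangent (fun u : E => (⟨x, u⟩ : TangentBundle 𝓘(ℝ, E) M)) v z
      : E × E) = (0, z) := by
  rw [mfderiv_to_tangentBundle (contMDiffAt_mk x v)]
  refine Prod.ext ?_ ?_
  · simp only [mfderiv_const]; rfl
  · have h0 : extChartAt 𝓘(ℝ, E) v = PartialEquiv.refl E := extChartAt_model_space_eq_id ℝ v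
    have : (fun u : E => fiberCoord x (⟨x, u⟩ : TangentBundle 𝓘(ℝ, E) M)) = id := by
      funext u; exact fiberCoord_self x u
    simp only [h0, PartialEquiv.refl_symm, PartialEquiv.refl_coe, id]
    rw [this, fderiv_id]
    rfl

/-- The map between tangent bundles given by a family of linear maps over a base map. -/
def fiberwiseMap (f : M → G) (A : M → E →L[ℝ] F) (p : TangentBundle 𝓘(ℝ, E) M) :
    TangentBundle 𝓘(ℝ, F) G :=
  ⟨f p.1, A p.1 p.2⟩

theorem mfderiv_constField (x : M) (v w : E) :
    (mfderiv 𝓘(ℝ, E) 𝓘(ℝ, E).tangent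
      (fun y => (⟨y, constField x v y⟩ : TangentBundle 𝓘(ℝ, E) M)) x w : E × E) = (w, 0) := by
  refine (mfderiv_to_tangentBundle (smoothFieldAt_constField x v) w).trans ?_
  refine Prod.ext ?_ ?_
  · exact congrArg (fun T : E →L[ℝ] E => T w) (mfderiv_id (I := 𝓘(ℝ, E)) (x := x))
  · have h := (fieldCoord_constField x v).fderiv_eq (𝕜 := ℝ)
    rw [fderiv_fun_const] at h
    exact congrArg (fun T : E →L[ℝ] E => T w) h

/-- The derivative of a fibrewise linear map in the preferred charts: on the base directions it is
computed by the constant vector field through `v`, and on the fibre directions it is the linear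
map itself. -/
theorem mfderiv_fiberwiseMap {f : M → G} {A : M → E →L[ℝ] F} {x : M} {v : E}
    (h : ContMDiffAt 𝓘(ℝ, E).tangent 𝓘(ℝ, F).tangent ∞ (fiberwiseMap f A) ⟨x, v⟩) (w z : E) :
    (mfderiv 𝓘(ℝ, E).tangent 𝓘(ℝ, F).tangent (fiberwiseMap f A) ⟨x, v⟩ ((w, z) : E × E) : F × F)
      = (mfderiv 𝓘(ℝ, E) 𝓘(ℝ, F) f x w,
        fderiv ℝ (fun e => fiberCoord (f x) (fiberwiseMap f A
          ⟨(extChartAt 𝓘(ℝ, E) x).symm e, constField x v ((extChartAt 𝓘(ℝ, E) x).symm e)⟩))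
          (extChartAt 𝓘(ℝ, E) x x) w + A x z) := by
  let T : E × E →L[ℝ] F × F :=
    mfderiv 𝓘(ℝ, E).tangent 𝓘(ℝ, F).tangent (fiberwiseMap f A) ⟨x, v⟩
  have hd := h.mdifferentiableAt (by simp)
  have hx : (⟨x, constField x v x⟩ : TangentBundle 𝓘(ℝ, E) M) = ⟨x, v⟩ := by
    rw [constField_self]
  have hs : ContMDiffAt 𝓘(ℝ, E) 𝓘(ℝ, F).tangent ∞
      (fun y => fiberwiseMap f A ⟨y, constField x v y⟩) x := by
    refine ContMDiffAt.comp x (g := fiberwiseMap f A)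
      (f := fun y => (⟨y, constField x v y⟩ : TangentBundle 𝓘(ℝ, E) M)) ?_
      (smoothFieldAt_constField x v)
    rw [hx]; exact h
  have h1 : T (w, 0) = (mfderiv 𝓘(ℝ, E) 𝓘(ℝ, F) f x w,
        fderiv ℝ (fun e => fiberCoord (f x) (fiberwiseMap f A
          ⟨(extChartAt 𝓘(ℝ, E) x).symm e, constField x v ((extChartAt 𝓘(ℝ, E) x).symm e)⟩))
          (extChartAt 𝓘(ℝ, E) x x) w) := by
    rw [← mfderiv_constField x v w]
    refine (mfderiv_mfderiv (f := fiberwiseMap f A)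
      (r := fun y => (⟨y, constField x v y⟩ : TangentBundle 𝓘(ℝ, E) M)) hx hd
      ((smoothFieldAt_constField x v).mdifferentiableAt (by simp))
      (Eventually.of_forall fun _ => rfl) w).trans ?_
    exact mfderiv_to_tangentBundle hs w
  have h2 : T (0, z) = (0, A x z) := by
    rw [← mfderiv_mk (M := M) x v z]
    have e : ∀ᶠ u : E in 𝓝 v, fiberwiseMap f A ⟨x, u⟩ =
        ((fun y : F => (⟨f x, y⟩ : TangentBundle 𝓘(ℝ, F) G)) ∘ A x) u :=
      Eventually.of_forall fun _ => rfl
    refine (mfderiv_mfderiv (f := fiberwiseMap f A)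
      (r := fun u : E => (⟨x, u⟩ : TangentBundle 𝓘(ℝ, E) M)) rfl hd
      ((contMDiffAt_mk x v).mdifferentiableAt (by simp)) e z).trans ?_
    refine (mfderiv_mfderiv (I' := 𝓘(ℝ, F)) (f := fun y : F => (⟨f x, y⟩ : TangentBundle 𝓘(ℝ, F) G))
      (r := A x) rfl ((contMDiffAt_mk (f x) (A x v)).mdifferentiableAt (by simp))
      (A x).differentiableAt.mdifferentiableAt (Eventually.of_forall fun _ => rfl) z).symm.trans ?_
    refine (mfderiv_mk (f x) (A x v) _).trans ?_
    rw [mfderiv_eq_fderiv, ContinuousLinearMap.fderiv]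
    rfl
  have h3 : T (w, z) = T (w, 0) + T (0, z) := by
    rw [← map_add]; simp
  refine h3.trans ?_
  rw [h1, h2]
  exact Prod.ext (add_zero _) rfl

theorem SmoothTensor.smoothFieldAt
    {K : ∀ x : M, TangentSpace 𝓘(ℝ, E) x →L[ℝ] TangentSpace 𝓘(ℝ, E) x}
    (hK : SmoothTensor K) {X : ∀ x : M, TangentSpace 𝓘(ℝ, E) x} {x : M} (hX : SmoothFieldAt X x) :
    SmoothFieldAt (fun y => K y (X y)) x :=
  ContMDiffAt.comp x (g := totalMap K) (hK ⟨x, X x⟩) hX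

/-- If a vector field `Z` vanishes at `x`, then `[Y, K Z] = K [Y, Z]` at `x`. -/
theorem mlieBracket_tensor_of_eq_zero
    {K : ∀ x : M, TangentSpace 𝓘(ℝ, E) x →L[ℝ] TangentSpace 𝓘(ℝ, E) x}
    (hK : SmoothTensor K) {Y Z : ∀ x : M, TangentSpace 𝓘(ℝ, E) x} {x : M}
    (hZ : SmoothFieldAt Z x) (hZx : Z x = 0) :
    mlieBracket 𝓘(ℝ, E) Y (fun y => K y (Z y)) x = K x (mlieBracket 𝓘(ℝ, E) Y Z x) := by
  have hd : ∀ w : E, fderiv ℝ (fieldCoord x (fun y => K y (Z y))) (extChartAt 𝓘(ℝ, E) x x) w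
      = K x (fderiv ℝ (fieldCoord x Z) (extChartAt 𝓘(ℝ, E) x x) w : E) := by
    intro w
    have hs := hK.smoothFieldAt hZ
    have e1 := mfderiv_to_tangentBundle hs w
    have e2 : (mfderiv 𝓘(ℝ, E) 𝓘(ℝ, E).tangent
        (fun y => (⟨y, Z y⟩ : TangentBundle 𝓘(ℝ, E) M)) x w : E × E)
        = (w, fderiv ℝ (fieldCoord x Z) (extChartAt 𝓘(ℝ, E) x x) w) :=
      (mfderiv_to_tangentBundle hZ w).trans (Prod.ext
        (congrArg (fun T : E →L[ℝ] E => T w) (mfderiv_id (I := 𝓘(ℝ, E)) (x := x))) rfl)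
    have hx : (⟨x, Z x⟩ : TangentBundle 𝓘(ℝ, E) M) = ⟨x, (0 : E)⟩ := by rw [hZx]; rfl
    have e3 := mfderiv_mfderiv (I' := 𝓘(ℝ, E).tangent) (I'' := 𝓘(ℝ, E).tangent)
      (f := totalMap K) (r := fun y => (⟨y, Z y⟩ : TangentBundle 𝓘(ℝ, E) M))
      (h := fun y => (⟨y, K y (Z y)⟩ : TangentBundle 𝓘(ℝ, E) M)) (x := x)
      hx ((hK _).mdifferentiableAt (by simp)) (hZ.mdifferentiableAt (by simp))
      (Eventually.of_forall fun _ => rfl) w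
    rw [e2] at e3
    have e4 := mfderiv_fiberwiseMap (f := id) (A := K) (x := x) (v := (0 : E)) (hK _) w
      (fderiv ℝ (fieldCoord x Z) (extChartAt 𝓘(ℝ, E) x x) w)
    have e5 : (fun e => fiberCoord (id x) (fiberwiseMap id K
        (⟨(extChartAt 𝓘(ℝ, E) x).symm e, constField x 0 ((extChartAt 𝓘(ℝ, E) x).symm e)⟩ :
          TangentBundle 𝓘(ℝ, E) M))) =ᶠ[𝓝 (extChartAt 𝓘(ℝ, E) x x)] fun _ => 0 := by
      filter_upwards [(tendsto_extChartAt_symm x).eventually (chart_source_mem_nhds E x)] with e he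
      rw [constField_zero he]
      refine (fiberCoord_eq_mfderiv (x₀ := x) he _).trans ?_
      exact (congrArg (mfderiv 𝓘(ℝ, E) 𝓘(ℝ, E) (extChartAt 𝓘(ℝ, E) x) _) (map_zero (K _))).trans
        (map_zero _)
    rw [e5.fderiv_eq, fderiv_fun_const] at e4
    have e6 := congrArg Prod.snd (e1.symm.trans (e3.symm.trans e4))
    exact e6.trans (zero_add _)
  have hKZ : (K x (Z x) : E) = 0 := by rw [hZx]; exact map_zero _
  refine (mlieBracket_eq_lieBracket_fieldCoord _ _ x).trans ?_
  refine Eq.trans ?_ (congrArg (K x) (mlieBracket_eq_lieBracket_fieldCoord Y Z x).symm)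
  rw [lieBracket, hd, fieldCoord_self, fieldCoord_self, hKZ]
  rw [lieBracket, fieldCoord_self, fieldCoord_self, hZx]
  have a : ∀ (T D B : E →L[ℝ] E) (u : E), T (D u) - B 0 = T (D u - B 0) := by
    intro T D B u
    rw [map_zero, sub_zero, sub_zero]
  exact a _ _ _ _

end TangentBundles

/-! ### Tangent vectors of the fibres of a submersion -/

section Fibers

variable {E : Type*} [NormedAddCommGroup E] [NormedSpace ℝ E]
  {M : Type*} [TopologicalSpace M] [ChartedSpace E M]
  {F : Type*} [NormedAddCommGroup F] [NormedSpace ℝ F]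
  {G : Type*} [TopologicalSpace G] [ChartedSpace F G]

theorem mfderiv_surjective {f : G → M} {g₀ : G}
    (hf : Manifold.IsSubmersionAt 𝓘(ℝ, F) 𝓘(ℝ, E) ∞ f g₀) (w : E) :
    ∃ v : F, (mfderiv 𝓘(ℝ, F) 𝓘(ℝ, E) f g₀ v : E) = w := by
  obtain ⟨ρ, hρ, hρ1, hρ2⟩ := exists_retraction hf
  have hι : ContMDiffAt 𝓘(ℝ, E) (𝓘(ℝ, E).prod 𝓘(ℝ, F)) ∞ (fun y : M => (y, g₀)) (f g₀) :=
    contMDiffAt_id.prodMk contMDiffAt_const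
  have hr : ContMDiffAt 𝓘(ℝ, E) 𝓘(ℝ, F) ∞ (fun y => ρ (y, g₀)) (f g₀) :=
    ContMDiffAt.comp (f g₀) (g := ρ) hρ hι
  refine ⟨mfderiv 𝓘(ℝ, E) 𝓘(ℝ, F) (fun y => ρ (y, g₀)) (f g₀) w, ?_⟩
  refine (mfderiv_mfderiv (r := fun y => ρ (y, g₀)) (h := id) hρ2.self_of_nhds
    (hf.contMDiffAt.mdifferentiableAt (by simp)) (hr.mdifferentiableAt (by simp))
    (hι.continuousAt.eventually hρ1) w).trans ?_
  rw [mfderiv_id]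
  rfl

variable [IsManifold 𝓘(ℝ, F) ∞ G] in
/-- A vector in the kernel of the differential of a submersion is the velocity of a curve in the
fibre. -/
theorem exists_curve_of_mfderiv_eq_zero {f : G → M} {g₀ : G}
    (hf : Manifold.IsSubmersionAt 𝓘(ℝ, F) 𝓘(ℝ, E) ∞ f g₀) {a : F}
    (ha : mfderiv 𝓘(ℝ, F) 𝓘(ℝ, E) f g₀ a = 0) :
    ∃ c : ℝ → G, c 0 = g₀ ∧ ContMDiffAt 𝓘(ℝ, ℝ) 𝓘(ℝ, F) ∞ c 0 ∧
      (∀ r, f (c r) = f g₀) ∧ (mfderiv 𝓘(ℝ, ℝ) 𝓘(ℝ, F) c 0 (1 : ℝ) : F) = a := by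
  classical
  obtain ⟨ρ, hρ, hρ1, hρ2⟩ := exists_retraction hf
  have hfs : ContMDiffAt 𝓘(ℝ, F) 𝓘(ℝ, E) ∞ f g₀ := hf.contMDiffAt
  let l : ℝ → F := fun r => extChartAt 𝓘(ℝ, F) g₀ g₀ + r • a
  have hl : HasDerivAt l a 0 := by
    have h := ((hasDerivAt_id (0 : ℝ)).smul_const a).const_add (extChartAt 𝓘(ℝ, F) g₀ g₀)
    rw [one_smul] at h
    exact h
  have hl0 : l 0 = extChartAt 𝓘(ℝ, F) g₀ g₀ := by simp [l]
  have hls : ContMDiff 𝓘(ℝ, ℝ) 𝓘(ℝ, F) ∞ l := by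
    have : ContDiff ℝ ∞ l := by fun_prop
    exact this.contMDiff
  let γ : ℝ → G := fun r => (extChartAt 𝓘(ℝ, F) g₀).symm (l r)
  have hγ0 : γ 0 = g₀ := by simp only [γ, hl0, extChartAt_to_inv]
  have hγ : ContMDiffAt 𝓘(ℝ, ℝ) 𝓘(ℝ, F) ∞ γ 0 := by
    refine ContMDiffAt.comp (0 : ℝ) (g := (extChartAt 𝓘(ℝ, F) g₀).symm) ?_ hls.contMDiffAt
    rw [hl0]; exact contMDiffAt_extChartAt_symm g₀
  have hγd : (mfderiv 𝓘(ℝ, ℝ) 𝓘(ℝ, F) γ 0 (1 : ℝ) : F) = a := by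
    have h1 := mfderiv_eq_fderiv_chart (hγ.mdifferentiableAt (by simp)) (1 : ℝ)
    have h0 : extChartAt 𝓘(ℝ, ℝ) (0 : ℝ) = PartialEquiv.refl ℝ := extChartAt_model_space_eq_id ℝ 0
    have h2 : (extChartAt 𝓘(ℝ, F) (γ 0) ∘ γ ∘ (extChartAt 𝓘(ℝ, ℝ) (0 : ℝ)).symm)
        =ᶠ[𝓝 0] l := by
      have : ∀ᶠ r in 𝓝 (0 : ℝ), l r ∈ (extChartAt 𝓘(ℝ, F) g₀).target := by
        refine hl.continuousAt.preimage_mem_nhds ?_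
        rw [hl0]; exact extChartAt_target_mem_nhds g₀
      filter_upwards [this] with r hr
      rw [h0, hγ0]
      exact (extChartAt 𝓘(ℝ, F) g₀).right_inv hr
    refine h1.trans ?_
    have h3 : extChartAt 𝓘(ℝ, ℝ) (0 : ℝ) 0 = 0 := by rw [h0]; rfl
    rw [h3, h2.fderiv_eq, hl.hasFDerivAt.fderiv]
    simp
    rfl
  have hι : ContMDiffAt 𝓘(ℝ, F) (𝓘(ℝ, E).prod 𝓘(ℝ, F)) ∞ (fun g : G => (f g₀, g)) g₀ :=
    contMDiffAt_const.prodMk contMDiffAt_id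
  have hι' : ContMDiffAt 𝓘(ℝ, F) (𝓘(ℝ, E).prod 𝓘(ℝ, F)) ∞ (fun g : G => (f g, g)) g₀ :=
    hfs.prodMk contMDiffAt_id
  let r₀ : G → G := fun g => ρ (f g₀, g)
  have hr₀ : ContMDiffAt 𝓘(ℝ, F) 𝓘(ℝ, F) ∞ r₀ g₀ := ContMDiffAt.comp g₀ (g := ρ) hρ hι
  have hr₀0 : r₀ g₀ = g₀ := hρ2.self_of_nhds
  have hρd := hρ.mdifferentiableAt (by simp : (∞ : ℕ∞ω) ≠ 0)
  -- the differential of the retraction is the identity on the tangent space of the fibre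
  have hr₀d : (mfderiv 𝓘(ℝ, F) 𝓘(ℝ, F) r₀ g₀ a : F) = a := by
    have e1 := mfderiv_mfderiv (f := ρ) (r := fun g => (f g₀, g)) (h := r₀) rfl hρd
      (hι.mdifferentiableAt (by simp)) (Eventually.of_forall fun _ => rfl) a
    have e2 := mfderiv_mfderiv (f := ρ) (r := fun g => (f g, g)) (h := id) rfl hρd
      (hι'.mdifferentiableAt (by simp)) hρ2 a
    have e3 := ((hasMFDerivAt_const (I := 𝓘(ℝ, F)) (I' := 𝓘(ℝ, E)) (f g₀) g₀).prodMk
      (hasMFDerivAt_id (I := 𝓘(ℝ, F)) g₀)).mfderiv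
    have e4 := ((hfs.mdifferentiableAt (by simp)).hasMFDerivAt.prodMk
      (hasMFDerivAt_id (I := 𝓘(ℝ, F)) g₀)).mfderiv
    have e5 : (mfderiv 𝓘(ℝ, F) (𝓘(ℝ, E).prod 𝓘(ℝ, F)) (fun g : G => (f g₀, g)) g₀ a : E × F)
        = mfderiv 𝓘(ℝ, F) (𝓘(ℝ, E).prod 𝓘(ℝ, F)) (fun g : G => (f g, g)) g₀ a := by
      refine (congrArg (fun T : F →L[ℝ] E × F => T a) e3).trans
        (Eq.trans ?_ (congrArg (fun T : F →L[ℝ] E × F => T a) e4).symm)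
      exact Prod.ext ha.symm rfl
    rw [← e1, e5, e2, mfderiv_id]
    rfl
  have hev : ∀ᶠ r in 𝓝 (0 : ℝ), f (r₀ (γ r)) = f g₀ := by
    have h1 : Tendsto (fun r => (f g₀, γ r)) (𝓝 0) (𝓝 (f g₀, g₀)) := by
      have := hι.continuousAt.tendsto.comp (hγ0 ▸ hγ.continuousAt.tendsto : Tendsto γ (𝓝 0) (𝓝 g₀))
      exact this
    exact h1.eventually hρ1
  let c : ℝ → G := fun r => if f (r₀ (γ r)) = f g₀ then r₀ (γ r) else g₀
  have hc : c =ᶠ[𝓝 0] r₀ ∘ γ := by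
    filter_upwards [hev] with r hr
    simp [c, hr]
  have hrγ : ContMDiffAt 𝓘(ℝ, ℝ) 𝓘(ℝ, F) ∞ (r₀ ∘ γ) 0 :=
    ContMDiffAt.comp (0 : ℝ) (by rw [hγ0]; exact hr₀) hγ
  refine ⟨c, ?_, hrγ.congr_of_eventuallyEq hc, ?_, ?_⟩
  · rw [hc.eq_of_nhds, Function.comp_apply, hγ0, hr₀0]
  · intro r
    by_cases h : f (r₀ (γ r)) = f g₀ <;> simp [c, h]
  · have e1 := mfderiv_mfderiv (f := r₀) (r := γ) (h := c) hγ0 (hr₀.mdifferentiableAt (by simp))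
      (hγ.mdifferentiableAt (by simp)) hc.symm (1 : ℝ)
    rw [← e1, hγd, hr₀d]

end Fibers

section Surfaces

variable {F : Type*} [NormedAddCommGroup F] [NormedSpace ℝ F]
  {G : Type*} [TopologicalSpace G] [ChartedSpace F G]

theorem mfderiv_left {f : ℝ × ℝ → G} {p q : ℝ}
    (hf : MDifferentiableAt 𝓘(ℝ, ℝ × ℝ) 𝓘(ℝ, F) f (p, q)) :
    (mfderiv 𝓘(ℝ, ℝ × ℝ) 𝓘(ℝ, F) f (p, q) ((1, 0) : ℝ × ℝ) : F)
      = mfderiv 𝓘(ℝ, ℝ) 𝓘(ℝ, F) (fun r => f (r, q)) p (1 : ℝ) := by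
  have h : HasFDerivAt (fun r : ℝ => (r, q)) (ContinuousLinearMap.inl ℝ ℝ ℝ) p :=
    hasFDerivAt_prodMk_left p q
  have h1 := mfderiv_mfderiv (f := f) (r := fun r : ℝ => (r, q)) (h := fun r => f (r, q)) rfl hf
    h.differentiableAt.mdifferentiableAt (Eventually.of_forall fun _ => rfl) (1 : ℝ)
  rw [mfderiv_eq_fderiv, h.fderiv] at h1
  exact h1

theorem mfderiv_right {f : ℝ × ℝ → G} {p q : ℝ}
    (hf : MDifferentiableAt 𝓘(ℝ, ℝ × ℝ) 𝓘(ℝ, F) f (p, q)) :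
    (mfderiv 𝓘(ℝ, ℝ × ℝ) 𝓘(ℝ, F) f (p, q) ((0, 1) : ℝ × ℝ) : F)
      = mfderiv 𝓘(ℝ, ℝ) 𝓘(ℝ, F) (fun r => f (p, r)) q (1 : ℝ) := by
  have h : HasFDerivAt (fun r : ℝ => (p, r)) (ContinuousLinearMap.inr ℝ ℝ ℝ) q :=
    hasFDerivAt_prodMk_right p q
  have h1 := mfderiv_mfderiv (f := f) (r := fun r : ℝ => (p, r)) (h := fun r => f (p, r)) rfl hf
    h.differentiableAt.mdifferentiableAt (Eventually.of_forall fun _ => rfl) (1 : ℝ)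
  rw [mfderiv_eq_fderiv, h.fderiv] at h1
  exact h1

end Surfaces

/-! ### Multiplication and translations in a Lie groupoid -/

namespace LieGroupoid

variable {E F : Type*} [NormedAddCommGroup E] [NormedSpace ℝ E]
  [NormedAddCommGroup F] [NormedSpace ℝ F]
  {M G : Type*} [TopologicalSpace M] [ChartedSpace E M] [TopologicalSpace G] [ChartedSpace F G]
  (Γ : LieGroupoid E F M G)

section Algebra

theorem inv_mul_cancel_left {g h : G} (e : Γ.src g = Γ.tgt h) :
    Γ.mul (Γ.inv g) (Γ.mul g h) = h := by
  rw [← Γ.mul_assoc _ _ _ (Γ.src_inv g) e, Γ.inv_mul, e, Γ.unit_mul]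

theorem mul_inv_cancel_right {h g : G} (e : Γ.src h = Γ.tgt g) :
    Γ.mul (Γ.mul h g) (Γ.inv g) = h := by
  rw [Γ.mul_assoc _ _ _ e (Γ.tgt_inv g).symm, Γ.mul_inv, ← e, Γ.mul_unit]

theorem inv_mul_cancel_right {h g : G} (e : Γ.src h = Γ.src g) :
    Γ.mul (Γ.mul h (Γ.inv g)) g = h := by
  rw [Γ.mul_assoc _ _ _ (e.trans (Γ.tgt_inv g).symm) (Γ.src_inv g), Γ.inv_mul, ← e, Γ.mul_unit]

theorem eq_inv_of_mul_eq_unit {h g : G} (e : Γ.src h = Γ.tgt g)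
    (e' : Γ.mul h g = Γ.unit (Γ.src g)) : h = Γ.inv g := by
  have h1 := Γ.mul_inv_cancel_right e
  rw [e', ← Γ.tgt_inv, Γ.unit_mul] at h1
  exact h1.symm

theorem inv_inv (g : G) : Γ.inv (Γ.inv g) = g :=
  (Γ.eq_inv_of_mul_eq_unit (Γ.tgt_inv g).symm ((Γ.mul_inv g).trans (by rw [Γ.src_inv]))).symm

theorem inv_unit (x : M) : Γ.inv (Γ.unit x) = Γ.unit x := by
  refine (Γ.eq_inv_of_mul_eq_unit (by rw [Γ.src_unit, Γ.tgt_unit]) ?_).symm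
  have h := Γ.unit_mul (Γ.unit x)
  rw [Γ.tgt_unit] at h
  rw [h, Γ.src_unit]

theorem inv_mul_rev {g h : G} (e : Γ.src g = Γ.tgt h) :
    Γ.inv (Γ.mul g h) = Γ.mul (Γ.inv h) (Γ.inv g) := by
  have e1 : Γ.src (Γ.inv h) = Γ.tgt (Γ.inv g) := by rw [Γ.src_inv, Γ.tgt_inv, e]
  refine (Γ.eq_inv_of_mul_eq_unit ?_ ?_).symm
  · rw [Γ.src_mul _ _ e1, Γ.src_inv, Γ.tgt_mul _ _ e]
  · rw [Γ.mul_assoc _ _ _ e1 (by rw [Γ.src_inv, Γ.tgt_mul _ _ e]), Γ.inv_mul_cancel_left e,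
      Γ.inv_mul, Γ.src_mul _ _ e]

end Algebra

section Smoothness

theorem submersionAt_src (g : G) : Manifold.IsSubmersionAt 𝓘(ℝ, F) 𝓘(ℝ, E) ∞ Γ.src g :=
  Γ.isSubmersion_src.isSubmersionAt g

theorem submersionAt_tgt (g : G) : Manifold.IsSubmersionAt 𝓘(ℝ, F) 𝓘(ℝ, E) ∞ Γ.tgt g :=
  Γ.isSubmersion_tgt.isSubmersionAt g

theorem contMDiffAt_src (g : G) : ContMDiffAt 𝓘(ℝ, F) 𝓘(ℝ, E) ∞ Γ.src g :=
  (Γ.submersionAt_src g).contMDiffAt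

theorem contMDiffAt_tgt (g : G) : ContMDiffAt 𝓘(ℝ, F) 𝓘(ℝ, E) ∞ Γ.tgt g :=
  (Γ.submersionAt_tgt g).contMDiffAt

theorem mdifferentiableAt_src (g : G) : MDifferentiableAt 𝓘(ℝ, F) 𝓘(ℝ, E) Γ.src g :=
  (Γ.contMDiffAt_src g).mdifferentiableAt (by simp)

theorem mdifferentiableAt_tgt (g : G) : MDifferentiableAt 𝓘(ℝ, F) 𝓘(ℝ, E) Γ.tgt g :=
  (Γ.contMDiffAt_tgt g).mdifferentiableAt (by simp)

theorem mdifferentiableAt_inv (g : G) : MDifferentiableAt 𝓘(ℝ, F) 𝓘(ℝ, F) Γ.inv g :=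
  Γ.smooth_inv.contMDiffAt.mdifferentiableAt (by simp)

theorem mdifferentiableAt_unit (x : M) : MDifferentiableAt 𝓘(ℝ, E) 𝓘(ℝ, F) Γ.unit x :=
  Γ.smooth_unit.contMDiffAt.mdifferentiableAt (by simp)

theorem mfderiv_src_unit (x : M) (w : E) :
    (mfderiv 𝓘(ℝ, F) 𝓘(ℝ, E) Γ.src (Γ.unit x) (mfderiv 𝓘(ℝ, E) 𝓘(ℝ, F) Γ.unit x w : F) : E)
      = w := by
  refine (mfderiv_mfderiv (f := Γ.src) (r := Γ.unit) (h := id) rfl (Γ.mdifferentiableAt_src _)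
    (Γ.mdifferentiableAt_unit x) (Eventually.of_forall Γ.src_unit) w).trans ?_
  rw [mfderiv_id]
  rfl

theorem mfderiv_tgt_unit (x : M) (w : E) :
    (mfderiv 𝓘(ℝ, F) 𝓘(ℝ, E) Γ.tgt (Γ.unit x) (mfderiv 𝓘(ℝ, E) 𝓘(ℝ, F) Γ.unit x w : F) : E)
      = w := by
  refine (mfderiv_mfderiv (f := Γ.tgt) (r := Γ.unit) (h := id) rfl (Γ.mdifferentiableAt_tgt _)
    (Γ.mdifferentiableAt_unit x) (Eventually.of_forall Γ.tgt_unit) w).trans ?_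
  rw [mfderiv_id]
  rfl

variable {E' : Type*} [NormedAddCommGroup E'] [NormedSpace ℝ E'] {H' : Type*} [TopologicalSpace H']
  {J : ModelWithCorners ℝ E' H'} {P : Type*} [TopologicalSpace P] [ChartedSpace H' P]

theorem contMDiffAt_mul {a b : P → G} {p : P} (ha : ContMDiffAt J 𝓘(ℝ, F) ∞ a p)
    (hb : ContMDiffAt J 𝓘(ℝ, F) ∞ b p) (h : ∀ᶠ q in 𝓝 p, Γ.src (a q) = Γ.tgt (b q)) :
    ContMDiffAt J 𝓘(ℝ, F) ∞ (fun q => Γ.mul (a q) (b q)) p := by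
  have h1 : ContMDiffWithinAt J (𝓘(ℝ, F).prod 𝓘(ℝ, F)) ∞ (fun q => (a q, b q))
      {q | Γ.src (a q) = Γ.tgt (b q)} p := (ha.prodMk hb).contMDiffWithinAt
  have h2 := Γ.smooth_mul (a p, b p) h.self_of_nhds
  exact (ContMDiffWithinAt.comp p (g := fun p : G × G => Γ.mul p.1 p.2) h2 h1
    (fun q hq => hq)).contMDiffAt h

/-- The smooth surface `(p, q) ↦ c(p) d(q)⁻¹` spanned by two curves in the same source fibre. -/
theorem contMDiffAt_mul_inv_curves {c d : ℝ → G} {x : M} (hc : ContMDiffAt 𝓘(ℝ, ℝ) 𝓘(ℝ, F) ∞ c 0)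
    (hd : ContMDiffAt 𝓘(ℝ, ℝ) 𝓘(ℝ, F) ∞ d 0) (hcs : ∀ r, Γ.src (c r) = x)
    (hds : ∀ r, Γ.src (d r) = x) :
    ContMDiffAt 𝓘(ℝ, ℝ × ℝ) 𝓘(ℝ, F) ∞ (fun r : ℝ × ℝ => Γ.mul (c r.1) (Γ.inv (d r.2))) 0 := by
  have h1 : ContMDiffAt 𝓘(ℝ, ℝ × ℝ) 𝓘(ℝ, F) ∞ (fun r : ℝ × ℝ => c r.1) 0 :=
    ContMDiffAt.comp (0 : ℝ × ℝ) (g := c) hc contDiff_fst.contMDiff.contMDiffAt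
  have h2 : ContMDiffAt 𝓘(ℝ, ℝ × ℝ) 𝓘(ℝ, F) ∞ (fun r : ℝ × ℝ => d r.2) 0 :=
    ContMDiffAt.comp (0 : ℝ × ℝ) (g := d) hd contDiff_snd.contMDiff.contMDiffAt
  exact Γ.contMDiffAt_mul h1 (ContMDiffAt.comp (0 : ℝ × ℝ) (g := Γ.inv) Γ.smooth_inv.contMDiffAt h2)
    (Eventually.of_forall fun r => by rw [Γ.tgt_inv, hcs, hds])

/-- Near a composable pair, the multiplication extends to a smooth map on an open subset of `G × G`,
which is still equivariant under left multiplication. -/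
theorem exists_mul_extension {h₀ g₀ : G} (e₀ : Γ.src h₀ = Γ.tgt g₀) :
    ∃ m : G × G → G, ContMDiffAt (𝓘(ℝ, F).prod 𝓘(ℝ, F)) 𝓘(ℝ, F) ∞ m (h₀, g₀) ∧
      (∀ᶠ g in 𝓝 g₀, ∀ h, Γ.src h = Γ.tgt g → m (h, g) = Γ.mul h g) ∧
      (∀ᶠ p in 𝓝 (h₀, g₀), Γ.tgt (m p) = Γ.tgt p.1) ∧
      ∀ᶠ p in 𝓝 (h₀, g₀), ∀ k, Γ.src k = Γ.tgt p.1 → m (Γ.mul k p.1, p.2) = Γ.mul k (m p) := by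
  obtain ⟨ρ, hρ, hρ1, hρ2⟩ := exists_retraction (Γ.submersionAt_tgt g₀)
  have h1 : ContMDiffAt (𝓘(ℝ, F).prod 𝓘(ℝ, F)) (𝓘(ℝ, E).prod 𝓘(ℝ, F)) ∞
      (fun p : G × G => (Γ.src p.1, p.2)) (h₀, g₀) :=
    (ContMDiffAt.comp (h₀, g₀) (g := Γ.src) (Γ.contMDiffAt_src h₀) contMDiffAt_fst).prodMk
      contMDiffAt_snd
  have h2 : ContMDiffAt (𝓘(ℝ, F).prod 𝓘(ℝ, F)) 𝓘(ℝ, F) ∞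
      (fun p : G × G => ρ (Γ.src p.1, p.2)) (h₀, g₀) :=
    ContMDiffAt.comp (h₀, g₀) (g := ρ) (by rw [e₀]; exact hρ) h1
  have h3 : ∀ᶠ p in 𝓝 (h₀, g₀), Γ.tgt (ρ (Γ.src p.1, p.2)) = Γ.src p.1 := by
    have h := h1.continuousAt.tendsto
    rw [e₀] at h
    exact h.eventually hρ1
  refine ⟨fun p => Γ.mul p.1 (ρ (Γ.src p.1, p.2)), Γ.contMDiffAt_mul contMDiffAt_fst h2
    (h3.mono fun _ h => h.symm), ?_, h3.mono fun p hp => Γ.tgt_mul _ _ hp.symm, ?_⟩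
  · filter_upwards [hρ2] with g hg h hh
    simp only [hh, hg]
  · filter_upwards [h3] with p hp k hk
    simp only [Γ.src_mul _ _ hk]
    exact Γ.mul_assoc _ _ _ hk hp.symm

end Smoothness

section Translations

/-- The derivative of a right translation, computed on a curve in a source fibre. -/
theorem dR_eq_of_curve {g : G} {a : Γ.Alg (Γ.tgt g)} {c : ℝ → G} (hc0 : c 0 = Γ.unit (Γ.tgt g))
    (hs : ∀ r, Γ.src (c r) = Γ.tgt g) (hc : ContMDiffAt 𝓘(ℝ, ℝ) 𝓘(ℝ, F) ∞ c 0)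
    (ha : (mfderiv 𝓘(ℝ, ℝ) 𝓘(ℝ, F) c 0 (1 : ℝ) : F) = a.1) :
    (Γ.dR g a : F) = mfderiv 𝓘(ℝ, ℝ) 𝓘(ℝ, F) (fun r => Γ.mul (c r) g) 0 (1 : ℝ) := by
  let S : Set G := {h | Γ.src h = Γ.tgt g}
  have h1 : ContMDiffOn 𝓘(ℝ, F) 𝓘(ℝ, F) ∞ (fun h => Γ.mul h g) S :=
    Γ.smooth_mul.comp (f := fun h : G => (h, g)) (contMDiff_id.prodMk contMDiff_const).contMDiffOn
      (fun h hh => hh)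
  have h2 := ((h1 (c 0) (hs 0)).mdifferentiableWithinAt (by simp)).hasMFDerivWithinAt
  have h3 := (hc.mdifferentiableAt (by simp)).hasMFDerivAt.hasMFDerivWithinAt (s := Set.univ)
  have h4 := (HasMFDerivWithinAt.comp (0 : ℝ) h2 h3 (fun r _ => hs r)).hasMFDerivAt univ_mem
  refine Eq.trans ?_ (congrArg (fun T : ℝ →L[ℝ] F => T 1) h4.mfderiv).symm
  have h5 : ∀ y, y = c 0 → (mfderivWithin 𝓘(ℝ, F) 𝓘(ℝ, F) (fun h => Γ.mul h g) S y : F →L[ℝ] F)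
      = mfderivWithin 𝓘(ℝ, F) 𝓘(ℝ, F) (fun h => Γ.mul h g) S (c 0) := by
    rintro y rfl; rfl
  refine (congrArg (fun T : F →L[ℝ] F => T a.1) (h5 _ hc0.symm)).trans ?_
  rw [← ha]
  rfl

theorem dL_eq_of_curve {g : G} {a : F} {c : ℝ → G} (hc0 : c 0 = Γ.unit (Γ.src g))
    (hs : ∀ r, Γ.tgt (c r) = Γ.src g) (hc : ContMDiffAt 𝓘(ℝ, ℝ) 𝓘(ℝ, F) ∞ c 0)
    (ha : (mfderiv 𝓘(ℝ, ℝ) 𝓘(ℝ, F) c 0 (1 : ℝ) : F) = a) :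
    (Γ.dL g a : F) = mfderiv 𝓘(ℝ, ℝ) 𝓘(ℝ, F) (fun r => Γ.mul g (c r)) 0 (1 : ℝ) := by
  let S : Set G := {h | Γ.tgt h = Γ.src g}
  have h1 : ContMDiffOn 𝓘(ℝ, F) 𝓘(ℝ, F) ∞ (fun h => Γ.mul g h) S :=
    Γ.smooth_mul.comp (f := fun h : G => (g, h)) (contMDiff_const.prodMk contMDiff_id).contMDiffOn
      (fun h hh => Eq.symm hh)
  have h2 := ((h1 (c 0) (hs 0)).mdifferentiableWithinAt (by simp)).hasMFDerivWithinAt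
  have h3 := (hc.mdifferentiableAt (by simp)).hasMFDerivAt.hasMFDerivWithinAt (s := Set.univ)
  have h4 := (HasMFDerivWithinAt.comp (0 : ℝ) h2 h3 (fun r _ => hs r)).hasMFDerivAt univ_mem
  refine Eq.trans ?_ (congrArg (fun T : ℝ →L[ℝ] F => T 1) h4.mfderiv).symm
  have h5 : ∀ y, y = c 0 → (mfderivWithin 𝓘(ℝ, F) 𝓘(ℝ, F) (fun h => Γ.mul g h) S y : F →L[ℝ] F)
      = mfderivWithin 𝓘(ℝ, F) 𝓘(ℝ, F) (fun h => Γ.mul g h) S (c 0) := by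
    rintro y rfl; rfl
  refine (congrArg (fun T : F →L[ℝ] F => T a) (h5 _ hc0.symm)).trans ?_
  rw [← ha]
  rfl

variable [IsManifold 𝓘(ℝ, F) ∞ G]

/-- The vector `dR_g(a)` is the velocity of `r ↦ c(r) g` for a curve `c` with velocity `a` in the
source fibre through the unit of `t(g)`. -/
theorem exists_curve_dR {g : G} (a : Γ.Alg (Γ.tgt g)) :
    ∃ c : ℝ → G, c 0 = Γ.unit (Γ.tgt g) ∧ ContMDiffAt 𝓘(ℝ, ℝ) 𝓘(ℝ, F) ∞ c 0 ∧
      (∀ r, Γ.src (c r) = Γ.tgt g) ∧ (mfderiv 𝓘(ℝ, ℝ) 𝓘(ℝ, F) c 0 (1 : ℝ) : F) = a.1 ∧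
      ContMDiffAt 𝓘(ℝ, ℝ) 𝓘(ℝ, F) ∞ (fun r => Γ.mul (c r) g) 0 ∧
      Γ.mul (c 0) g = g ∧
      (Γ.dR g a : F) = mfderiv 𝓘(ℝ, ℝ) 𝓘(ℝ, F) (fun r => Γ.mul (c r) g) 0 (1 : ℝ) := by
  obtain ⟨c, hc0, hc, hs, ha⟩ := exists_curve_of_mfderiv_eq_zero
    (Γ.submersionAt_src (Γ.unit (Γ.tgt g))) (a := a.1) a.2
  rw [Γ.src_unit] at hs
  exact ⟨c, hc0, hc, hs, ha, Γ.contMDiffAt_mul hc contMDiffAt_const (Eventually.of_forall hs),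
    by rw [hc0, Γ.unit_mul], Γ.dR_eq_of_curve hc0 hs hc ha⟩

theorem mfderiv_tgt_dR (g : G) (a : Γ.Alg (Γ.tgt g)) :
    (mfderiv 𝓘(ℝ, F) 𝓘(ℝ, E) Γ.tgt g (Γ.dR g a) : E) = Γ.anchor (Γ.tgt g) a := by
  obtain ⟨c, hc0, hc, hs, ha, hcg, hg, hd⟩ := Γ.exists_curve_dR a
  have e1 := mfderiv_mfderiv (f := Γ.tgt) (h := fun r => Γ.tgt (c r)) hg (Γ.mdifferentiableAt_tgt g)
    (hcg.mdifferentiableAt (by simp)) (Eventually.of_forall fun r => Γ.tgt_mul _ _ (hs r)) (1 : ℝ)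
  have e2 := mfderiv_mfderiv (f := Γ.tgt) (h := fun r => Γ.tgt (c r)) hc0
    (Γ.mdifferentiableAt_tgt _)
    (hc.mdifferentiableAt (by simp)) (Eventually.of_forall fun r => rfl) (1 : ℝ)
  rw [← hd] at e1
  rw [ha] at e2
  exact e1.trans e2.symm

theorem mfderiv_src_dR (g : G) (a : Γ.Alg (Γ.tgt g)) :
    (mfderiv 𝓘(ℝ, F) 𝓘(ℝ, E) Γ.src g (Γ.dR g a) : E) = 0 := by
  obtain ⟨c, hc0, hc, hs, ha, hcg, hg, hd⟩ := Γ.exists_curve_dR a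
  have e1 := mfderiv_mfderiv (f := Γ.src) (r := fun r => Γ.mul (c r) g) (h := fun _ => Γ.src g) hg
    (Γ.mdifferentiableAt_src g) (hcg.mdifferentiableAt (by simp))
    (Eventually.of_forall fun r => Γ.src_mul _ _ (hs r)) (1 : ℝ)
  rw [← hd, mfderiv_const] at e1
  exact e1

/-- The right translation by `g` is inverted by the right translation by `g⁻¹`. -/
theorem dR_injective (g : G) : Function.Injective (Γ.dR g) := by
  have e0 : Γ.src g = Γ.tgt (Γ.inv g) := (Γ.tgt_inv g).symm
  obtain ⟨m, hm, hm1, -⟩ := Γ.exists_mul_extension e0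
  have hm' : ContMDiffAt 𝓘(ℝ, F) 𝓘(ℝ, F) ∞ (fun h => m (h, Γ.inv g)) g :=
    ContMDiffAt.comp g (g := m) hm (contMDiffAt_id.prodMk contMDiffAt_const)
  have key : ∀ a : Γ.Alg (Γ.tgt g),
      (mfderiv 𝓘(ℝ, F) 𝓘(ℝ, F) (fun h => m (h, Γ.inv g)) g (Γ.dR g a) : F) = a.1 := by
    intro a
    obtain ⟨c, hc0, hc, hs, ha, hcg, hg, hd⟩ := Γ.exists_curve_dR a
    have e1 := mfderiv_mfderiv (f := fun h => m (h, Γ.inv g)) (h := c) hg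
      (hm'.mdifferentiableAt (by simp)) (hcg.mdifferentiableAt (by simp))
      (Eventually.of_forall fun r => ?_) (1 : ℝ)
    · rw [← hd, ha] at e1
      exact e1
    · have := hm1.self_of_nhds (Γ.mul (c r) g) (by rw [Γ.src_mul _ _ (hs r), e0])
      rw [this, Γ.mul_inv_cancel_right (hs r)]
  intro a b hab
  refine Subtype.ext ?_
  have h1 := key a
  rw [hab] at h1
  exact h1.symm.trans (key b)

/-- The right translation by `g` maps `A` at `t(g)` onto `ker ds` at `g`. -/
theorem exists_dR_eq {g : G} {b : F} (hb : b ∈ Γ.kerSrc g) :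
    ∃ a : Γ.Alg (Γ.tgt g), (Γ.dR g a : F) = b := by
  obtain ⟨c, hc0, hc, hs, hcb⟩ := exists_curve_of_mfderiv_eq_zero (Γ.submersionAt_src g) hb
  have hs' : ∀ r, Γ.src (c r) = Γ.tgt (Γ.inv g) := fun r => (hs r).trans (Γ.tgt_inv g).symm
  have h1 : ContMDiffAt 𝓘(ℝ, ℝ) 𝓘(ℝ, F) ∞ (fun r => Γ.mul (c r) (Γ.inv g)) 0 :=
    Γ.contMDiffAt_mul hc contMDiffAt_const (Eventually.of_forall hs')
  have h0 : Γ.mul (c 0) (Γ.inv g) = Γ.unit (Γ.tgt g) := by rw [hc0, Γ.mul_inv]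
  have hs1 : ∀ r, Γ.src (Γ.mul (c r) (Γ.inv g)) = Γ.tgt g := fun r => by
    rw [Γ.src_mul _ _ (hs' r), Γ.src_inv]
  have e1 := mfderiv_mfderiv (f := Γ.src) (r := fun r => Γ.mul (c r) (Γ.inv g))
    (h := fun _ => Γ.tgt g) h0 (Γ.mdifferentiableAt_src _)
    (h1.mdifferentiableAt (by simp)) (Eventually.of_forall hs1) (1 : ℝ)
  rw [mfderiv_const] at e1
  refine ⟨⟨_, e1⟩, (Γ.dR_eq_of_curve h0 hs1 h1 rfl).trans ?_⟩
  have e2 : (fun r => Γ.mul (Γ.mul (c r) (Γ.inv g)) g) = c :=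
    funext fun r => Γ.inv_mul_cancel_right (hs r)
  refine Eq.trans ?_ hcb
  exact congrArg (fun f : ℝ → G => (mfderiv 𝓘(ℝ, ℝ) 𝓘(ℝ, F) f 0 (1 : ℝ) : F)) e2

theorem dR_unit (x : M) (a : Γ.Alg (Γ.tgt (Γ.unit x))) : (Γ.dR (Γ.unit x) a : F) = a.1 := by
  obtain ⟨c, hc0, hc, hs, ha, hcg, hg, hd⟩ := Γ.exists_curve_dR a
  have e2 : (fun r => Γ.mul (c r) (Γ.unit x)) = c := funext fun r => by
    have h := hs r
    rw [Γ.tgt_unit] at h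
    rw [← h, Γ.mul_unit]
  refine hd.trans (Eq.trans ?_ ha)
  exact congrArg (fun f : ℝ → G => (mfderiv 𝓘(ℝ, ℝ) 𝓘(ℝ, F) f 0 (1 : ℝ) : F)) e2

end Translations

end LieGroupoid

/-! ### Right invariant vector fields and invariant lifts -/

namespace LieGroupoid

variable {E F : Type*} [NormedAddCommGroup E] [NormedSpace ℝ E]
  [NormedAddCommGroup F] [NormedSpace ℝ F]
  {M G : Type*} [TopologicalSpace M] [ChartedSpace E M]
  [TopologicalSpace G] [ChartedSpace F G] [IsManifold 𝓘(ℝ, F) ∞ G]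
  (Γ : LieGroupoid E F M G)

section RightInvariantFields

/-- The derivative of the right translation by `g`, in terms of an extended multiplication. -/
theorem mfderiv_extension_eq_dR {m : G × G → G} {g : G}
    (hm : MDifferentiableAt (𝓘(ℝ, F).prod 𝓘(ℝ, F)) 𝓘(ℝ, F) m (Γ.unit (Γ.tgt g), g))
    (hm1 : ∀ h, Γ.src h = Γ.tgt g → m (h, g) = Γ.mul h g) (a : Γ.Alg (Γ.tgt g)) :
    (mfderiv (𝓘(ℝ, F).prod 𝓘(ℝ, F)) 𝓘(ℝ, F) m (Γ.unit (Γ.tgt g), g) ((a.1, 0) : F × F) : F)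
      = Γ.dR g a := by
  obtain ⟨c, hc0, hc, hs, ha, hcg, hg, hd⟩ := Γ.exists_curve_dR a
  have h1 := (hc.mdifferentiableAt (by simp)).hasMFDerivAt.prodMk
    (hasMFDerivAt_const (I := 𝓘(ℝ, ℝ)) (I' := 𝓘(ℝ, F)) g (0 : ℝ))
  have h2 := mfderiv_mfderiv (f := m) (r := fun r => (c r, g)) (h := fun r => Γ.mul (c r) g)
    (y := (Γ.unit (Γ.tgt g), g)) (by rw [hc0]) hm h1.mdifferentiableAt
    (Eventually.of_forall fun r => hm1 _ (hs r)) (1 : ℝ)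
  rw [← hd] at h2
  refine Eq.trans ?_ h2
  have h3 : ((a.1, 0) : F × F)
      = mfderiv 𝓘(ℝ, ℝ) (𝓘(ℝ, F).prod 𝓘(ℝ, F)) (fun r => (c r, g)) 0 (1 : ℝ) := by
    refine Eq.trans ?_ (congrArg (fun T : ℝ →L[ℝ] F × F => T 1) h1.mfderiv.symm)
    exact Prod.ext ha.symm rfl
  exact congrArg (mfderiv (𝓘(ℝ, F).prod 𝓘(ℝ, F)) 𝓘(ℝ, F) m (Γ.unit (Γ.tgt g), g)) h3

/-- `dR_g(α)` depends smoothly on `g` and `α`. The domain of the right translation by `g` varies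
with `g`, so its derivative is expressed by that of an extension of the multiplication to an open
set. -/
theorem contMDiffAt_dR {E' : Type*} [NormedAddCommGroup E'] [NormedSpace ℝ E'] {H' : Type*}
    [TopologicalSpace H'] {J : ModelWithCorners ℝ E' H'} {P : Type*} [TopologicalSpace P]
    [ChartedSpace H' P] {γ : P → G} {α : ∀ p, Γ.Alg (Γ.tgt (γ p))} {p : P}
    (hγ : ContMDiffAt J 𝓘(ℝ, F) ∞ γ p)
    (hα : ContMDiffAt J 𝓘(ℝ, F).tangent ∞
      (fun q => (⟨Γ.unit (Γ.tgt (γ q)), (α q).1⟩ : TangentBundle 𝓘(ℝ, F) G)) p) :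
    ContMDiffAt J 𝓘(ℝ, F).tangent ∞
      (fun q => (⟨γ q, Γ.dR (γ q) (α q)⟩ : TangentBundle 𝓘(ℝ, F) G)) p := by
  obtain ⟨m, hm, hm1, -, -⟩ := Γ.exists_mul_extension (Γ.src_unit (Γ.tgt (γ p)))
  have h0 : ContMDiffAt J 𝓘(ℝ, F).tangent ∞
      (fun q => (⟨γ q, (0 : F)⟩ : TangentBundle 𝓘(ℝ, F) G)) p :=
    ContMDiffAt.comp p (g := fun g => (⟨g, (0 : F)⟩ : TangentBundle 𝓘(ℝ, F) G))
      (Bundle.contMDiff_zeroSection ℝ (TangentSpace 𝓘(ℝ, F) : G → Type _)).contMDiffAt hγ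
  have h1 := (contMDiff_equivTangentBundleProd_symm (n := ∞) (I := 𝓘(ℝ, F)) (M := G)
      (I' := 𝓘(ℝ, F)) (M' := G)).contMDiffAt.comp p (hα.prodMk h0)
  have h2 := ContMDiffAt.comp p (contMDiffAt_tangentMap hm) h1
  refine h2.congr_of_eventuallyEq ?_
  have h3 : ContinuousAt (fun q => (Γ.unit (Γ.tgt (γ q)), γ q)) p := by
    refine ContinuousAt.prodMk ?_ hγ.continuousAt
    exact (FiberBundle.continuous_proj F (TangentSpace 𝓘(ℝ, F))).continuousAt.comp hα.continuousAt
  filter_upwards [hγ.continuousAt.eventually hm1,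
    h3.eventually (eventually_mdifferentiableAt hm)] with q hq1 hq2
  have e1 := Γ.mfderiv_extension_eq_dR hq2 hq1 (α q)
  have e2 : m (Γ.unit (Γ.tgt (γ q)), γ q) = γ q := by
    rw [hq1 _ (Γ.src_unit _), Γ.unit_mul]
  refine (tangentBundle_mk_congr e2.symm _).trans ?_
  exact congrArg (fun v : F =>
    (⟨m (Γ.unit (Γ.tgt (γ q)), γ q), v⟩ : TangentBundle 𝓘(ℝ, F) G)) e1.symm

theorem smoothFieldAt_rightInvariant {a : ∀ x : M, Γ.Alg x} {g : G}
    (ha : ContMDiffAt 𝓘(ℝ, E) 𝓘(ℝ, F).tangent ∞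
      (fun x => (⟨Γ.unit x, (a x).1⟩ : TangentBundle 𝓘(ℝ, F) G)) (Γ.tgt g)) :
    SmoothFieldAt (Γ.rightInvariant a) g :=
  Γ.contMDiffAt_dR (γ := id) (α := fun g => a (Γ.tgt g)) contMDiffAt_id
    (ContMDiffAt.comp g (g := fun x => (⟨Γ.unit x, (a x).1⟩ : TangentBundle 𝓘(ℝ, F) G)) ha
      (Γ.contMDiffAt_tgt g))

omit [IsManifold 𝓘(ℝ, F) ∞ G] in
theorem section_congr (a : ∀ x : M, Γ.Alg x) {x y : M} (e : x = y) :
    ((a x).1 : F) = (a y).1 := by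
  subst e; rfl

variable [IsManifold 𝓘(ℝ, E) ∞ M]

omit [IsManifold 𝓘(ℝ, E) ∞ M] in
/-- The commutator of right invariant vector fields is right invariant. -/
theorem mlieBracket_rightInvariant {a b : ∀ x : M, Γ.Alg x} {g : G}
    (ha : ContMDiffAt 𝓘(ℝ, E) 𝓘(ℝ, F).tangent ∞
      (fun x => (⟨Γ.unit x, (a x).1⟩ : TangentBundle 𝓘(ℝ, F) G)) (Γ.tgt g))
    (hb : ContMDiffAt 𝓘(ℝ, E) 𝓘(ℝ, F).tangent ∞
      (fun x => (⟨Γ.unit x, (b x).1⟩ : TangentBundle 𝓘(ℝ, F) G)) (Γ.tgt g))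
    (c : Γ.Alg (Γ.tgt g)) (hc : (c.1 : F) = Γ.bracket a b (Γ.tgt g)) :
    (mlieBracket 𝓘(ℝ, F) (Γ.rightInvariant a) (Γ.rightInvariant b) g : F) = Γ.dR g c := by
  obtain ⟨m, hm, hm1, hm2, hm3⟩ := Γ.exists_mul_extension (Γ.src_unit (Γ.tgt g))
  have hι : ContMDiffAt 𝓘(ℝ, F) (𝓘(ℝ, F).prod 𝓘(ℝ, F)) ∞ (fun h : G => (h, g))
      (Γ.unit (Γ.tgt g)) := contMDiffAt_id.prodMk contMDiffAt_const
  let φ : G → G := fun h => m (h, g)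
  have hφ : ContMDiffAt 𝓘(ℝ, F) 𝓘(ℝ, F) ∞ φ (Γ.unit (Γ.tgt g)) :=
    ContMDiffAt.comp _ (g := m) hm hι
  have hφ0 : φ (Γ.unit (Γ.tgt g)) = g :=
    (hm1.self_of_nhds _ (Γ.src_unit _)).trans (Γ.unit_mul g)
  -- `φ` intertwines each right invariant vector field with itself
  have hrel : ∀ a : ∀ x : M, Γ.Alg x, ∀ᶠ h in 𝓝 (Γ.unit (Γ.tgt g)),
      mfderiv 𝓘(ℝ, F) 𝓘(ℝ, F) φ h (Γ.rightInvariant a h) = Γ.rightInvariant a (φ h) := by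
    intro a
    filter_upwards [hι.continuousAt.eventually hm2, hι.continuousAt.eventually hm3,
      eventually_mdifferentiableAt hφ] with h h2 h3 h4
    obtain ⟨c, hc0, hc, hs, ha, hcg, hg, hd⟩ := Γ.exists_curve_dR (a (Γ.tgt h))
    have e1 := mfderiv_mfderiv (f := φ) (r := fun r => Γ.mul (c r) h)
      (h := fun r => Γ.mul (c r) (φ h)) hg h4
      (hcg.mdifferentiableAt (by simp)) (Eventually.of_forall fun r => h3 _ (hs r)) (1 : ℝ)
    have e2 : Γ.tgt (φ h) = Γ.tgt h := h2
    have e3 := Γ.dR_eq_of_curve (g := φ h) (a := a (Γ.tgt (φ h))) (c := c) (by rw [hc0, e2])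
      (fun r => (hs r).trans e2.symm) hc (ha.trans (Γ.section_congr a e2.symm))
    rw [← hd] at e1
    exact e1.trans e3.symm
  have hl := mfderiv_mlieBracket_of_related hφ
    (Γ.smoothFieldAt_rightInvariant (a := a) (by rw [Γ.tgt_unit]; exact ha))
    (Γ.smoothFieldAt_rightInvariant (a := b) (by rw [Γ.tgt_unit]; exact hb))
    (by rw [hφ0]; exact Γ.smoothFieldAt_rightInvariant ha)
    (by rw [hφ0]; exact Γ.smoothFieldAt_rightInvariant hb) (hrel a) (hrel b)
  have e1 := Γ.mfderiv_extension_eq_dR (hm.mdifferentiableAt (by simp)) hm1.self_of_nhds c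
  have e2 := mfderiv_mfderiv (f := m) (r := fun h => (h, g)) (h := φ) rfl
    (hm.mdifferentiableAt (by simp)) (hι.mdifferentiableAt (by simp))
    (Eventually.of_forall fun _ => rfl) c.1
  have e3 : (mfderiv 𝓘(ℝ, F) (𝓘(ℝ, F).prod 𝓘(ℝ, F)) (fun h : G => (h, g))
      (Γ.unit (Γ.tgt g)) c.1 : F × F) = (c.1, 0) := by
    have := ((hasMFDerivAt_id (I := 𝓘(ℝ, F)) (Γ.unit (Γ.tgt g))).prodMk
      (hasMFDerivAt_const (I := 𝓘(ℝ, F)) (I' := 𝓘(ℝ, F)) g (Γ.unit (Γ.tgt g)))).mfderiv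
    exact congrArg (fun T : F →L[ℝ] F × F => T c.1) this
  have e4 : ∀ h, h = g → (mlieBracket 𝓘(ℝ, F) (Γ.rightInvariant a) (Γ.rightInvariant b) g : F)
      = mlieBracket 𝓘(ℝ, F) (Γ.rightInvariant a) (Γ.rightInvariant b) h := by
    rintro h rfl; rfl
  refine (e4 _ hφ0).trans (hl.symm.trans (Eq.trans ?_ e1))
  have e5 := (congrArg (mfderiv (𝓘(ℝ, F).prod 𝓘(ℝ, F)) 𝓘(ℝ, F) m (Γ.unit (Γ.tgt g), g))
    e3).symm.trans e2
  exact (congrArg (mfderiv 𝓘(ℝ, F) 𝓘(ℝ, F) φ (Γ.unit (Γ.tgt g))) hc.symm).trans e5.symm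

end RightInvariantFields

section Lifts

variable (U : ∀ x : M, TangentSpace 𝓘(ℝ, E) x →L[ℝ] Γ.Alg x)

omit [IsManifold 𝓘(ℝ, F) ∞ G] in
theorem bundleMap_congr {x y : M} (e : x = y) {v w : E} (h : v = w) :
    ((U x v).1 : F) = (U y w).1 := by
  subst e h; rfl

/-- The left invariant lift is the conjugate of the right invariant lift by the inversion. -/
theorem leftLift_eq (g : G) (v : F) :
    (Γ.leftLift U g v : F) = mfderiv 𝓘(ℝ, F) 𝓘(ℝ, F) Γ.inv (Γ.inv g)
      (Γ.rightLift U (Γ.inv g) (mfderiv 𝓘(ℝ, F) 𝓘(ℝ, F) Γ.inv g v : F) : F) := by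
  obtain ⟨c, hc0, hc, hs, ha, hcg, hg, hd⟩ := Γ.exists_curve_dR (g := Γ.inv g)
    (U (Γ.tgt (Γ.inv g)) (mfderiv 𝓘(ℝ, F) 𝓘(ℝ, E) Γ.tgt (Γ.inv g)
      (mfderiv 𝓘(ℝ, F) 𝓘(ℝ, F) Γ.inv g v : F)))
  have h1 := mfderiv_mfderiv (f := Γ.tgt) (r := Γ.inv) (h := Γ.src) rfl (Γ.mdifferentiableAt_tgt _)
    (Γ.mdifferentiableAt_inv g) (Eventually.of_forall Γ.tgt_inv) v
  have h2 := Γ.bundleMap_congr U (Γ.tgt_inv g) h1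
  have hc0' : c 0 = Γ.unit (Γ.src g) := by rw [hc0, Γ.tgt_inv]
  have hi : ContMDiffAt 𝓘(ℝ, ℝ) 𝓘(ℝ, F) ∞ (fun r => Γ.inv (c r)) 0 :=
    ContMDiffAt.comp (0 : ℝ) (g := Γ.inv) Γ.smooth_inv.contMDiffAt hc
  have h3 := mfderiv_mfderiv (f := Γ.inv) (r := c) (h := fun r => Γ.inv (c r)) hc0'
    (Γ.mdifferentiableAt_inv _) (hc.mdifferentiableAt (by simp))
    (Eventually.of_forall fun _ => rfl) (1 : ℝ)
  rw [ha, h2] at h3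
  have h4 := Γ.dL_eq_of_curve (g := g) (c := fun r => Γ.inv (c r)) (by rw [hc0', Γ.inv_unit])
    (fun r => by rw [Γ.tgt_inv, hs, Γ.tgt_inv]) hi h3.symm
  have h5 := mfderiv_mfderiv (f := Γ.inv) (r := fun r => Γ.mul (c r) (Γ.inv g))
    (h := fun r => Γ.mul g (Γ.inv (c r))) hg (Γ.mdifferentiableAt_inv _)
    (hcg.mdifferentiableAt (by simp))
    (Eventually.of_forall fun r => by rw [Γ.inv_mul_rev (hs r), Γ.inv_inv]) (1 : ℝ)
  rw [← hd] at h5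
  exact h4.trans h5.symm

theorem mfderiv_src_rightLift (g : G) (v : F) :
    (mfderiv 𝓘(ℝ, F) 𝓘(ℝ, E) Γ.src g (Γ.rightLift U g v) : E) = 0 :=
  Γ.mfderiv_src_dR g _

theorem mfderiv_tgt_rightLift (g : G) (v : F) :
    (mfderiv 𝓘(ℝ, F) 𝓘(ℝ, E) Γ.tgt g (Γ.rightLift U g v) : E)
      = Γ.anchor (Γ.tgt g) (U (Γ.tgt g) (mfderiv 𝓘(ℝ, F) 𝓘(ℝ, E) Γ.tgt g v)) :=
  Γ.mfderiv_tgt_dR g _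

theorem mfderiv_tgt_leftLift (g : G) (v : F) :
    (mfderiv 𝓘(ℝ, F) 𝓘(ℝ, E) Γ.tgt g (Γ.leftLift U g v) : E) = 0 := by
  have h := mfderiv_mfderiv (f := Γ.tgt) (r := Γ.inv) (h := Γ.src) (x := Γ.inv g) (Γ.inv_inv g)
    (Γ.mdifferentiableAt_tgt _) (Γ.mdifferentiableAt_inv _) (Eventually.of_forall Γ.tgt_inv)
    (Γ.rightLift U (Γ.inv g) (mfderiv 𝓘(ℝ, F) 𝓘(ℝ, F) Γ.inv g v : F))
  rw [← Γ.leftLift_eq] at h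
  exact h.trans (Γ.mfderiv_src_rightLift U _ _)

theorem mfderiv_src_leftLift (g : G) (v : F) :
    (mfderiv 𝓘(ℝ, F) 𝓘(ℝ, E) Γ.src g (Γ.leftLift U g v) : E)
      = Γ.anchor (Γ.src g) (U (Γ.src g) (mfderiv 𝓘(ℝ, F) 𝓘(ℝ, E) Γ.src g v)) := by
  have h := mfderiv_mfderiv (f := Γ.src) (r := Γ.inv) (h := Γ.tgt) (x := Γ.inv g) (Γ.inv_inv g)
    (Γ.mdifferentiableAt_src _) (Γ.mdifferentiableAt_inv _) (Eventually.of_forall Γ.src_inv)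
    (Γ.rightLift U (Γ.inv g) (mfderiv 𝓘(ℝ, F) 𝓘(ℝ, F) Γ.inv g v : F))
  rw [← Γ.leftLift_eq] at h
  have h1 := mfderiv_mfderiv (f := Γ.tgt) (r := Γ.inv) (h := Γ.src) rfl (Γ.mdifferentiableAt_tgt _)
    (Γ.mdifferentiableAt_inv g) (Eventually.of_forall Γ.tgt_inv) v
  have h2 : ∀ x y : M, x = y → ∀ w : E, (Γ.anchor x (U x w) : E) = Γ.anchor y (U y w) := by
    rintro x y rfl w; rfl
  refine h.trans ((Γ.mfderiv_tgt_rightLift U _ _).trans ((h2 _ _ (Γ.tgt_inv g) _).trans ?_))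
  exact congrArg (fun w : E => (Γ.anchor (Γ.src g) (U (Γ.src g) w) : E)) h1

variable {U} [IsManifold 𝓘(ℝ, E) ∞ M]

theorem smoothTensor_rightLift (hU : Γ.IsBundleMap U) : SmoothTensor (Γ.rightLift U) := by
  intro p
  refine Γ.contMDiffAt_dR (γ := Bundle.TotalSpace.proj) (α := fun p : TangentBundle 𝓘(ℝ, F) G =>
    U (Γ.tgt p.1) (mfderiv 𝓘(ℝ, F) 𝓘(ℝ, E) Γ.tgt p.1 p.2))
    (Bundle.contMDiff_proj (TangentSpace 𝓘(ℝ, F) : G → Type _)).contMDiffAt ?_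
  exact ContMDiffAt.comp p (g := Γ.bundleMap U) (hU _)
    (contMDiffAt_tangentMap (Γ.contMDiffAt_tgt _))

theorem smoothTensor_leftLift (hU : Γ.IsBundleMap U) : SmoothTensor (Γ.leftLift U) := by
  intro p
  have h1 : ContMDiff 𝓘(ℝ, F).tangent 𝓘(ℝ, F).tangent ∞ (tangentMap 𝓘(ℝ, F) 𝓘(ℝ, F) Γ.inv) :=
    fun p => contMDiffAt_tangentMap Γ.smooth_inv.contMDiffAt
  refine ((h1.comp ((Γ.smoothTensor_rightLift hU).comp h1)) p).congr_of_eventuallyEq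
    (Eventually.of_forall fun p => ?_)
  refine (tangentBundle_mk_congr (Γ.inv_inv p.1).symm _).trans ?_
  exact congrArg (fun v : F => (⟨Γ.inv (Γ.inv p.1), v⟩ : TangentBundle 𝓘(ℝ, F) G))
    (Γ.leftLift_eq U p.1 p.2)

end Lifts

end LieGroupoid

/-! ### The torsion of a `(1,1)` tensor -/

section Torsion

variable {E : Type*} [NormedAddCommGroup E] [NormedSpace ℝ E]
  {M : Type*} [TopologicalSpace M] [ChartedSpace E M] [IsManifold 𝓘(ℝ, E) ∞ M]
  {F : Type*} [NormedAddCommGroup F] [NormedSpace ℝ F]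
  {G : Type*} [TopologicalSpace G] [ChartedSpace F G] [IsManifold 𝓘(ℝ, F) ∞ G]

/-- Linear combinations of smooth vector fields along a map are smooth. -/
theorem contMDiffAt_add_const_smul {E' : Type*} [NormedAddCommGroup E'] [NormedSpace ℝ E']
    {H' : Type*} [TopologicalSpace H'] {J : ModelWithCorners ℝ E' H'} {P : Type*}
    [TopologicalSpace P] [ChartedSpace H' P] {f : P → M} {s t : ∀ p, TangentSpace 𝓘(ℝ, E) (f p)}
    {p : P} (hs : ContMDiffAt J 𝓘(ℝ, E).tangent ∞
      (fun q => (⟨f q, s q⟩ : TangentBundle 𝓘(ℝ, E) M)) p)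
    (ht : ContMDiffAt J 𝓘(ℝ, E).tangent ∞
      (fun q => (⟨f q, t q⟩ : TangentBundle 𝓘(ℝ, E) M)) p) (c : ℝ) :
    ContMDiffAt J 𝓘(ℝ, E).tangent ∞
      (fun q => (⟨f q, s q + c • t q⟩ : TangentBundle 𝓘(ℝ, E) M)) p := by
  obtain ⟨hf, h1⟩ := Bundle.contMDiffAt_totalSpace.1 hs
  have h2 := (Bundle.contMDiffAt_totalSpace.1 ht).2
  refine Bundle.contMDiffAt_totalSpace.2 ⟨hf, ?_⟩
  have hc : ContMDiffAt J 𝓘(ℝ, ℝ) ∞ (fun _ : P => c) p := contMDiffAt_const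
  refine (h1.add (hc.smul h2)).congr_of_eventuallyEq ?_
  filter_upwards [hf.continuousAt.eventually (chart_source_mem_nhds E (f p))] with q hq
  have e : ∀ v : TangentSpace 𝓘(ℝ, E) (f q), fiberCoord (f p) ⟨f q, v⟩ = _ :=
    fun v => fiberCoord_eq_mfderiv hq v
  refine (e _).trans (Eq.trans ?_
    (congrArg₂ (fun a b => a + c • b) (e (s q)) (e (t q))).symm)
  rw [map_add, map_smul]
  rfl

theorem SmoothTensor.add
    {K L : ∀ x : M, TangentSpace 𝓘(ℝ, E) x →L[ℝ] TangentSpace 𝓘(ℝ, E) x}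
    (hK : SmoothTensor K) (hL : SmoothTensor L) : SmoothTensor (fun x => K x + L x) := by
  intro p
  have h := contMDiffAt_add_const_smul (f := Bundle.TotalSpace.proj) (hK p) (hL p) 1
  simp only [one_smul] at h
  exact h

omit [IsManifold 𝓘(ℝ, E) ∞ M] in
theorem fnBracket_self (K : ∀ x : M, TangentSpace 𝓘(ℝ, E) x →L[ℝ] TangentSpace 𝓘(ℝ, E) x)
    (X Y : ∀ x : M, TangentSpace 𝓘(ℝ, E) x) (x : M) :
    fnBracket K K X Y x = (2 : ℝ) • torsion K X Y x := by
  simp only [fnBracket, torsion, map_add, smul_sub, smul_add, two_smul]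
  abel

variable {K : ∀ x : M, TangentSpace 𝓘(ℝ, E) x →L[ℝ] TangentSpace 𝓘(ℝ, E) x}
  {X X' Y Y' : ∀ x : M, TangentSpace 𝓘(ℝ, E) x} {x : M}

omit [IsManifold 𝓘(ℝ, E) ∞ M] in
theorem torsion_swap : torsion K X Y x = - torsion K Y X x := by
  have h1 := mlieBracket_swap_apply (I := 𝓘(ℝ, E)) (x := x) (V := fun y => K y (X y))
    (W := fun y => K y (Y y))
  have h2 := mlieBracket_swap_apply (I := 𝓘(ℝ, E)) (x := x) (V := X) (W := Y)
  have h3 := mlieBracket_swap_apply (I := 𝓘(ℝ, E)) (x := x) (V := fun y => K y (X y)) (W := Y)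
  have h4 := mlieBracket_swap_apply (I := 𝓘(ℝ, E)) (x := x) (V := X) (W := fun y => K y (Y y))
  rw [torsion, torsion, h1, h2, h3, h4]
  simp only [map_neg]
  abel

/-- The Lie derivative `(L_Y K) X = [Y, K X] - K [Y, X]` only depends on the value of `X` at the
point. -/
theorem lieDerivative_tensor_congr [CompleteSpace E]
    (hK : SmoothTensor K) (hX : SmoothFieldAt X x) (hX' : SmoothFieldAt X' x) (h : X x = X' x) :
    mlieBracket 𝓘(ℝ, E) Y (fun y => K y (X y)) x - K x (mlieBracket 𝓘(ℝ, E) Y X x)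
      = mlieBracket 𝓘(ℝ, E) Y (fun y => K y (X' y)) x - K x (mlieBracket 𝓘(ℝ, E) Y X' x) := by
  let Z : ∀ x : M, TangentSpace 𝓘(ℝ, E) x := fun y => X y + (-1 : ℝ) • X' y
  have hZ : SmoothFieldAt Z x := contMDiffAt_add_const_smul (f := id) hX hX' (-1)
  have hZx : Z x = 0 := by simp [Z, h]
  have e1 : X = X' + Z := by
    funext y
    simp [Z]
  have e2 : (fun y => K y (X y)) = (fun y => K y (X' y)) + fun y => K y (Z y) := by
    rw [e1]
    funext y
    exact map_add _ _ _
  have : IsManifold 𝓘(ℝ, E) (minSmoothness ℝ 2) M := .of_le (n := ∞) two_le_smooth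
  have b1 := mlieBracket_add_right (V := Y) ((hK.smoothFieldAt hX').mdifferentiableAt (by simp))
    ((hK.smoothFieldAt hZ).mdifferentiableAt (by simp))
  have b2 := mlieBracket_add_right (V := Y) (hX'.mdifferentiableAt (by simp))
    (hZ.mdifferentiableAt (by simp))
  have h0 := mlieBracket_tensor_of_eq_zero (Y := Y) hK hZ hZx
  rw [e2, b1, h0, e1, b2, map_add]
  abel

/-- The torsion is a tensor: it is `T_K(X, Y) = (L_{K X} K) Y - K (L_X K) Y`, and antisymmetric. -/
theorem torsion_congr_right [CompleteSpace E] (hK : SmoothTensor K) (hY : SmoothFieldAt Y x)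
    (hY' : SmoothFieldAt Y' x) (h : Y x = Y' x) : torsion K X Y x = torsion K X Y' x := by
  have e : ∀ Y : ∀ x : M, TangentSpace 𝓘(ℝ, E) x, torsion K X Y x
      = (mlieBracket 𝓘(ℝ, E) (fun y => K y (X y)) (fun y => K y (Y y)) x
          - K x (mlieBracket 𝓘(ℝ, E) (fun y => K y (X y)) Y x))
        - K x (mlieBracket 𝓘(ℝ, E) X (fun y => K y (Y y)) x
          - K x (mlieBracket 𝓘(ℝ, E) X Y x)) := by
    intro Y
    rw [torsion, map_sub]
    abel
  rw [e, e, lieDerivative_tensor_congr hK hY hY' h, lieDerivative_tensor_congr hK hY hY' h]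

theorem torsion_congr [CompleteSpace E] (hK : SmoothTensor K) (hX : SmoothFieldAt X x)
    (hX' : SmoothFieldAt X' x) (hY : SmoothFieldAt Y x) (hY' : SmoothFieldAt Y' x)
    (h : X x = X' x) (h' : Y x = Y' x) :
    torsion K X Y x = torsion K X' Y' x := by
  rw [torsion_congr_right hK hY hY' h', torsion_swap, torsion_congr_right hK hX hX' h,
    ← torsion_swap]

end Torsion

section Related

variable {E : Type*} [NormedAddCommGroup E] [NormedSpace ℝ E]
  {M : Type*} [TopologicalSpace M] [ChartedSpace E M] [IsManifold 𝓘(ℝ, E) ∞ M]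
  {F : Type*} [NormedAddCommGroup F] [NormedSpace ℝ F]
  {G : Type*} [TopologicalSpace G] [ChartedSpace F G] [IsManifold 𝓘(ℝ, F) ∞ G]
  {f : G → M} {T : ∀ g : G, TangentSpace 𝓘(ℝ, F) g →L[ℝ] TangentSpace 𝓘(ℝ, F) g}
  {N : ∀ x : M, TangentSpace 𝓘(ℝ, E) x →L[ℝ] TangentSpace 𝓘(ℝ, E) x} {g : G}
  {X Y : ∀ g : G, TangentSpace 𝓘(ℝ, F) g} {X₀ Y₀ : ∀ x : M, TangentSpace 𝓘(ℝ, E) x}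

theorem mfderiv_bracketN_of_related (hf : ContMDiffAt 𝓘(ℝ, F) 𝓘(ℝ, E) ∞ f g)
    (hT : SmoothTensor T) (hN : SmoothTensor N)
    (hTN : ∀ (g : G) (v : F),
      (mfderiv 𝓘(ℝ, F) 𝓘(ℝ, E) f g (T g v) : E) = N (f g) (mfderiv 𝓘(ℝ, F) 𝓘(ℝ, E) f g v))
    (hX : SmoothFieldAt X g) (hY : SmoothFieldAt Y g)
    (hX₀ : SmoothFieldAt X₀ (f g)) (hY₀ : SmoothFieldAt Y₀ (f g))
    (hXX : ∀ᶠ h in 𝓝 g, mfderiv 𝓘(ℝ, F) 𝓘(ℝ, E) f h (X h) = X₀ (f h))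
    (hYY : ∀ᶠ h in 𝓝 g, mfderiv 𝓘(ℝ, F) 𝓘(ℝ, E) f h (Y h) = Y₀ (f h)) :
    (mfderiv 𝓘(ℝ, F) 𝓘(ℝ, E) f g (bracketN T X Y g) : E) = bracketN N X₀ Y₀ (f g) := by
  have hTX : ∀ᶠ h in 𝓝 g, mfderiv 𝓘(ℝ, F) 𝓘(ℝ, E) f h (T h (X h)) = N (f h) (X₀ (f h)) :=
    hXX.mono fun h hh => (hTN h _).trans (congrArg (N (f h)) hh)
  have hTY : ∀ᶠ h in 𝓝 g, mfderiv 𝓘(ℝ, F) 𝓘(ℝ, E) f h (T h (Y h)) = N (f h) (Y₀ (f h)) :=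
    hYY.mono fun h hh => (hTN h _).trans (congrArg (N (f h)) hh)
  have e1 := mfderiv_mlieBracket_of_related hf hX hY hX₀ hY₀ hXX hYY
  have e2 := mfderiv_mlieBracket_of_related hf (hT.smoothFieldAt hX) hY (hN.smoothFieldAt hX₀) hY₀
    hTX hYY
  have e3 := mfderiv_mlieBracket_of_related hf hX (hT.smoothFieldAt hY) hX₀ (hN.smoothFieldAt hY₀)
    hXX hTY
  refine (map_sub (mfderiv 𝓘(ℝ, F) 𝓘(ℝ, E) f g) _ _).trans ?_
  refine congrArg₂ (fun a b : E => a - b)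
    ((map_add (mfderiv 𝓘(ℝ, F) 𝓘(ℝ, E) f g) _ _).trans (congrArg₂ (fun a b : E => a + b) e2 e3)) ?_
  exact (hTN g _).trans (congrArg (N (f g)) e1)

omit [IsManifold 𝓘(ℝ, E) ∞ M] in
theorem torsion_eq_sub_bracketN (x : M) : torsion N X₀ Y₀ x
    = mlieBracket 𝓘(ℝ, E) (fun y => N y (X₀ y)) (fun y => N y (Y₀ y)) x
      - N x (bracketN N X₀ Y₀ x) := by
  rw [torsion, bracketN, map_sub, map_add]
  abel

theorem mfderiv_torsion_of_related (hf : ContMDiffAt 𝓘(ℝ, F) 𝓘(ℝ, E) ∞ f g)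
    (hT : SmoothTensor T) (hN : SmoothTensor N)
    (hTN : ∀ (g : G) (v : F),
      (mfderiv 𝓘(ℝ, F) 𝓘(ℝ, E) f g (T g v) : E) = N (f g) (mfderiv 𝓘(ℝ, F) 𝓘(ℝ, E) f g v))
    (hX : SmoothFieldAt X g) (hY : SmoothFieldAt Y g)
    (hX₀ : SmoothFieldAt X₀ (f g)) (hY₀ : SmoothFieldAt Y₀ (f g))
    (hXX : ∀ᶠ h in 𝓝 g, mfderiv 𝓘(ℝ, F) 𝓘(ℝ, E) f h (X h) = X₀ (f h))
    (hYY : ∀ᶠ h in 𝓝 g, mfderiv 𝓘(ℝ, F) 𝓘(ℝ, E) f h (Y h) = Y₀ (f h)) :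
    (mfderiv 𝓘(ℝ, F) 𝓘(ℝ, E) f g (torsion T X Y g) : E) = torsion N X₀ Y₀ (f g) := by
  have hTX : ∀ᶠ h in 𝓝 g, mfderiv 𝓘(ℝ, F) 𝓘(ℝ, E) f h (T h (X h)) = N (f h) (X₀ (f h)) :=
    hXX.mono fun h hh => (hTN h _).trans (congrArg (N (f h)) hh)
  have hTY : ∀ᶠ h in 𝓝 g, mfderiv 𝓘(ℝ, F) 𝓘(ℝ, E) f h (T h (Y h)) = N (f h) (Y₀ (f h)) :=
    hYY.mono fun h hh => (hTN h _).trans (congrArg (N (f h)) hh)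
  have e1 := mfderiv_mlieBracket_of_related hf (hT.smoothFieldAt hX) (hT.smoothFieldAt hY)
    (hN.smoothFieldAt hX₀) (hN.smoothFieldAt hY₀) hTX hTY
  have e2 := mfderiv_bracketN_of_related hf hT hN hTN hX hY hX₀ hY₀ hXX hYY
  rw [torsion_eq_sub_bracketN, torsion_eq_sub_bracketN]
  refine (map_sub (mfderiv 𝓘(ℝ, F) 𝓘(ℝ, E) f g) _ _).trans ?_
  exact congrArg₂ (fun a b : E => a - b) e1 ((hTN g _).trans (congrArg (N (f g)) e2))

end Related

/-! ### The Nijenhuis operator of an integrating map -/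

namespace LieGroupoid

variable {E F : Type*} [NormedAddCommGroup E] [NormedSpace ℝ E]
  [NormedAddCommGroup F] [NormedSpace ℝ F]
  {M G : Type*} [TopologicalSpace M] [ChartedSpace E M]
  [TopologicalSpace G] [ChartedSpace F G]
  {Γ : LieGroupoid E F M G} {U : ∀ x : M, TangentSpace 𝓘(ℝ, E) x →L[ℝ] Γ.Alg x}

variable (U) in
/-- The composition of a vector bundle map `U : TM → A` with the anchor, a `(1,1)` tensor on `M`. -/
def anchorTensor (x : M) : TangentSpace 𝓘(ℝ, E) x →L[ℝ] TangentSpace 𝓘(ℝ, E) x :=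
  (Γ.anchor x).comp (U x)

variable [IsManifold 𝓘(ℝ, F) ∞ G]

theorem srcRelated_delta : Γ.SrcRelated (Γ.delta U) (anchorTensor U) := by
  intro g
  ext v
  refine (map_add (mfderiv 𝓘(ℝ, F) 𝓘(ℝ, E) Γ.src g) _ _).trans ?_
  exact (congrArg₂ (fun a b : E => a + b) (Γ.mfderiv_src_rightLift U g v)
    (Γ.mfderiv_src_leftLift U g v)).trans (zero_add _)

theorem tgtRelated_delta : Γ.TgtRelated (Γ.delta U) (anchorTensor U) := by
  intro g
  ext v
  refine (map_add (mfderiv 𝓘(ℝ, F) 𝓘(ℝ, E) Γ.tgt g) _ _).trans ?_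
  exact (congrArg₂ (fun a b : E => a + b) (Γ.mfderiv_tgt_rightLift U g v)
    (Γ.mfderiv_tgt_leftLift U g v)).trans (add_zero _)

variable [IsManifold 𝓘(ℝ, E) ∞ M]

theorem smoothTensor_anchorTensor (hU : Γ.IsBundleMap U) : SmoothTensor (anchorTensor U) := by
  intro p
  have h1 : ContMDiffAt 𝓘(ℝ, E).tangent 𝓘(ℝ, E).tangent ∞
      (fun p => tangentMap 𝓘(ℝ, F) 𝓘(ℝ, E) Γ.tgt (Γ.bundleMap U p)) p :=
    ContMDiffAt.comp p (g := tangentMap 𝓘(ℝ, F) 𝓘(ℝ, E) Γ.tgt)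
      (contMDiffAt_tangentMap (Γ.contMDiffAt_tgt _)) (hU p)
  refine h1.congr_of_eventuallyEq (Eventually.of_forall fun q => ?_)
  exact tangentBundle_mk_congr (Γ.tgt_unit q.1).symm _

/-- For vector fields related by `t`, the torsion of the right invariant lift of `U` measures the
failure of `U` to preserve brackets. -/
theorem torsion_rightLift (hU : Γ.IsBundleMap U) {X Y : ∀ g : G, TangentSpace 𝓘(ℝ, F) g}
    {X₀ Y₀ : ∀ x : M, TangentSpace 𝓘(ℝ, E) x} {g : G}
    (hX : SmoothFieldAt X g) (hY : SmoothFieldAt Y g)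
    (hX₀ : SmoothFieldAt X₀ (Γ.tgt g)) (hY₀ : SmoothFieldAt Y₀ (Γ.tgt g))
    (hXX : ∀ᶠ h in 𝓝 g, mfderiv 𝓘(ℝ, F) 𝓘(ℝ, E) Γ.tgt h (X h) = X₀ (Γ.tgt h))
    (hYY : ∀ᶠ h in 𝓝 g, mfderiv 𝓘(ℝ, F) 𝓘(ℝ, E) Γ.tgt h (Y h) = Y₀ (Γ.tgt h)) :
    (torsion (Γ.rightLift U) X Y g : F)
      = mlieBracket 𝓘(ℝ, F) (Γ.rightInvariant fun x => U x (X₀ x))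
          (Γ.rightInvariant fun x => U x (Y₀ x)) g
        - Γ.rightInvariant (fun x => U x (bracketN (anchorTensor U) X₀ Y₀ x)) g := by
  have hR : ∀ {Z : ∀ g : G, TangentSpace 𝓘(ℝ, F) g} {Z₀ : ∀ x : M, TangentSpace 𝓘(ℝ, E) x},
      (∀ᶠ h in 𝓝 g, mfderiv 𝓘(ℝ, F) 𝓘(ℝ, E) Γ.tgt h (Z h) = Z₀ (Γ.tgt h)) →
      (fun h => Γ.rightLift U h (Z h)) =ᶠ[𝓝 g] Γ.rightInvariant fun x => U x (Z₀ x) :=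
    fun hZ => hZ.mono fun h hh => congrArg (fun v => Γ.dR h (U (Γ.tgt h) v)) hh
  rw [torsion_eq_sub_bracketN, (hR hXX).mlieBracket_vectorField_eq (hR hYY)]
  refine congrArg₂ (fun a b : F => a - b) rfl ?_
  have h := mfderiv_bracketN_of_related (Γ.contMDiffAt_tgt g) (Γ.smoothTensor_rightLift hU)
    (smoothTensor_anchorTensor hU) (Γ.mfderiv_tgt_rightLift U) hX hY hX₀ hY₀ hXX hYY
  exact congrArg (fun v : E => (Γ.dR g (U (Γ.tgt g) v) : F)) h

section IntegratingMap

variable (hU : Γ.IsIntegratingMap U)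
include hU

theorem IsIntegratingMap.torsion_rightLift_eq_zero {X Y : ∀ g : G, TangentSpace 𝓘(ℝ, F) g} {g : G}
    (hX : SmoothFieldAt X g) (hY : SmoothFieldAt Y g) : torsion (Γ.rightLift U) X Y g = 0 := by
  have h := hU.fnBracket_eq_zero g X Y hX hY
  rw [fnBracket_self] at h
  exact (smul_eq_zero.1 h).resolve_left (by norm_num)

/-- The condition on the kernel and the image of the right invariant lift makes `U` bijective on the
fibre at `t(g)`, and every point is the target of its unit. -/
theorem IsIntegratingMap.bijective (x : M) : Function.Bijective (U x) := by
  have key : ∀ g : G, Function.Bijective (U (Γ.tgt g)) := by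
    intro g
    constructor
    · refine (injective_iff_map_eq_zero _).2 fun w hw => ?_
      obtain ⟨v, hv⟩ := mfderiv_surjective (Γ.submersionAt_tgt g) w
      have h1 : v ∈ Γ.kerTgt g := by
        rw [← hU.ker_eq g]
        have h2 : (Γ.rightLift U g v : F) = Γ.dR g (U (Γ.tgt g) w) :=
          congrArg (fun v : E => (Γ.dR g (U (Γ.tgt g) v) : F)) hv
        rw [hw] at h2
        exact h2.trans (map_zero (Γ.dR g))
      exact hv.symm.trans h1
    · intro a
      have h1 : (Γ.dR g a : F) ∈ Γ.kerSrc g := Γ.mfderiv_src_dR g a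
      rw [← hU.range_eq g] at h1
      obtain ⟨v, hv⟩ := h1
      exact ⟨_, Γ.dR_injective g hv⟩
  have h := key (Γ.unit x)
  rwa [Γ.tgt_unit] at h

/-- The right invariant extensions of `U` intertwine the brackets. -/
theorem IsIntegratingMap.mlieBracket_rightInvariant {X₀ Y₀ : ∀ x : M, TangentSpace 𝓘(ℝ, E) x}
    (g : G) (hX₀ : SmoothFieldAt X₀ (Γ.tgt g)) (hY₀ : SmoothFieldAt Y₀ (Γ.tgt g)) :
    (mlieBracket 𝓘(ℝ, F) (Γ.rightInvariant fun x => U x (X₀ x))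
        (Γ.rightInvariant fun x => U x (Y₀ x)) g : F)
      = Γ.rightInvariant (fun x => U x (bracketN (anchorTensor U) X₀ Y₀ x)) g := by
  obtain ⟨v, hv⟩ := mfderiv_surjective (Γ.submersionAt_tgt g) (X₀ (Γ.tgt g))
  obtain ⟨w, hw⟩ := mfderiv_surjective (Γ.submersionAt_tgt g) (Y₀ (Γ.tgt g))
  obtain ⟨X, hX, -, hXX⟩ := exists_lift (Γ.submersionAt_tgt g) hX₀ v hv
  obtain ⟨Y, hY, -, hYY⟩ := exists_lift (Γ.submersionAt_tgt g) hY₀ w hw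
  have h := torsion_rightLift hU.isBundleMap hX hY hX₀ hY₀ hXX hYY
  exact sub_eq_zero.1 (h.symm.trans (hU.torsion_rightLift_eq_zero hX hY))

theorem IsIntegratingMap.isNijenhuis : IsNijenhuis (anchorTensor U) where
  smooth := smoothTensor_anchorTensor hU.isBundleMap
  torsion_eq_zero := by
    have key : ∀ (g : G) (X₀ Y₀ : ∀ x : M, TangentSpace 𝓘(ℝ, E) x), SmoothFieldAt X₀ (Γ.tgt g) →
        SmoothFieldAt Y₀ (Γ.tgt g) → torsion (anchorTensor U) X₀ Y₀ (Γ.tgt g) = 0 := by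
      intro g X₀ Y₀ hX₀ hY₀
      obtain ⟨v, hv⟩ := mfderiv_surjective (Γ.submersionAt_tgt g) (X₀ (Γ.tgt g))
      obtain ⟨w, hw⟩ := mfderiv_surjective (Γ.submersionAt_tgt g) (Y₀ (Γ.tgt g))
      obtain ⟨X, hX, -, hXX⟩ := exists_lift (Γ.submersionAt_tgt g) hX₀ v hv
      obtain ⟨Y, hY, -, hYY⟩ := exists_lift (Γ.submersionAt_tgt g) hY₀ w hw
      have h := mfderiv_torsion_of_related (Γ.contMDiffAt_tgt g)
        (Γ.smoothTensor_rightLift hU.isBundleMap) (smoothTensor_anchorTensor hU.isBundleMap)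
        (Γ.mfderiv_tgt_rightLift U) hX hY hX₀ hY₀ hXX hYY
      rw [hU.torsion_rightLift_eq_zero hX hY] at h
      exact h.symm.trans (map_zero _)
    intro x X₀ Y₀ hX₀ hY₀
    have h := key (Γ.unit x) X₀ Y₀
    rw [Γ.tgt_unit] at h
    exact h hX₀ hY₀

theorem IsIntegratingMap.map_bracket {X₀ Y₀ : ∀ x : M, TangentSpace 𝓘(ℝ, E) x} (x : M)
    (hX₀ : SmoothFieldAt X₀ x) (hY₀ : SmoothFieldAt Y₀ x) :
    (U x (bracketN (anchorTensor U) X₀ Y₀ x) : TangentSpace 𝓘(ℝ, F) (Γ.unit x))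
      = Γ.bracket (fun y => U y (X₀ y)) (fun y => U y (Y₀ y)) x := by
  have h := hU.mlieBracket_rightInvariant (X₀ := X₀) (Y₀ := Y₀) (Γ.unit x)
    (by rwa [Γ.tgt_unit]) (by rwa [Γ.tgt_unit])
  refine Eq.symm (h.trans ((Γ.dR_unit x _).trans ?_))
  exact Γ.section_congr (fun x => U x (bracketN (anchorTensor U) X₀ Y₀ x)) (Γ.tgt_unit x)

end IntegratingMap

/-- A section of `TM` is smooth if its image under an injective vector bundle map is smooth. The
coordinates of the section are obtained from those of its image by a smooth left inverse of the
matrix of the bundle map. -/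
theorem smoothFieldAt_of_comp [FiniteDimensional ℝ E] [FiniteDimensional ℝ F]
    (hU : Γ.IsBundleMap U) {X : ∀ x : M, TangentSpace 𝓘(ℝ, E) x} {x₀ : M}
    (hinj : Function.Injective (U x₀))
    (hX : ContMDiffAt 𝓘(ℝ, E) 𝓘(ℝ, F).tangent ∞
      (fun x => (⟨Γ.unit x, (U x (X x)).1⟩ : TangentBundle 𝓘(ℝ, F) G)) x₀) :
    SmoothFieldAt X x₀ := by
  have : CompleteSpace E := FiniteDimensional.complete ℝ E
  let A : E →L[ℝ] F := (Γ.Alg x₀).subtypeL.comp (U x₀)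
  have hA : Function.Injective A := fun v w h => hinj (Subtype.ext h)
  obtain ⟨P, hP⟩ := A.toLinearMap.exists_leftInverse_of_injective (LinearMap.ker_eq_bot.2 hA)
  let P' : F →L[ℝ] E := P.toContinuousLinearMap
  have hP' : ∀ v, P' (A v) = v := fun v => LinearMap.congr_fun hP v
  let b := Module.finBasis ℝ E
  -- the coefficients of the bundle map followed by a left inverse of its value at `x₀`
  let q : Fin (Module.finrank ℝ E) → M → E := fun i y =>
    P' (fiberCoord (Γ.unit x₀) (Γ.bundleMap U ⟨y, constField x₀ (b i) y⟩))
  let Q : M → E →L[ℝ] E := fun y =>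
    ∑ i, (LinearMap.toContinuousLinearMap (b.coord i)).smulRight (q i y)
  have hcoord : ∀ {s : M → TangentBundle 𝓘(ℝ, F) G}, (s x₀).1 = Γ.unit x₀ →
      ContMDiffAt 𝓘(ℝ, E) 𝓘(ℝ, F).tangent ∞ s x₀ →
      ContMDiffAt 𝓘(ℝ, E) 𝓘(ℝ, E) ∞ (fun y => P' (fiberCoord (Γ.unit x₀) (s y))) x₀ := by
    intro s hs0 hs
    have h := (Bundle.contMDiffAt_totalSpace.1 hs).2
    rw [hs0] at h
    exact ContMDiffAt.comp x₀ (g := P') P'.contDiff.contMDiff.contMDiffAt h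
  have hq : ∀ i, ContMDiffAt 𝓘(ℝ, E) 𝓘(ℝ, E) ∞ (q i) x₀ := fun i =>
    hcoord rfl (ContMDiffAt.comp x₀ (g := Γ.bundleMap U) (hU _)
      (smoothFieldAt_constField x₀ (b i)))
  have hQ : ContMDiffAt 𝓘(ℝ, E) 𝓘(ℝ, E →L[ℝ] E) ∞ Q x₀ := by
    refine contMDiffAt_finsetSum fun i _ => ?_
    exact ContMDiffAt.comp x₀
      (g := fun v : E => (LinearMap.toContinuousLinearMap (b.coord i)).smulRight v)
      ((ContinuousLinearMap.smulRightL ℝ E E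
        (LinearMap.toContinuousLinearMap (b.coord i))).contDiff.contMDiff.contMDiffAt) (hq i)
  have hQ0 : Q x₀ = ContinuousLinearMap.id ℝ E := by
    ext v
    have hq0 : ∀ i, q i x₀ = b i := fun i => by
      have h1 : (constField x₀ (b i) x₀ : E) = b i := constField_self x₀ (b i)
      refine Eq.trans (congrArg P' (fiberCoord_self (E := F) (Γ.unit x₀) _)) ?_
      exact (congrArg (fun v : E => P' (A v)) h1).trans (hP' _)
    simp only [Q, hq0, _root_.sum_apply, ContinuousLinearMap.smulRight_apply]
    exact b.sum_repr v
  have hQξ : ∀ᶠ y in 𝓝 x₀, Q y (fiberCoord x₀ ⟨y, X y⟩)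
      = P' (fiberCoord (Γ.unit x₀) ⟨Γ.unit y, (U y (X y)).1⟩) := by
    filter_upwards [chart_source_mem_nhds E x₀,
      Γ.smooth_unit.continuous.continuousAt.eventually
        (chart_source_mem_nhds F (Γ.unit x₀))] with y hy hy'
    let ξ : E := fiberCoord x₀ ⟨y, X y⟩
    -- the composition of `P'` with the coordinate expression of `U` at `y`, as a linear map
    let D : TangentSpace 𝓘(ℝ, E) y →L[ℝ] E := (P'.comp (show F →L[ℝ] F from
      mfderiv 𝓘(ℝ, F) 𝓘(ℝ, F) (extChartAt 𝓘(ℝ, F) (Γ.unit x₀)) (Γ.unit y))).comp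
        ((Γ.Alg y).subtypeL.comp (U y))
    have hD : ∀ v : TangentSpace 𝓘(ℝ, E) y,
        P' (fiberCoord (Γ.unit x₀) ⟨Γ.unit y, (U y v).1⟩) = D v := fun v =>
      congrArg P' (fiberCoord_eq_mfderiv hy' _)
    have hXy : X y = ∑ i, b.repr ξ i • constField x₀ (b i) y := by
      let e := trivializationAt E (TangentSpace 𝓘(ℝ, E) : M → Type _) x₀
      have h1 : ∀ v : E, constField x₀ v y = e.symmₗ ℝ y v := by
        intro v
        rw [Bundle.Trivialization.symmₗ_apply _ hy]
        exact congrArg (e.symm y) (fiberCoord_self x₀ v)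
      have h2 : e.symmₗ ℝ y ξ = X y := by
        rw [Bundle.Trivialization.symmₗ_apply _ hy]
        exact e.symm_apply_apply_mk hy (X y)
      simp only [h1]
      rw [← h2]
      conv_lhs => rw [← b.sum_repr ξ]
      rw [map_sum]
      simp only [map_smul]
    refine Eq.trans ?_ ((hD (X y)).trans ((congrArg D hXy).trans (map_sum D _ _))).symm
    refine (_root_.sum_apply _ _ _).trans (Finset.sum_congr rfl fun i _ => ?_)
    rw [map_smul]
    exact congrArg (fun v : E => b.repr ξ i • v) (hD _)
  have hinv : ContMDiffAt 𝓘(ℝ, E) 𝓘(ℝ, E →L[ℝ] E) ∞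
      (fun y => ContinuousLinearMap.inverse (Q y)) x₀ := by
    refine ContMDiffAt.comp x₀ (g := ContinuousLinearMap.inverse) ?_ hQ
    rw [hQ0]
    exact (contDiffAt_map_inverse (ContinuousLinearEquiv.refl ℝ E)).contMDiffAt
  have hξ : ContMDiffAt 𝓘(ℝ, E) 𝓘(ℝ, E) ∞ (fun y => fiberCoord x₀ ⟨y, X y⟩) x₀ := by
    refine (hinv.clm_apply (hcoord rfl hX)).congr_of_eventuallyEq ?_
    have h1 : ∀ᶠ y in 𝓝 x₀, Q y ∈ Set.range ((↑) : (E ≃L[ℝ] E) → E →L[ℝ] E) := by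
      refine hQ.continuousAt.eventually ?_
      rw [hQ0]
      exact (ContinuousLinearEquiv.refl ℝ E).nhds
    filter_upwards [h1, hQξ] with y ⟨e, he⟩ hy
    rw [← hy, ← he, ContinuousLinearMap.inverse_equiv]
    exact (e.symm_apply_apply _).symm
  exact Bundle.contMDiffAt_totalSpace.2 ⟨contMDiffAt_id, hξ⟩

end LieGroupoid

/-! ### Integrating maps are the Lie algebroid isomorphisms -/

namespace LieGroupoid

variable {E F : Type*} [NormedAddCommGroup E] [NormedSpace ℝ E]
  [NormedAddCommGroup F] [NormedSpace ℝ F]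
  {M G : Type*} [TopologicalSpace M] [ChartedSpace E M]
  [TopologicalSpace G] [ChartedSpace F G] [IsManifold 𝓘(ℝ, F) ∞ G]
  {Γ : LieGroupoid E F M G} {U : ∀ x : M, TangentSpace 𝓘(ℝ, E) x →L[ℝ] Γ.Alg x}

section Equivalence

variable [IsManifold 𝓘(ℝ, E) ∞ M] [FiniteDimensional ℝ E] [FiniteDimensional ℝ F]

theorem IsIntegratingMap.isLieAlgebroidIso (hU : Γ.IsIntegratingMap U) :
    Γ.IsLieAlgebroidIso (anchorTensor U) U where
  isBundleMap := hU.isBundleMap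
  bijective := hU.bijective
  smooth_inverse _ hX x := smoothFieldAt_of_comp hU.isBundleMap (hU.bijective x).1 (hX x)
  map_anchor _ _ := rfl
  map_bracket _ _ hX hY x := hU.map_bracket x (hX x) (hY x)

/-- A Lie algebroid isomorphism from `(TM)_N` has the defining properties of an integrating map. The
torsion of its right invariant lift is a tensor, so it is enough to evaluate it on vector fields
related by `t` to vector fields on `M`. -/
theorem IsLieAlgebroidIso.isIntegratingMap [T2Space M]
    {N : ∀ x : M, TangentSpace 𝓘(ℝ, E) x →L[ℝ] TangentSpace 𝓘(ℝ, E) x}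
    (hU : Γ.IsLieAlgebroidIso N U) : Γ.IsIntegratingMap U where
  isBundleMap := hU.isBundleMap
  ker_eq g := by
    ext v
    have h0 : (mfderiv 𝓘(ℝ, F) 𝓘(ℝ, E) Γ.tgt g v : E) = 0 ↔ (Γ.rightLift U g v : F) = 0 := by
      refine Iff.symm ((map_eq_zero_iff (Γ.dR g) (Γ.dR_injective g)).trans ?_)
      exact map_eq_zero_iff (U (Γ.tgt g)) (hU.bijective _).1
    exact h0.symm
  range_eq g := by
    ext v
    constructor
    · rintro ⟨w, rfl⟩
      exact Γ.mfderiv_src_rightLift U g w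
    · intro hv
      obtain ⟨a, ha⟩ := Γ.exists_dR_eq hv
      obtain ⟨w, hw⟩ := (hU.bijective (Γ.tgt g)).2 a
      obtain ⟨u, hu⟩ := mfderiv_surjective (Γ.submersionAt_tgt g) w
      refine ⟨u, Eq.trans ?_ ha⟩
      rw [← hw]
      exact congrArg (fun w : E => (Γ.dR g (U (Γ.tgt g) w) : F)) hu
  fnBracket_eq_zero := by
    have : CompleteSpace F := FiniteDimensional.complete ℝ F
    have hN : anchorTensor U = N := by
      funext x
      ext v
      exact hU.map_anchor x v
    intro g X Y hX hY
    obtain ⟨X₀, hX₀, hXg⟩ := exists_smoothField (mfderiv 𝓘(ℝ, F) 𝓘(ℝ, E) Γ.tgt g (X g))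
    obtain ⟨Y₀, hY₀, hYg⟩ := exists_smoothField (mfderiv 𝓘(ℝ, F) 𝓘(ℝ, E) Γ.tgt g (Y g))
    obtain ⟨X', hX', hX'g, hXX⟩ := exists_lift (Γ.submersionAt_tgt g) (hX₀ _) (X g) hXg.symm
    obtain ⟨Y', hY', hY'g, hYY⟩ := exists_lift (Γ.submersionAt_tgt g) (hY₀ _) (Y g) hYg.symm
    have hR := Γ.smoothTensor_rightLift hU.isBundleMap
    rw [fnBracket_self, torsion_congr hR hX hX' hY hY' hX'g.symm hY'g.symm]
    refine smul_eq_zero_of_right _ ?_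
    refine (torsion_rightLift hU.isBundleMap hX' hY' (hX₀ _) (hY₀ _) hXX hYY).trans ?_
    refine sub_eq_zero.2 ?_
    have hs : ∀ {Z : ∀ x : M, TangentSpace 𝓘(ℝ, E) x}, SmoothField Z →
        ContMDiff 𝓘(ℝ, E) 𝓘(ℝ, F).tangent ∞
          (fun x => (⟨Γ.unit x, (U x (Z x)).1⟩ : TangentBundle 𝓘(ℝ, F) G)) :=
      fun hZ => hU.isBundleMap.comp hZ
    rw [hN]
    exact Γ.mlieBracket_rightInvariant (a := fun x => U x (X₀ x)) (b := fun x => U x (Y₀ x))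
      (hs hX₀ _) (hs hY₀ _) (U (Γ.tgt g) (bracketN N X₀ Y₀ (Γ.tgt g)))
      (hU.map_bracket X₀ Y₀ hX₀ hY₀ (Γ.tgt g))

end Equivalence

/-! ### The tensor `δU` at the units -/

section Units

theorem exists_curve_unit {x : M} (a : Γ.Alg x) :
    ∃ c : ℝ → G, c 0 = Γ.unit x ∧ ContMDiffAt 𝓘(ℝ, ℝ) 𝓘(ℝ, F) ∞ c 0 ∧ (∀ r, Γ.src (c r) = x) ∧
      (mfderiv 𝓘(ℝ, ℝ) 𝓘(ℝ, F) c 0 (1 : ℝ) : F) = a.1 := by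
  obtain ⟨c, hc0, hc, hs, ha⟩ := exists_curve_of_mfderiv_eq_zero
    (Γ.submersionAt_src (Γ.unit x)) (a := a.1) a.2
  rw [Γ.src_unit] at hs
  exact ⟨c, hc0, hc, hs, ha⟩

/-- `a + di(a) = d1(dt(a))`, from differentiating `c(r) c(r)⁻¹ = 1_{t(c(r))}`. -/
theorem add_mfderiv_inv {x : M} (a : Γ.Alg x) :
    (a.1 + Γ.dInv x a : F) = mfderiv 𝓘(ℝ, E) 𝓘(ℝ, F) Γ.unit x (Γ.anchor x a) := by
  obtain ⟨c, hc0, hc, hs, ha⟩ := exists_curve_unit a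
  have hf := Γ.contMDiffAt_mul_inv_curves hc hc hs hs
  have hfd := hf.mdifferentiableAt (by simp : (∞ : ℕ∞ω) ≠ 0)
  have hcd := hc.mdifferentiableAt (by simp : (∞ : ℕ∞ω) ≠ 0)
  have e1 := mfderiv_left (p := 0) (q := 0) hfd
  have e2 := mfderiv_right (p := 0) (q := 0) hfd
  have f1 : (fun r => Γ.mul (c r) (Γ.inv (c 0))) = c := by
    funext r
    have h : Γ.inv (c 0) = Γ.unit (Γ.src (c r)) := by rw [hc0, hs, Γ.inv_unit]
    exact (congrArg (Γ.mul (c r)) h).trans (Γ.mul_unit _)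
  have f2 : (fun r => Γ.mul (c 0) (Γ.inv (c r))) = fun r => Γ.inv (c r) := by
    funext r
    have := Γ.unit_mul (Γ.inv (c r))
    rwa [Γ.tgt_inv, hs r, ← hc0] at this
  have e3 := mfderiv_mfderiv (f := Γ.inv) (r := c) (h := fun r => Γ.inv (c r)) hc0
    (Γ.mdifferentiableAt_inv _) hcd (Eventually.of_forall fun _ => rfl) (1 : ℝ)
  have e4 := mfderiv_mfderiv (f := Γ.tgt) (r := c) (h := fun r => Γ.tgt (c r)) hc0
    (Γ.mdifferentiableAt_tgt _) hcd (Eventually.of_forall fun _ => rfl) (1 : ℝ)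
  have htc : MDifferentiableAt 𝓘(ℝ, ℝ) 𝓘(ℝ, E) (fun r => Γ.tgt (c r)) 0 :=
    MDifferentiableAt.comp (0 : ℝ) (Γ.mdifferentiableAt_tgt _) hcd
  have e5 := mfderiv_mfderiv (f := Γ.unit) (r := fun r => Γ.tgt (c r))
    (h := fun r => Γ.mul (c r) (Γ.inv (c r))) (y := x) (by rw [hc0, Γ.tgt_unit])
    (Γ.mdifferentiableAt_unit x) htc (Eventually.of_forall fun r => (Γ.mul_inv _).symm) (1 : ℝ)
  have hδ : HasFDerivAt (fun r : ℝ => (r, r))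
      ((ContinuousLinearMap.id ℝ ℝ).prod (ContinuousLinearMap.id ℝ ℝ)) 0 :=
    (hasFDerivAt_id _).prodMk (hasFDerivAt_id _)
  have e6 := mfderiv_mfderiv (f := fun r : ℝ × ℝ => Γ.mul (c r.1) (Γ.inv (c r.2)))
    (r := fun r : ℝ => (r, r)) (h := fun r => Γ.mul (c r) (Γ.inv (c r))) (x := 0) rfl hfd
    hδ.differentiableAt.mdifferentiableAt (Eventually.of_forall fun _ => rfl) (1 : ℝ)
  rw [mfderiv_eq_fderiv, hδ.fderiv] at e6
  rw [ha] at e3 e4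
  rw [← e4] at e5
  let D : ℝ × ℝ →L[ℝ] F := mfderiv 𝓘(ℝ, ℝ × ℝ) 𝓘(ℝ, F)
    (fun r : ℝ × ℝ => Γ.mul (c r.1) (Γ.inv (c r.2))) (0, 0)
  have e7 : D (1, 0) + D (0, 1) = D (1, 1) := by rw [← map_add]; simp
  have e8 : D (1, 0) = a.1 := by
    refine e1.trans (Eq.trans ?_ ha)
    exact congrArg (fun f : ℝ → G => (mfderiv 𝓘(ℝ, ℝ) 𝓘(ℝ, F) f 0 (1 : ℝ) : F)) f1
  have e9 : D (0, 1) = mfderiv 𝓘(ℝ, F) 𝓘(ℝ, F) Γ.inv (Γ.unit x) a.1 := by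
    refine e2.trans (Eq.trans ?_ e3.symm)
    exact congrArg (fun f : ℝ → G => (mfderiv 𝓘(ℝ, ℝ) 𝓘(ℝ, F) f 0 (1 : ℝ) : F)) f2
  rw [e8, e9] at e7
  exact e7.trans (e6.trans e5.symm)

theorem rightLift_unit (x : M) (v : F) :
    (Γ.rightLift U (Γ.unit x) v : F)
      = (U x (mfderiv 𝓘(ℝ, F) 𝓘(ℝ, E) Γ.tgt (Γ.unit x) v)).1 :=
  (Γ.dR_unit x _).trans (Γ.bundleMap_congr U (Γ.tgt_unit x) rfl)

theorem leftLift_unit (x : M) (v : F) :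
    (Γ.leftLift U (Γ.unit x) v : F) = mfderiv 𝓘(ℝ, F) 𝓘(ℝ, F) Γ.inv (Γ.unit x)
      (U x (mfderiv 𝓘(ℝ, F) 𝓘(ℝ, E) Γ.src (Γ.unit x) v)).1 := by
  have h1 : ∀ h, h = Γ.unit x → ∀ u : F, (mfderiv 𝓘(ℝ, F) 𝓘(ℝ, F) Γ.inv h (Γ.rightLift U h u) : F)
      = mfderiv 𝓘(ℝ, F) 𝓘(ℝ, F) Γ.inv (Γ.unit x) (Γ.rightLift U (Γ.unit x) u) := by
    rintro h rfl u; rfl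
  have h2 := mfderiv_mfderiv (f := Γ.tgt) (r := Γ.inv) (h := Γ.src) (Γ.inv_unit x)
    (Γ.mdifferentiableAt_tgt _) (Γ.mdifferentiableAt_inv _) (Eventually.of_forall Γ.tgt_inv) v
  refine (Γ.leftLift_eq U _ v).trans ((h1 _ (Γ.inv_unit x) _).trans ?_)
  refine congrArg (mfderiv 𝓘(ℝ, F) 𝓘(ℝ, F) Γ.inv (Γ.unit x)) ((rightLift_unit x _).trans ?_)
  exact Γ.bundleMap_congr U rfl h2

/-- `δU` restricts to the tensor `ρ ∘ U` on the tangent spaces of the manifold of units. -/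
theorem delta_mfderiv_unit (x : M) (w : E) :
    (Γ.delta U (Γ.unit x) (mfderiv 𝓘(ℝ, E) 𝓘(ℝ, F) Γ.unit x w : F) : F)
      = mfderiv 𝓘(ℝ, E) 𝓘(ℝ, F) Γ.unit x (anchorTensor U x w) := by
  refine Eq.trans ?_ (add_mfderiv_inv (U x w))
  refine congrArg₂ (fun a b : F => a + b) ((rightLift_unit (U := U) x _).trans ?_)
    ((leftLift_unit (U := U) x _).trans ?_)
  · exact Γ.bundleMap_congr U rfl (Γ.mfderiv_tgt_unit x w)
  · exact congrArg (mfderiv 𝓘(ℝ, F) 𝓘(ℝ, F) Γ.inv (Γ.unit x))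
      (Γ.bundleMap_congr U rfl (Γ.mfderiv_src_unit x w))

/-- `δU` restricts to an endomorphism of `A`, which corresponds to `ρ ∘ U` under `U`. -/
theorem delta_apply_alg (x : M) (v : E) :
    (Γ.delta U (Γ.unit x) (U x v).1 : F) = (U x (anchorTensor U x v)).1 := by
  refine (congrArg₂ (fun a b : F => a + b) (rightLift_unit (U := U) x _)
    ((leftLift_unit (U := U) x _).trans ?_)).trans
    (add_zero _)
  have h : (mfderiv 𝓘(ℝ, F) 𝓘(ℝ, E) Γ.src (Γ.unit x) (U x v).1 : E) = 0 := (U x v).2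
  refine (congrArg (mfderiv 𝓘(ℝ, F) 𝓘(ℝ, F) Γ.inv (Γ.unit x)) (Γ.bundleMap_congr U rfl h)).trans ?_
  have h' : ((U x 0).1 : F) = 0 := congrArg Subtype.val (map_zero (U x))
  exact (congrArg (mfderiv 𝓘(ℝ, F) 𝓘(ℝ, F) Γ.inv (Γ.unit x)) h').trans (map_zero _)

end Units

end LieGroupoid

/-! ### The tangent lift -/

section TangentLift

variable {E : Type*} [NormedAddCommGroup E] [NormedSpace ℝ E]
  {M : Type*} [TopologicalSpace M] [ChartedSpace E M] [IsManifold 𝓘(ℝ, E) ∞ M]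

theorem mlieBracket_eq_fderiv (V W : ∀ x : M, TangentSpace 𝓘(ℝ, E) x) (x : M) :
    (mlieBracket 𝓘(ℝ, E) V W x : E)
      = fderiv ℝ (fieldCoord x W) (extChartAt 𝓘(ℝ, E) x x) (V x)
        - fderiv ℝ (fieldCoord x V) (extChartAt 𝓘(ℝ, E) x x) (W x) := by
  refine (mlieBracket_eq_lieBracket_fieldCoord V W x).trans ?_
  rw [lieBracket, fieldCoord_self, fieldCoord_self]

theorem fderiv_fieldCoord_constField (x : M) (v : E) :
    fderiv ℝ (fieldCoord x (constField x v)) (extChartAt 𝓘(ℝ, E) x x) = 0 := by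
  rw [(fieldCoord_constField x v).fderiv_eq, fderiv_fun_const]
  rfl

/-- The tangent lift of a `(1,1)` tensor in the coordinates of the preferred charts. -/
theorem tangentLift_mk {K : M → E →L[ℝ] E} (hK : SmoothTensor (E := E) (M := M) K)
    (x : M) (v w z : E) :
    tangentLift K ⟨⟨x, v⟩, ((w, z) : E × E)⟩
      = ⟨⟨x, v⟩, ((K x w, fderiv ℝ (fieldCoord x fun y => K y (constField x w y))
          (extChartAt 𝓘(ℝ, E) x x) v + K x z) : E × E)⟩ := by
  have e := (mfderiv_fiberwiseMap (f := id) (A := K) (x := x) (v := w) (hK _) v z).trans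
    (congrArg (fun T : E →L[ℝ] E => (T v, fderiv ℝ (fieldCoord x fun y => K y (constField x w y))
      (extChartAt 𝓘(ℝ, E) x x) v + K x z)) (mfderiv_id (I := 𝓘(ℝ, E)) (x := x)))
  exact congrArg (fun p : E × E => (⟨⟨x, p.1⟩, ((K x w, p.2) : E × E)⟩ :
    TangentBundle 𝓘(ℝ, E).tangent (TangentBundle 𝓘(ℝ, E) M))) e

end TangentLift

namespace LieGroupoid

variable {E F : Type*} [NormedAddCommGroup E] [NormedSpace ℝ E]
  [NormedAddCommGroup F] [NormedSpace ℝ F]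
  {M G : Type*} [TopologicalSpace M] [ChartedSpace E M] [IsManifold 𝓘(ℝ, E) ∞ M]
  [TopologicalSpace G] [ChartedSpace F G] [IsManifold 𝓘(ℝ, F) ∞ G]
  {Γ : LieGroupoid E F M G} {U : ∀ x : M, TangentSpace 𝓘(ℝ, E) x →L[ℝ] Γ.Alg x}

theorem smoothFieldAt_rightInvariant_comp (hU : Γ.IsBundleMap U)
    {Y₀ : ∀ x : M, TangentSpace 𝓘(ℝ, E) x} {g : G} (hY₀ : SmoothFieldAt Y₀ (Γ.tgt g)) :
    SmoothFieldAt (Γ.rightInvariant fun x => U x (Y₀ x)) g :=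
  Γ.smoothFieldAt_rightInvariant (ContMDiffAt.comp (Γ.tgt g) (g := Γ.bundleMap U) (hU _) hY₀)

/-- At the units, the right invariant vector fields commute with the left invariant lift of vector
fields that are `s`-related to a vector field on `M`: the flows of the two fields are a left and a
right translation. -/
theorem mlieBracket_rightInvariant_leftLift (hU : Γ.IsBundleMap U) {x : M}
    {X : ∀ g : G, TangentSpace 𝓘(ℝ, F) g} {X₀ Y₀ : ∀ x : M, TangentSpace 𝓘(ℝ, E) x}
    (hX : SmoothFieldAt X (Γ.unit x)) (hY₀ : SmoothFieldAt Y₀ x)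
    (hXX : ∀ᶠ h in 𝓝 (Γ.unit x), mfderiv 𝓘(ℝ, F) 𝓘(ℝ, E) Γ.src h (X h) = X₀ (Γ.src h)) :
    mlieBracket 𝓘(ℝ, F) (Γ.rightInvariant fun x => U x (Y₀ x)) (fun h => Γ.leftLift U h (X h))
      (Γ.unit x) = 0 := by
  obtain ⟨c, hc0, hc, hcs, hca⟩ := exists_curve_unit (U x (Y₀ x))
  obtain ⟨d, hd0, hd, hds, hda⟩ := exists_curve_unit (U x (X₀ x))
  have hf := Γ.contMDiffAt_mul_inv_curves hc hd hcs hds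
  have hfd := eventually_mdifferentiableAt hf
  have hfq : ∀ᶠ q in 𝓝 (0 : ℝ), MDifferentiableAt 𝓘(ℝ, ℝ × ℝ) 𝓘(ℝ, F)
      (fun r : ℝ × ℝ => Γ.mul (c r.1) (Γ.inv (d r.2))) (0, q) :=
    ((Continuous.prodMk_right (0 : ℝ)).tendsto (0 : ℝ)).eventually hfd
  have hfp : ∀ᶠ p in 𝓝 (0 : ℝ), MDifferentiableAt 𝓘(ℝ, ℝ × ℝ) 𝓘(ℝ, F)
      (fun r : ℝ × ℝ => Γ.mul (c r.1) (Γ.inv (d r.2))) (p, 0) :=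
    ((Continuous.prodMk_left (0 : ℝ)).tendsto (0 : ℝ)).eventually hfd
  have f1 : ∀ q, Γ.mul (c 0) (Γ.inv (d q)) = Γ.inv (d q) := fun q => by
    have := Γ.unit_mul (Γ.inv (d q))
    rwa [Γ.tgt_inv, hds q, ← hc0] at this
  have f2 : ∀ p, Γ.mul (c p) (Γ.inv (d 0)) = c p := fun p => by
    have h : Γ.inv (d 0) = Γ.unit (Γ.src (c p)) := by rw [hd0, hcs, Γ.inv_unit]
    exact (congrArg (Γ.mul (c p)) h).trans (Γ.mul_unit _)
  have hdi : ContMDiffAt 𝓘(ℝ, ℝ) 𝓘(ℝ, F) ∞ (fun r => Γ.inv (d r)) 0 :=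
    ContMDiffAt.comp (0 : ℝ) (g := Γ.inv) Γ.smooth_inv.contMDiffAt hd
  have hdi1 := mfderiv_mfderiv (f := Γ.inv) (r := d) (h := fun r => Γ.inv (d r)) hd0
    (Γ.mdifferentiableAt_inv _) (hd.mdifferentiableAt (by simp))
    (Eventually.of_forall fun _ => rfl) (1 : ℝ)
  rw [hda] at hdi1
  refine mlieBracket_eq_zero_of_square (f := fun r : ℝ × ℝ => Γ.mul (c r.1) (Γ.inv (d r.2)))
    ((f2 0).trans hc0) hf
    (smoothFieldAt_rightInvariant_comp hU (by rwa [Γ.tgt_unit]))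
    ((Γ.smoothTensor_leftLift hU).smoothFieldAt hX) ?_ ?_
  · filter_upwards [hfq] with q hq
    have ht : Γ.tgt (Γ.mul (c 0) (Γ.inv (d q))) = x := by rw [f1, Γ.tgt_inv, hds]
    have h1 := Γ.dR_eq_of_curve (g := Γ.mul (c 0) (Γ.inv (d q)))
      (a := U _ (Y₀ _)) (c := c) (by rw [ht, hc0]) (fun r => (hcs r).trans ht.symm) hc
      (hca.trans (Γ.section_congr (fun x => U x (Y₀ x)) ht.symm))
    refine (mfderiv_left hq).trans (Eq.trans ?_ h1.symm)
    exact congrArg (fun k => (mfderiv 𝓘(ℝ, ℝ) 𝓘(ℝ, F) (fun r => Γ.mul (c r) k) 0 (1 : ℝ) : F))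
      (f1 q).symm
  · have hcc : ∀ᶠ p in 𝓝 (0 : ℝ),
        mfderiv 𝓘(ℝ, F) 𝓘(ℝ, E) Γ.src (c p) (X (c p)) = X₀ (Γ.src (c p)) := by
      have := hc.continuousAt.tendsto
      rw [hc0] at this
      exact this.eventually hXX
    filter_upwards [hfp, hcc] with p hp hcp
    have hL : ∀ g, g = c p → (Γ.leftLift U g (X g) : F) = Γ.leftLift U (c p) (X (c p)) := by
      rintro g rfl; rfl
    have h0 : ((U (Γ.src (c p)) (mfderiv 𝓘(ℝ, F) 𝓘(ℝ, E) Γ.src (c p) (X (c p)))).1 : F)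
        = (U x (X₀ x)).1 :=
      (Γ.bundleMap_congr U rfl hcp).trans (Γ.section_congr (fun x => U x (X₀ x)) (hcs p))
    have h1 : (mfderiv 𝓘(ℝ, ℝ) 𝓘(ℝ, F) (fun r => Γ.inv (d r)) 0 (1 : ℝ) : F)
        = Γ.dInv (Γ.src (c p)) (U (Γ.src (c p))
          (mfderiv 𝓘(ℝ, F) 𝓘(ℝ, E) Γ.src (c p) (X (c p)))) := by
      refine hdi1.symm.trans ?_
      refine (mfderiv_apply_congr Γ.inv (congrArg Γ.unit (hcs p).symm) _).trans ?_
      exact congrArg (mfderiv 𝓘(ℝ, F) 𝓘(ℝ, F) Γ.inv (Γ.unit (Γ.src (c p)))) h0.symm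
    have h2 := Γ.dL_eq_of_curve (g := c p) (c := fun r => Γ.inv (d r))
      (by rw [hd0, Γ.inv_unit, hcs]) (fun r => by rw [Γ.tgt_inv, hds, hcs]) hdi h1
    exact (mfderiv_right hp).trans (h2.symm.trans (hL _ (f2 p)).symm)

variable [CompleteSpace F]

/-- The Lie derivative of the right invariant lift `R` of `U` along a right invariant vector field.
It may be evaluated on a vector field that is `t`-related to a vector field on `M`, where the
vanishing of the torsion of `R` reduces it to the bracket of `(TM)_N`. -/
theorem IsIntegratingMap.lieDerivative_rightLift (hU : Γ.IsIntegratingMap U) {x : M}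
    {X : ∀ g : G, TangentSpace 𝓘(ℝ, F) g} {X₀ Y₀ : ∀ x : M, TangentSpace 𝓘(ℝ, E) x}
    (hX : SmoothFieldAt X (Γ.unit x)) (hX₀ : SmoothFieldAt X₀ x) (hY₀ : SmoothFieldAt Y₀ x)
    (hXx : (X (Γ.unit x) : F) = mfderiv 𝓘(ℝ, E) 𝓘(ℝ, F) Γ.unit x (X₀ x)) :
    (mlieBracket 𝓘(ℝ, F) (Γ.rightInvariant fun x => U x (Y₀ x)) (fun h => Γ.rightLift U h (X h))
        (Γ.unit x)
      - Γ.rightLift U (Γ.unit x)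
          (mlieBracket 𝓘(ℝ, F) (Γ.rightInvariant fun x => U x (Y₀ x)) X (Γ.unit x)) : F)
      = (U x (mlieBracket 𝓘(ℝ, E) Y₀ (fun y => anchorTensor U y (X₀ y)) x
          - anchorTensor U x (mlieBracket 𝓘(ℝ, E) Y₀ X₀ x))).1 := by
  have hN := smoothTensor_anchorTensor hU.isBundleMap
  have hX₀' : SmoothFieldAt X₀ (Γ.tgt (Γ.unit x)) := by rwa [Γ.tgt_unit]
  have hY₀' : SmoothFieldAt Y₀ (Γ.tgt (Γ.unit x)) := by rwa [Γ.tgt_unit]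
  have hYR := smoothFieldAt_rightInvariant_comp hU.isBundleMap hY₀'
  have h0 : (X₀ x : E) = X₀ (Γ.tgt (Γ.unit x)) := by rw [Γ.tgt_unit]
  obtain ⟨X', hX', hX'x, hXX⟩ := exists_lift (Γ.submersionAt_tgt (Γ.unit x)) hX₀' (X (Γ.unit x))
    ((congrArg (mfderiv 𝓘(ℝ, F) 𝓘(ℝ, E) Γ.tgt (Γ.unit x)) hXx).trans
      ((Γ.mfderiv_tgt_unit x _).trans h0))
  refine (lieDerivative_tensor_congr (Γ.smoothTensor_rightLift hU.isBundleMap) hX hX'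
    hX'x.symm).trans ?_
  have hRX : (fun h => Γ.rightLift U h (X' h)) =ᶠ[𝓝 (Γ.unit x)]
      Γ.rightInvariant fun x => U x (X₀ x) :=
    hXX.mono fun h hh => congrArg (fun v => Γ.dR h (U (Γ.tgt h) v)) hh
  have e1 := (hU.map_bracket x hY₀ hX₀).symm
  have e2 := mfderiv_mlieBracket_of_related (Γ.contMDiffAt_tgt (Γ.unit x)) hYR hX'
    (hN.smoothFieldAt hY₀') hX₀' (Eventually.of_forall fun h => Γ.mfderiv_tgt_dR h _) hXX
  have e3 : (mlieBracket 𝓘(ℝ, E) (fun y => anchorTensor U y (Y₀ y)) X₀ (Γ.tgt (Γ.unit x)) : E)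
      = mlieBracket 𝓘(ℝ, E) (fun y => anchorTensor U y (Y₀ y)) X₀ x := by rw [Γ.tgt_unit]
  have e4 := (rightLift_unit (U := U) x
    (mlieBracket 𝓘(ℝ, F) (Γ.rightInvariant fun x => U x (Y₀ x)) X' (Γ.unit x))).trans
      (Γ.bundleMap_congr U rfl (e2.trans e3))
  refine (congrArg₂ (fun a b : F => a - b)
    ((((EventuallyEq.refl _ _).mlieBracket_vectorField_eq hRX)).trans e1) e4).trans ?_
  refine (congrArg Subtype.val (map_sub (U x) _ _).symm).trans ?_
  refine Γ.bundleMap_congr U rfl ?_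
  rw [bracketN]
  abel

/-- The Lie derivative of the left invariant lift of `U` along a right invariant vector field vanishes
at the units, in the directions of the manifold of units. -/
theorem lieDerivative_leftLift (hU : Γ.IsBundleMap U) {x : M}
    {X : ∀ g : G, TangentSpace 𝓘(ℝ, F) g} {X₀ Y₀ : ∀ x : M, TangentSpace 𝓘(ℝ, E) x}
    (hX : SmoothFieldAt X (Γ.unit x)) (hX₀ : SmoothFieldAt X₀ x) (hY₀ : SmoothFieldAt Y₀ x)
    (hXx : (X (Γ.unit x) : F) = mfderiv 𝓘(ℝ, E) 𝓘(ℝ, F) Γ.unit x (X₀ x)) :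
    mlieBracket 𝓘(ℝ, F) (Γ.rightInvariant fun x => U x (Y₀ x)) (fun h => Γ.leftLift U h (X h))
        (Γ.unit x)
      - Γ.leftLift U (Γ.unit x)
          (mlieBracket 𝓘(ℝ, F) (Γ.rightInvariant fun x => U x (Y₀ x)) X (Γ.unit x)) = 0 := by
  have hX₀' : SmoothFieldAt X₀ (Γ.src (Γ.unit x)) := by rwa [Γ.src_unit]
  have hY₀' : SmoothFieldAt Y₀ (Γ.tgt (Γ.unit x)) := by rwa [Γ.tgt_unit]
  have h0 : (X₀ x : E) = X₀ (Γ.src (Γ.unit x)) := by rw [Γ.src_unit]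
  obtain ⟨X', hX', hX'x, hXX⟩ := exists_lift (Γ.submersionAt_src (Γ.unit x)) hX₀' (X (Γ.unit x))
    ((congrArg (mfderiv 𝓘(ℝ, F) 𝓘(ℝ, E) Γ.src (Γ.unit x)) hXx).trans
      ((Γ.mfderiv_src_unit x _).trans h0))
  refine (lieDerivative_tensor_congr (Γ.smoothTensor_leftLift hU) hX hX' hX'x.symm).trans ?_
  rw [mlieBracket_rightInvariant_leftLift hU hX' hY₀ hXX, zero_sub, neg_eq_zero]
  have e2 := mfderiv_mlieBracket_of_related (V' := 0) (Γ.contMDiffAt_src (Γ.unit x))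
    (smoothFieldAt_rightInvariant_comp hU hY₀') hX'
    (Bundle.contMDiff_zeroSection ℝ (TangentSpace 𝓘(ℝ, E) : M → Type _)).contMDiffAt hX₀'
    (Eventually.of_forall fun h => Γ.mfderiv_src_dR h _) hXX
  rw [mlieBracket_zero_left] at e2
  have e3 := congrArg (fun v : E =>
    (Γ.dL (Γ.unit x) (Γ.dInv _ (U (Γ.src (Γ.unit x)) v)) : F)) e2
  refine Eq.trans e3 ?_
  have e4 : (Γ.dL (Γ.unit x)).comp
      ((Γ.dInv (Γ.src (Γ.unit x))).comp (U (Γ.src (Γ.unit x)))) 0 = 0 :=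
    map_zero _
  exact e4

/-- The Lie derivative of `δU` along the right invariant extension of `U Y₀` corresponds to the Lie
derivative of `ρ ∘ U` along `Y₀`. -/
theorem IsIntegratingMap.lieDerivative_delta (hU : Γ.IsIntegratingMap U) {x : M}
    {X : ∀ g : G, TangentSpace 𝓘(ℝ, F) g} {X₀ Y₀ : ∀ x : M, TangentSpace 𝓘(ℝ, E) x}
    (hX : SmoothFieldAt X (Γ.unit x)) (hX₀ : SmoothFieldAt X₀ x) (hY₀ : SmoothFieldAt Y₀ x)
    (hXx : (X (Γ.unit x) : F) = mfderiv 𝓘(ℝ, E) 𝓘(ℝ, F) Γ.unit x (X₀ x)) :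
    (mlieBracket 𝓘(ℝ, F) (Γ.rightInvariant fun x => U x (Y₀ x)) (fun h => Γ.delta U h (X h))
        (Γ.unit x)
      - Γ.delta U (Γ.unit x)
          (mlieBracket 𝓘(ℝ, F) (Γ.rightInvariant fun x => U x (Y₀ x)) X (Γ.unit x)) : F)
      = (U x (mlieBracket 𝓘(ℝ, E) Y₀ (fun y => anchorTensor U y (X₀ y)) x
          - anchorTensor U x (mlieBracket 𝓘(ℝ, E) Y₀ X₀ x))).1 := by
  have e1 := hU.lieDerivative_rightLift hX hX₀ hY₀ hXx
  have e2 := lieDerivative_leftLift hU.isBundleMap hX hX₀ hY₀ hXx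
  have : IsManifold 𝓘(ℝ, F) (minSmoothness ℝ 2) G := .of_le (n := ∞) two_le_smooth
  have e3 := mlieBracket_add_right (V := Γ.rightInvariant fun x => U x (Y₀ x))
    (((Γ.smoothTensor_rightLift hU.isBundleMap).smoothFieldAt hX).mdifferentiableAt (by simp))
    (((Γ.smoothTensor_leftLift hU.isBundleMap).smoothFieldAt hX).mdifferentiableAt (by simp))
  have e4 : (fun h => Γ.delta U h (X h))
      = (fun h => Γ.rightLift U h (X h)) + fun h => Γ.leftLift U h (X h) := rfl
  rw [← e1, e4, e3]
  have e5 : ∀ v : TangentSpace 𝓘(ℝ, F) (Γ.unit x), Γ.delta U (Γ.unit x) v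
      = Γ.rightLift U (Γ.unit x) v + Γ.leftLift U (Γ.unit x) v := fun _ => rfl
  rw [e5, add_sub_add_comm, e2, add_zero]

/-- Under `U`, the derivative of `δU` is the tangent lift of `ρ ∘ U`. In the coordinates of the
preferred charts this is the identity of `IsIntegratingMap.lieDerivative_delta` for vector fields
with constant coordinates. -/
theorem IsIntegratingMap.tangentMap_tangentLift (hU : Γ.IsIntegratingMap U)
    (z : TangentBundle 𝓘(ℝ, E).tangent (TangentBundle 𝓘(ℝ, E) M)) :
    tangentMap 𝓘(ℝ, E).tangent 𝓘(ℝ, F).tangent (Γ.bundleMap U) (tangentLift (anchorTensor U) z)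
      = Γ.derivative (Γ.delta U)
          (tangentMap 𝓘(ℝ, E).tangent 𝓘(ℝ, F).tangent (Γ.bundleMap U) z) := by
  obtain ⟨⟨x, v⟩, wz⟩ := z
  obtain ⟨w, ζ⟩ : E × E := wz
  change E at v
  have hN := smoothTensor_anchorTensor hU.isBundleMap
  have hT : SmoothTensor (Γ.delta U) :=
    (Γ.smoothTensor_rightLift hU.isBundleMap).add (Γ.smoothTensor_leftLift hU.isBundleMap)
  -- the derivatives of `N`, `U` and `δU` in the preferred charts
  let N : E →L[ℝ] E := anchorTensor U x
  let A : E →L[ℝ] F := (Γ.Alg x).subtypeL.comp (U x)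
  let T : F →L[ℝ] F := Γ.delta U (Γ.unit x)
  let ι : E →L[ℝ] F := mfderiv 𝓘(ℝ, E) 𝓘(ℝ, F) Γ.unit x
  let DN : E →L[ℝ] E := fderiv ℝ (fieldCoord x fun y => anchorTensor U y (constField x w y))
    (extChartAt 𝓘(ℝ, E) x x)
  let DA : E →L[ℝ] F := fderiv ℝ (fun e => fiberCoord (Γ.unit x) (Γ.bundleMap U
    ⟨(extChartAt 𝓘(ℝ, E) x).symm e, constField x v ((extChartAt 𝓘(ℝ, E) x).symm e)⟩))
    (extChartAt 𝓘(ℝ, E) x x)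
  let X : ∀ g : G, TangentSpace 𝓘(ℝ, F) g := constField (Γ.unit x) (ι w)
  let Y : ∀ g : G, TangentSpace 𝓘(ℝ, F) g := Γ.rightInvariant fun y => U y (constField x v y)
  let DT : F →L[ℝ] F := fderiv ℝ (fieldCoord (Γ.unit x) fun h => Γ.delta U h (X h))
    (extChartAt 𝓘(ℝ, F) (Γ.unit x) (Γ.unit x))
  let DY : F →L[ℝ] F := fderiv ℝ (fieldCoord (Γ.unit x) Y)
    (extChartAt 𝓘(ℝ, F) (Γ.unit x) (Γ.unit x))
  have hY : SmoothFieldAt Y (Γ.unit x) := smoothFieldAt_rightInvariant_comp hU.isBundleMap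
    (by rw [Γ.tgt_unit]; exact smoothFieldAt_constField x v)
  have hYu : ∀ y, (Y (Γ.unit y) : F) = (U y (constField x v y)).1 := fun y =>
    (Γ.dR_unit y _).trans (Γ.section_congr (fun y => U y (constField x v y)) (Γ.tgt_unit y))
  have hYx : (Y (Γ.unit x) : F) = A v := (hYu x).trans (congrArg A (constField_self x v))
  have hXx : (X (Γ.unit x) : F) = ι w := constField_self _ _
  have hTι : ∀ w, T (ι w) = ι (N w) := delta_mfderiv_unit x
  have hTA : ∀ w, T (A w) = A (N w) := delta_apply_alg x
  -- the right invariant field extends the section `U` of constant coordinates on the units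
  have hDY : ∀ e, DY (ι e) = DA e := by
    intro e
    have hs : ContMDiffAt 𝓘(ℝ, E) 𝓘(ℝ, F).tangent ∞
        (fun y => Γ.bundleMap U ⟨y, constField x v y⟩) x :=
      ContMDiffAt.comp x (g := Γ.bundleMap U) (hU.isBundleMap _) (smoothFieldAt_constField x v)
    have h1 := mfderiv_to_tangentBundle hs e
    have h2 := mfderiv_mfderiv (f := fun h => (⟨h, Y h⟩ : TangentBundle 𝓘(ℝ, F) G)) (r := Γ.unit)
      (h := fun y => Γ.bundleMap U ⟨y, constField x v y⟩) (x := x) rfl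
      (hY.mdifferentiableAt (by simp)) (Γ.mdifferentiableAt_unit x)
      (Eventually.of_forall fun y =>
        congrArg (fun v : F => (⟨Γ.unit y, v⟩ : TangentBundle 𝓘(ℝ, F) G)) (hYu y)) e
    have h3 := mfderiv_to_tangentBundle hY (ι e)
    exact congrArg Prod.snd (h3.symm.trans (h2.trans h1))
  have key : DA (N w) + A (DN v) = DT (A v) + T (DA w) := by
    have k := hU.lieDerivative_delta (X := X) (X₀ := constField x w) (Y₀ := constField x v)
      (smoothFieldAt_constField _ _) (smoothFieldAt_constField _ _) (smoothFieldAt_constField _ _)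
      (hXx.trans (congrArg ι (constField_self x w)).symm)
    have b1 : (mlieBracket 𝓘(ℝ, F) Y (fun h => Γ.delta U h (X h)) (Γ.unit x) : F)
        = DT (A v) - DY (ι (N w)) := by
      refine (mlieBracket_eq_fderiv _ _ _).trans ?_
      exact congrArg₂ (fun a b : F => a - b) (congrArg DT hYx)
        (congrArg DY ((congrArg T hXx).trans (hTι w)))
    have b2 : (mlieBracket 𝓘(ℝ, F) Y X (Γ.unit x) : F) = - DY (ι w) := by
      refine (mlieBracket_eq_fderiv _ _ _).trans ?_
      rw [fderiv_fieldCoord_constField]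
      exact (zero_sub _).trans (congrArg (fun a : F => - DY a) hXx)
    have b3 : (mlieBracket 𝓘(ℝ, E) (constField x v)
        (fun y => anchorTensor U y (constField x w y)) x : E) = DN v := by
      refine (mlieBracket_eq_fderiv _ _ _).trans ?_
      rw [fderiv_fieldCoord_constField (M := M)]
      exact (sub_zero _).trans (congrArg DN (constField_self x v))
    have b4 : (mlieBracket 𝓘(ℝ, E) (constField x v) (constField x w) x : E) = 0 := by
      refine (mlieBracket_eq_fderiv _ _ _).trans ?_
      rw [fderiv_fieldCoord_constField (M := M), fderiv_fieldCoord_constField (M := M)]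
      exact sub_zero _
    have k' : (DT (A v) - DY (ι (N w))) - T (- DY (ι w)) = A (DN v - N 0) :=
      (congrArg₂ (fun a b : F => a - T b) b1 b2).symm.trans
        (k.trans (congrArg₂ (fun a b : E => A (a - N b)) b3 b4))
    rw [hDY, hDY, map_neg, map_zero, sub_zero, sub_neg_eq_add, sub_add_eq_add_sub,
      sub_eq_iff_eq_add] at k'
    rw [k', add_comm]
  have e1 := tangentLift_mk hN x v w ζ
  have e2 := fun w ζ : E => mfderiv_fiberwiseMap (f := Γ.unit)
    (A := fun y => (Γ.Alg y).subtypeL.comp (U y)) (x := x) (v := v) (hU.isBundleMap _) w ζ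
  have e2' : ∀ w ζ : E, tangentMap 𝓘(ℝ, E).tangent 𝓘(ℝ, F).tangent (Γ.bundleMap U)
      ⟨⟨x, v⟩, ((w, ζ) : E × E)⟩ = ⟨⟨Γ.unit x, A v⟩, ((ι w, DA w + A ζ) : F × F)⟩ := fun w ζ =>
    congrArg (fun p : F × F => (⟨⟨Γ.unit x, A v⟩, p⟩ :
      TangentBundle 𝓘(ℝ, F).tangent (TangentBundle 𝓘(ℝ, F) G))) (e2 w ζ)
  have e3 := tangentLift_mk hT (Γ.unit x) (A v) (ι w) (DA w + A ζ)
  refine (congrArg (tangentMap 𝓘(ℝ, E).tangent 𝓘(ℝ, F).tangent (Γ.bundleMap U)) e1).trans ?_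
  refine (e2' _ _).trans ?_
  refine Eq.trans ?_ ((congrArg (tangentLift (Γ.delta U)) (e2' w ζ)).trans e3).symm
  refine congrArg (fun p : F × F => (⟨⟨Γ.unit x, A v⟩, p⟩ :
    TangentBundle 𝓘(ℝ, F).tangent (TangentBundle 𝓘(ℝ, F) G))) (Prod.ext (hTι w).symm ?_)
  change DA (N w) + A (DN v + N ζ) = DT (A v) + T (DA w + A ζ)
  rw [map_add, map_add, hTA, ← add_assoc, ← add_assoc, key]

end LieGroupoid

end NijenhuisGroupoid

end

open NijenhuisGroupoid in
theorem theorem2 {E F : Type*} [NormedAddCommGroup E] [NormedSpace ℝ E] [FiniteDimensional ℝ E]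
    [NormedAddCommGroup F] [NormedSpace ℝ F] [FiniteDimensional ℝ F]
    {M G : Type*} [TopologicalSpace M] [T2Space M] [ChartedSpace E M] [IsManifold 𝓘(ℝ, E) ∞ M]
    [TopologicalSpace G] [ChartedSpace F G] [IsManifold 𝓘(ℝ, F) ∞ G]
    (Γ : LieGroupoid E F M G) :
    ((∃ N : ∀ x : M, TangentSpace 𝓘(ℝ, E) x →L[ℝ] TangentSpace 𝓘(ℝ, E) x,
        IsNijenhuis N ∧ Γ.Integrates N) ↔
      ∃ U : ∀ x : M, TangentSpace 𝓘(ℝ, E) x →L[ℝ] Γ.Alg x, Γ.IsIntegratingMap U) ∧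
    ∀ U : ∀ x : M, TangentSpace 𝓘(ℝ, E) x →L[ℝ] Γ.Alg x, Γ.IsIntegratingMap U →
      ∃ N : ∀ x : M, TangentSpace 𝓘(ℝ, E) x →L[ℝ] TangentSpace 𝓘(ℝ, E) x,
        Γ.SrcRelated (Γ.delta U) N ∧ Γ.TgtRelated (Γ.delta U) N ∧
        IsNijenhuis N ∧ Γ.IsLieAlgebroidIso N U ∧
        ∀ z : TangentBundle 𝓘(ℝ, E).tangent (TangentBundle 𝓘(ℝ, E) M),
          tangentMap 𝓘(ℝ, E).tangent 𝓘(ℝ, F).tangent (Γ.bundleMap U) (tangentLift N z)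
            = Γ.derivative (Γ.delta U)
                (tangentMap 𝓘(ℝ, E).tangent 𝓘(ℝ, F).tangent (Γ.bundleMap U) z) := by
  refine ⟨⟨fun ⟨N, _, Φ, hΦ⟩ => ⟨Φ, hΦ.isIntegratingMap⟩,
    fun ⟨U, hU⟩ => ⟨_, hU.isNijenhuis, U, hU.isLieAlgebroidIso⟩⟩, fun U hU => ?_⟩
  have : CompleteSpace F := FiniteDimensional.complete ℝ F
  exact ⟨LieGroupoid.anchorTensor U, LieGroupoid.srcRelated_delta, LieGroupoid.tgtRelated_delta,
    hU.isNijenhuis, hU.isLieAlgebroidIso, hU.tangentMap_tangentLift⟩
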